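/- **Setting.** Let $R$ be an irreducible, reduced, crystallographic root system spanning a finite-dimensional real Euclidean space $V$, with positive roots $R^+$, simple roots $\alpha_1,\dots,\alpha_n$, coroots $\alpha^\vee=2\alpha/\langle\alpha,\alpha\rangle$, weight lattice $P=\{\lambda\in V\mid\langle\lambda,\alpha^\vee\rangle\in\mathbb Z\ \forall\alpha\in R\}$ and dominant weights $P^+=\{\lambda\in P\mid \langle\lambda,\alpha^\vee\rangle\ge 0\ \forall\alpha\in R^+\}$. For $\alpha\in R^+$ and $k\in\mathbb Z$ let $s_{\alpha,k}$ be the orthogonal reflection across $V_{\alpha,k}=\{x\in V\mid\langle x,\alpha^\vee\rangle=k\}$, and for $\lambda\in P$ let $t_\lambda(x)=x+\lambda$. Let $W_0$ be the finite Weyl group generated by the $s_{\alpha,0}$, and $W$ the extended affine Weyl group generated by $W_0$ and the $t_\lambda$, $\lambda\in P$. The length $\ell(w)$ of $w\in W$ is the number of hyperplanes $V_{\alpha,k}$ that separate $A$ and $wA$, where $A=\{x\in V\mid 0<\langle x,\alpha^\vee\rangle<1\ \forall\alpha\in R^+\}$. Put $s_j=s_{\alpha_j,0}$ for $1\le j\le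 n$ and $s_0=s_{\alpha_0,1}$, where $\alpha_0^\vee$ is the highest root of $R^\vee$. Let $q:W\to\mathbb R\setminus\{0\}$ satisfy $q_{ww'}=q_wq_{w'}$ whenever $\ell(ww')=\ell(w)+\ell(w')$, and $q_w=1$ whenever $\ell(w)=0$; write $q_j=q_{s_j}$. The affine Hecke algebra $\mathcal H$ is the unital associative $\mathbb C$-algebra generated by elements $T_w$, $w\in W$, with the relations $T_1=1$, $T_{ww'}=T_wT_{w'}$ if $\ell(ww')=\ell(w)+\ell(w')$, and $(T_j-q_j)(T_j+q_j^{-1})=0$ for $T_j=T_{s_j}$, $0\le j\le n$. For $\lambda\in P$ put $Y^\lambda=T_{t_\mu}T_{t_\nu}^{-1}$, where $\mu,\nu\in P^+$ and $\lambda=\mu-\nu$ (this does not depend on the choice of $\mu,\nu$). On $C(P)=\{f:P\to\mathbb C\}$ let $(t_\lambda f)(\mu)=f(\mu-\lambda)$ and $(s_jf)(\lambda)=f(s_j\lambda)$, and for $1\le j\le n$ let $I_j=q_js_j+(q_j-q_j^{-1})J_j$, where $$(J_jf)(\lambda)=\begin{cases}-f(\lambda-\alpha_j)-f(\lambda-2\alpha_j)-\cdots-f(s_j\lambda)&\text{if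 }\langle\lambda,\alpha_j^\vee\rangle>0,\\ 0&\text{if }\langle\lambda,\alpha_j^\vee\rangle=0,\\ f(\lambda)+f(\lambda+\alpha_j)+\cdots+f(s_j\lambda-\alpha_j)&\text{if }\langle\lambda,\alpha_j^\vee\rangle<0.\end{cases}$$ On the group algebra $\mathbb C[P]$, with basis $e^\lambda$ ($\lambda\in P$) and $s_je^\lambda=e^{s_j\lambda}$, let $\check T_j=q_js_j+(q_j-q_j^{-1})(1-e^{-\alpha_j})^{-1}(1-s_j)$ for $1\le j\le n$ (the Demazure–Lusztig operators). For $f\in C(P)$ and $p=\sum_\lambda c_\lambda e^\lambda\in\mathbb C[P]$ let $(f,p)=\sum_\lambda\overline{c_\lambda}\,(t_\lambda f)(0)=\sum_\lambda\overline{c_\lambda}\,f(-\lambda)$. **Statement.** 1. The assignment $T_j\mapsto I_j$ ($1\le j\le n$), $Y^\lambda\mapsto t_\lambda$ ($\lambda\in P$) extends uniquely to a representation $h\mapsto I(h)$ of $\mathcal H$ on $C(P)$. 2. The assignment $T_j\mapsto\check T_j$ ($1\le j\le n$), $Y^\lambda\mapsto e^\lambda$ (acting by multiplication, $\lambda\in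 P$) extends uniquely to a representation $h\mapsto\check T(h)$ of $\mathcal H$ on $\mathbb C[P]$. 3. The assignment $T_wY^\lambda\mapsto Y^\lambda T_{w^{-1}}$ ($w\in W_0$, $\lambda\in P$) extends uniquely to an antilinear anti-involution $h\mapsto h^\star$ of $\mathcal H$. 4. The representation $I$ is dual to $\check T$: $(I(h)f,p)=(f,\check T(h^\star)p)$ for all $h\in\mathcal H$, $f\in C(P)$ and $p\in\mathbb C[P]$. -/

import Mathlib

noncomputable section

namespace AffineHecke

variable {ι V N : Type*} [AddCommGroup V] [Module ℝ V] [AddCommGroup N] [Module ℝ N]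

/-! ### The weight lattice -/

/-- The weight lattice `P = {λ ∈ V | ⟨λ, α^∨⟩ ∈ ℤ for all roots α}`. -/
def weightLattice (Φ : RootPairing ι ℝ V N) : AddSubgroup V where
  carrier := {v | ∀ i, ∃ z : ℤ, (z : ℝ) = Φ.coroot' i v}
  zero_mem' := fun _ => ⟨0, by simp⟩
  add_mem' := by
    intro v w hv hw i
    obtain ⟨a, ha⟩ := hv i
    obtain ⟨c, hc⟩ := hw i
    exact ⟨a + c, by rw [map_add, ← ha, ← hc]; push_cast; rfl⟩
  neg_mem' := by
    intro v hv i
    obtain ⟨a, ha⟩ := hv i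
    exact ⟨-a, by rw [map_neg, ← ha]; push_cast; rfl⟩

/-- The integer `⟨λ, α_i^∨⟩`, for a weight `λ`. -/
def wtPair (Φ : RootPairing ι ℝ V N) (i : ι) (l : weightLattice Φ) : ℤ :=
  (l.2 i).choose

theorem wtPair_cast (Φ : RootPairing ι ℝ V N) (i : ι) (l : weightLattice Φ) :
    (wtPair Φ i l : ℝ) = Φ.coroot' i (l : V) :=
  (l.2 i).choose_spec

/-- A root, as an element of the weight lattice. -/
def rootWt (Φ : RootPairing ι ℝ V N) [Φ.IsCrystallographic] (i : ι) : weightLattice Φ :=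
  ⟨Φ.root i, fun j => by
    obtain ⟨z, hz⟩ := Φ.exists_value (S := ℤ) i j
    exact ⟨z, by simpa using hz⟩⟩

/-- The action of the reflection `s_α` on the weight lattice. -/
def wtRefl (Φ : RootPairing ι ℝ V N) [Φ.IsCrystallographic] (i : ι) (l : weightLattice Φ) :
    weightLattice Φ :=
  l - wtPair Φ i l • rootWt Φ i

theorem wtRefl_coe (Φ : RootPairing ι ℝ V N) [Φ.IsCrystallographic] (i : ι)
    (l : weightLattice Φ) : (wtRefl Φ i l : V) = Φ.reflection i (l : V) := by
  rw [RootPairing.reflection_apply, ← wtPair_cast, Int.cast_smul_eq_zsmul]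
  rfl

/-- The cone `P^+` of dominant weights. -/
def IsDominant {Φ : RootPairing ι ℝ V N} (b : Φ.Base) (l : weightLattice Φ) : Prop :=
  ∀ i, b.IsPos i → 0 ≤ Φ.coroot' i (l : V)

/-! ### The extended affine Weyl group and its length function -/

/-- The reflection `s_{α,k} : x ↦ x - (⟨x, α^∨⟩ - k) α` across the hyperplane
`V_{α,k} = {x | ⟨x, α^∨⟩ = k}`. -/
def affRefl (Φ : RootPairing ι ℝ V N) (i : ι) (k : ℤ) : V ≃ᵃ[ℝ] V :=
  AffineEquiv.constVAdd ℝ V ((k : ℝ) • Φ.root i) * (Φ.reflection i).toAffineEquiv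

theorem affRefl_apply (Φ : RootPairing ι ℝ V N) (i : ι) (k : ℤ) (x : V) :
    affRefl Φ i k x = x - (Φ.coroot' i x - k) • Φ.root i := by
  have h : affRefl Φ i k x = (k : ℝ) • Φ.root i + Φ.reflection i x := rfl
  rw [h, RootPairing.reflection_apply, sub_smul]
  abel

/-- The finite Weyl group `W₀`, generated by the reflections `s_{α,0}`. -/
def finWeyl (Φ : RootPairing ι ℝ V N) : Subgroup (V ≃ᵃ[ℝ] V) :=
  Subgroup.closure (Set.range fun i => affRefl Φ i 0)

/-- The extended affine Weyl group `W`, generated by `W₀` and the translations `t_λ`, `λ ∈ P`. -/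
def affWeyl (Φ : RootPairing ι ℝ V N) : Subgroup (V ≃ᵃ[ℝ] V) :=
  Subgroup.closure ((finWeyl Φ : Set (V ≃ᵃ[ℝ] V)) ∪
    Set.range fun l : weightLattice Φ => AffineEquiv.constVAdd ℝ V (l : V))

/-- The translation `t_λ : x ↦ x + λ`, as an element of `W`. -/
def trans (Φ : RootPairing ι ℝ V N) (l : weightLattice Φ) : affWeyl Φ :=
  ⟨AffineEquiv.constVAdd ℝ V (l : V), Subgroup.subset_closure (Or.inr ⟨l, rfl⟩)⟩

/-- The reflection `s_{α,k}`, as an element of `W`. -/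
def refl (Φ : RootPairing ι ℝ V N) [Φ.IsCrystallographic] (i : ι) (k : ℤ) : affWeyl Φ :=
  ⟨affRefl Φ i k, by
    have h0 : affRefl Φ i 0 ∈ affWeyl Φ :=
      Subgroup.subset_closure (Or.inl (Subgroup.subset_closure ⟨i, rfl⟩))
    have h : affRefl Φ i k =
        (trans Φ (k • rootWt Φ i) : V ≃ᵃ[ℝ] V) * affRefl Φ i 0 := by
      ext x
      have hr : ((trans Φ (k • rootWt Φ i) : V ≃ᵃ[ℝ] V) * affRefl Φ i 0) x =
        k • Φ.root i + affRefl Φ i 0 x := rfl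
      rw [hr, affRefl_apply, affRefl_apply, ← Int.cast_smul_eq_zsmul ℝ, sub_smul, Int.cast_zero,
        sub_zero]
      abel
    rw [h]
    exact (affWeyl Φ).mul_mem (trans Φ (k • rootWt Φ i)).2 h0⟩

/-- The Weyl alcove `A = {x | 0 < ⟨x, α^∨⟩ < 1 for all positive roots α}`. -/
def alcove {Φ : RootPairing ι ℝ V N} (b : Φ.Base) : Set V :=
  {x | ∀ i, b.IsPos i → 0 < Φ.coroot' i x ∧ Φ.coroot' i x < 1}

/-- The hyperplane `V_{α,k}` separates `X` and `Y`: these lie in the two different open half-spaces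
that are the connected components of `V \ V_{α,k}`. -/
def Separates (Φ : RootPairing ι ℝ V N) (i : ι) (k : ℤ) (X Y : Set V) : Prop :=
  ((∀ x ∈ X, Φ.coroot' i x < k) ∧ ∀ y ∈ Y, k < Φ.coroot' i y) ∨
    ((∀ x ∈ X, k < Φ.coroot' i x) ∧ ∀ y ∈ Y, Φ.coroot' i y < k)

/-- The length `ℓ(w)`: the number of hyperplanes `V_{α,k}` (`α` a positive root, `k ∈ ℤ`) that
separate `A` and `wA`. As the root system is reduced, the pairs `(α, k)` parametrize the
hyperplanes without repetition. -/
def length {Φ : RootPairing ι ℝ V N} (b : Φ.Base) (w : affWeyl Φ) : ℕ :=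
  Set.ncard {p : ι × ℤ | b.IsPos p.1 ∧
    Separates Φ p.1 p.2 (alcove b) ((w : V ≃ᵃ[ℝ] V) '' alcove b)}

/-- `α_i^∨` is the highest root of the dual root system: `α_i^∨ - α_j^∨` is a sum of simple coroots
for every `j`. -/
def IsHighestCoroot {Φ : RootPairing ι ℝ V N} (b : Φ.Base) (i : ι) : Prop :=
  ∀ j, Φ.coroot i - Φ.coroot j ∈ AddSubmonoid.closure (Φ.coroot '' b.support)

/-- `s` is one of `s_0 = s_{α_0,1}, s_1 = s_{α_1,0}, …, s_n = s_{α_n,0}`, with `α_1, …, α_n` the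
simple roots and `α_0^∨` the highest root of the dual root system. -/
def IsSimpleRefl {Φ : RootPairing ι ℝ V N} [Φ.IsCrystallographic] (b : Φ.Base)
    (s : affWeyl Φ) : Prop :=
  (∃ i, IsHighestCoroot b i ∧ s = refl Φ i 1) ∨ ∃ i ∈ b.support, s = refl Φ i 0

/-! ### The affine Hecke algebra -/

/-- A length multiplicative function `q : W → ℝ \ {0}`. -/
structure IsLengthMultiplicative {Φ : RootPairing ι ℝ V N} (b : Φ.Base) (q : affWeyl Φ → ℝ) :
    Prop where
  ne_zero : ∀ w, q w ≠ 0
  map_mul : ∀ w w', length b (w * w') = length b w + length b w' → q (w * w') = q w * q w'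
  map_length_zero : ∀ w, length b w = 0 → q w = 1

/-- The defining relations of the affine Hecke algebra, on generators `T_w`, `w ∈ W`. -/
inductive HeckeRel {Φ : RootPairing ι ℝ V N} [Φ.IsCrystallographic] (b : Φ.Base)
    (q : affWeyl Φ → ℝ) : FreeAlgebra ℂ (affWeyl Φ) → FreeAlgebra ℂ (affWeyl Φ) → Prop
  | one : HeckeRel b q (FreeAlgebra.ι ℂ 1) 1
  | braid (w w' : affWeyl Φ) (h : length b (w * w') = length b w + length b w') :
      HeckeRel b q (FreeAlgebra.ι ℂ (w * w')) (FreeAlgebra.ι ℂ w * FreeAlgebra.ι ℂ w')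
  | quadratic (s : affWeyl Φ) (h : IsSimpleRefl b s) :
      HeckeRel b q
        ((FreeAlgebra.ι ℂ s - algebraMap ℂ _ (q s : ℂ)) *
          (FreeAlgebra.ι ℂ s + algebraMap ℂ _ (q s : ℂ)⁻¹)) 0

/-- The extended affine Hecke algebra `H` associated with `W` and `q`. -/
abbrev HeckeAlgebra {Φ : RootPairing ι ℝ V N} [Φ.IsCrystallographic] (b : Φ.Base)
    (q : affWeyl Φ → ℝ) : Type _ :=
  RingQuot (HeckeRel b q)

/-- The element `T_w` of the affine Hecke algebra. -/
def T {Φ : RootPairing ι ℝ V N} [Φ.IsCrystallographic] (b : Φ.Base)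
    (q : affWeyl Φ → ℝ) (w : affWeyl Φ) : HeckeAlgebra b q :=
  RingQuot.mkAlgHom ℂ (HeckeRel b q) (FreeAlgebra.ι ℂ w)

/-- A vector that is nonnegative on the simple coroots is nonnegative on the positive coroots. -/
theorem nonneg_of_simple [Finite ι] {Φ : RootPairing ι ℝ V N} [Φ.IsCrystallographic] (b : Φ.Base)
    (x : V) (hx : ∀ i ∈ b.support, 0 ≤ Φ.coroot' i x) (i : ι) (hi : b.IsPos i) :
    0 ≤ Φ.coroot' i x := by
  have := Fintype.ofFinite ι
  have key : ∀ j, Φ.RootForm (Φ.root j) (Φ.root j) * Φ.coroot' j x =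
      2 * Φ.toLinearMap x (Φ.Polarization (Φ.root j)) := by
    intro j
    have h := congrArg (fun y => Φ.toLinearMap x y) (Φ.rootForm_self_smul_coroot j)
    simpa using h
  have hpos : ∀ j, 0 < Φ.RootForm (Φ.root j) (Φ.root j) := fun j =>
    lt_of_le_of_ne (Φ.rootForm_self_sum_of_squares (Φ.root j)).nonneg
      (RootPairing.IsAnisotropic.rootForm_root_ne_zero j).symm
  have hpol : 0 ≤ Φ.toLinearMap x (Φ.Polarization (Φ.root i)) := by
    refine hi.induction_on_add (p := fun j => 0 ≤ Φ.toLinearMap x (Φ.Polarization (Φ.root j)))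
      ?_ ?_
    · intro j hj
      nlinarith [key j, mul_nonneg (hpos j).le (hx j hj)]
    · intro j k l hl hj hk
      have hk' : 0 ≤ Φ.toLinearMap x (Φ.Polarization (Φ.root k)) := by
        nlinarith [key k, mul_nonneg (hpos k).le (hx k hk)]
      rw [hl, map_add, map_add]
      exact add_nonneg hj hk'
  have h := key i
  by_contra hneg
  nlinarith [mul_pos_of_neg_of_neg (neg_neg_of_pos (hpos i)) (not_le.mp hneg)]

/-- Every weight is a difference of two dominant weights. -/
theorem exists_dominant_sub [Finite ι] {Φ : RootPairing ι ℝ V N} [Φ.IsRootSystem]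
    [Φ.IsCrystallographic] (b : Φ.Base) (l : weightLattice Φ) :
    ∃ p : weightLattice Φ × weightLattice Φ,
      IsDominant b p.1 ∧ IsDominant b p.2 ∧ l = p.1 - p.2 := by
  classical
  obtain ⟨x, hx⟩ := (LinearMap.IsPerfPair.bijective_left Φ.toLinearMap).surjective
    (b.toCoweightBasis.constr ℝ fun i : b.support => ((|wtPair Φ i l| : ℤ) : ℝ))
  have hxs : ∀ i (hi : i ∈ b.support), Φ.coroot' i x = ((|wtPair Φ i l| : ℤ) : ℝ) := by
    intro i hi
    have h := congrArg (fun f => f (b.toCoweightBasis ⟨i, hi⟩)) hx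
    simp only [Module.Basis.constr_basis] at h
    rw [← h]
    simp
  have hxP : x ∈ weightLattice Φ := by
    intro i
    have h := b.coroot_mem_span_int i
    refine Submodule.span_induction (p := fun y _ => ∃ z : ℤ, (z : ℝ) = Φ.toLinearMap x y)
      ?_ ?_ ?_ ?_ h
    · rintro _ ⟨j, hj, rfl⟩
      exact ⟨_, (hxs j hj).symm⟩
    · exact ⟨0, by simp⟩
    · rintro y z - - ⟨c, hc⟩ ⟨d, hd⟩
      exact ⟨c + d, by rw [map_add, ← hc, ← hd]; push_cast; rfl⟩
    · rintro a y - ⟨c, hc⟩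
      exact ⟨a * c, by rw [map_zsmul, ← hc]; push_cast; simp⟩
  refine ⟨(l + ⟨x, hxP⟩, ⟨x, hxP⟩), ?_, ?_, by simp⟩
  · refine fun i hi => nonneg_of_simple b _ (fun j hj => ?_) i hi
    have h : Φ.coroot' j ((l + ⟨x, hxP⟩ : weightLattice Φ) : V) =
        ((wtPair Φ j l + |wtPair Φ j l| : ℤ) : ℝ) := by
      rw [AddSubgroup.coe_add, map_add, hxs j hj, ← wtPair_cast]
      push_cast
      rfl
    rw [h]
    exact_mod_cast (by linarith [neg_abs_le (wtPair Φ j l)] :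
      0 ≤ wtPair Φ j l + |wtPair Φ j l|)
  · refine fun i hi => nonneg_of_simple b _ (fun j hj => ?_) i hi
    change 0 ≤ Φ.coroot' j x
    rw [hxs j hj]
    exact_mod_cast abs_nonneg _

/-- `Y^λ = T_{t_μ} T_{t_ν}⁻¹` for dominant weights `μ`, `ν` with `λ = μ - ν`. The elements `T_w` are
invertible, and `Y^λ` does not depend on the choice of `μ` and `ν`. -/
def Y [Finite ι] {Φ : RootPairing ι ℝ V N} [Φ.IsRootSystem] [Φ.IsCrystallographic] (b : Φ.Base)
    (q : affWeyl Φ → ℝ) (l : weightLattice Φ) : HeckeAlgebra b q :=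
  T b q (trans Φ (exists_dominant_sub b l).choose.1) *
    Ring.inverse (T b q (trans Φ (exists_dominant_sub b l).choose.2))

/-! ### Integral-reflection operators on `C(P)` -/

/-- The translation `(t_λ f)(μ) = f(μ - λ)` on `C(P)`. -/
def transOp (Φ : RootPairing ι ℝ V N) (l : weightLattice Φ) :
    Module.End ℂ (weightLattice Φ → ℂ) :=
  LinearMap.funLeft ℂ ℂ fun m => m - l

/-- The reflection `(s_α f)(λ) = f(s_α⁻¹ λ) = f(s_α λ)` on `C(P)`. -/
def reflOp (Φ : RootPairing ι ℝ V N) [Φ.IsCrystallographic] (i : ι) :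
    Module.End ℂ (weightLattice Φ → ℂ) :=
  LinearMap.funLeft ℂ ℂ (wtRefl Φ i)

/-- The discrete integral operator `J` along the `α`-string: `(J f)(λ)` is
`-f(λ - α) - f(λ - 2α) - ⋯ - f(s_α λ)` if `⟨λ, α^∨⟩ > 0`, it is `0` if `⟨λ, α^∨⟩ = 0`, and it is
`f(λ) + f(λ + α) + ⋯ + f(s_α λ - α)` if `⟨λ, α^∨⟩ < 0`. -/
def stringOp (Φ : RootPairing ι ℝ V N) [Φ.IsCrystallographic] (i : ι) :
    Module.End ℂ (weightLattice Φ → ℂ) where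
  toFun f l :=
    if 0 < wtPair Φ i l then
      -∑ k ∈ Finset.Icc 1 (wtPair Φ i l).toNat, f (l - k • rootWt Φ i)
    else if wtPair Φ i l = 0 then 0
    else ∑ k ∈ Finset.range (-wtPair Φ i l).toNat, f (l + k • rootWt Φ i)
  map_add' f g := by
    funext l
    simp only [Pi.add_apply]
    split_ifs <;> simp [Finset.sum_add_distrib, add_comm]
  map_smul' c f := by
    funext l
    simp only [Pi.smul_apply, smul_eq_mul, RingHom.id_apply]
    split_ifs <;> simp [Finset.mul_sum]

/-- The integral-reflection operator `q s_α + (q - q⁻¹) J` on `C(P)`. -/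
def intReflOp (Φ : RootPairing ι ℝ V N) [Φ.IsCrystallographic] (i : ι) (c : ℂ) :
    Module.End ℂ (weightLattice Φ → ℂ) :=
  c • reflOp Φ i + (c - c⁻¹) • stringOp Φ i

/-! ### Demazure–Lusztig operators on `ℂ[P]` -/

/-- The group algebra `ℂ[P]`; its standard basis is `e^λ = AddMonoidAlgebra.single λ 1`. -/
abbrev GroupAlg (Φ : RootPairing ι ℝ V N) : Type _ := AddMonoidAlgebra ℂ (weightLattice Φ)

/-- The basis element `e^λ` of `ℂ[P]`. -/
def e (Φ : RootPairing ι ℝ V N) (l : weightLattice Φ) : GroupAlg Φ :=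
  AddMonoidAlgebra.single l 1

/-- The linear operator on `ℂ[P]` with prescribed values on the basis `e^λ`. -/
def onBasis (Φ : RootPairing ι ℝ V N) (g : weightLattice Φ → GroupAlg Φ) :
    Module.End ℂ (GroupAlg Φ) where
  toFun p := p.coeff.sum fun l c => c • g l
  map_add' p r := by
    simp only [AddMonoidAlgebra.coeff_add]
    exact Finsupp.sum_add_index' (by simp) (by simp [add_smul])
  map_smul' c p := by
    simp only [AddMonoidAlgebra.coeff_smul, RingHom.id_apply]
    rw [Finsupp.sum_smul_index (by simp), Finsupp.smul_sum]
    simp [mul_smul]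

theorem onBasis_e (Φ : RootPairing ι ℝ V N) (g : weightLattice Φ → GroupAlg Φ)
    (l : weightLattice Φ) : onBasis Φ g (e Φ l) = g l := by
  simp [onBasis, e]

/-- The action `s_α e^λ = e^{s_α λ}` on `ℂ[P]`. -/
def reflAlg (Φ : RootPairing ι ℝ V N) [Φ.IsCrystallographic] (i : ι) :
    Module.End ℂ (GroupAlg Φ) :=
  onBasis Φ fun l => e Φ (wtRefl Φ i l)

/-- The operator `(1 - e^{-α})⁻¹ (1 - s_α)` on `ℂ[P]`, written out on the basis: `e^λ` goes to
`e^λ + e^{λ-α} + ⋯ + e^{s_α λ + α}` if `⟨λ, α^∨⟩ > 0`, to `0` if `⟨λ, α^∨⟩ = 0`, and to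
`-e^{λ+α} - e^{λ+2α} - ⋯ - e^{s_α λ}` if `⟨λ, α^∨⟩ < 0`. See `one_sub_mul_divDiff`. -/
def divDiff (Φ : RootPairing ι ℝ V N) [Φ.IsCrystallographic] (i : ι) :
    Module.End ℂ (GroupAlg Φ) :=
  onBasis Φ fun l =>
    if 0 < wtPair Φ i l then
      ∑ k ∈ Finset.range (wtPair Φ i l).toNat, e Φ (l - k • rootWt Φ i)
    else if wtPair Φ i l = 0 then 0
    else -∑ k ∈ Finset.Icc 1 (-wtPair Φ i l).toNat, e Φ (l + k • rootWt Φ i)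

theorem e_mul_e (Φ : RootPairing ι ℝ V N) (l m : weightLattice Φ) :
    e Φ l * e Φ m = e Φ (l + m) := by
  simp [e, AddMonoidAlgebra.single_mul_single]

theorem endo_ext (Φ : RootPairing ι ℝ V N) {A B : Module.End ℂ (GroupAlg Φ)}
    (h : ∀ l, A (e Φ l) = B (e Φ l)) : A = B := by
  refine LinearMap.ext fun p => ?_
  induction p using AddMonoidAlgebra.induction_linear with
  | zero => simp
  | add p r hp hr => rw [map_add, map_add, hp, hr]
  | single l c =>
  have hs : AddMonoidAlgebra.single l c = c • e Φ l := by simp [e]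
  rw [hs, map_smul, map_smul, h]

/-- `divDiff` is indeed the quotient `(1 - e^{-α})⁻¹ (1 - s_α)`. -/
theorem one_sub_mul_divDiff (Φ : RootPairing ι ℝ V N) [Φ.IsCrystallographic] (i : ι)
    (p : GroupAlg Φ) :
    (1 - e Φ (-rootWt Φ i)) * divDiff Φ i p = p - reflAlg Φ i p := by
  suffices h : LinearMap.mulLeft ℂ (1 - e Φ (-rootWt Φ i)) * divDiff Φ i = 1 - reflAlg Φ i by
    exact LinearMap.congr_fun h p
  refine endo_ext Φ fun l => ?_
  have hL : (LinearMap.mulLeft ℂ (1 - e Φ (-rootWt Φ i)) * divDiff Φ i) (e Φ l) =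
    (1 - e Φ (-rootWt Φ i)) * divDiff Φ i (e Φ l) := rfl
  have hR : (1 - reflAlg Φ i : Module.End ℂ (GroupAlg Φ)) (e Φ l) =
    e Φ l - reflAlg Φ i (e Φ l) := rfl
  rw [hL, hR, divDiff, reflAlg, onBasis_e, onBasis_e]
  split_ifs with h1 h2
  · obtain ⟨n, hn⟩ := Int.eq_ofNat_of_zero_le h1.le
    have hw : wtRefl Φ i l = l - n • rootWt Φ i := by
      rw [wtRefl, hn, natCast_zsmul]
    rw [hw, hn, Int.toNat_natCast]
    clear hw hn
    induction n with
    | zero => simp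
    | succ n ih =>
      rw [Finset.sum_range_succ, mul_add, ih, sub_mul, one_mul, e_mul_e]
      have : -rootWt Φ i + (l - n • rootWt Φ i) = l - (n + 1) • rootWt Φ i := by
        rw [add_smul, one_smul]; abel
      rw [this]; abel
  · simp [wtRefl, h2]
  · obtain ⟨n, hn⟩ := Int.eq_ofNat_of_zero_le (a := -wtPair Φ i l) (by omega)
    have hw : wtRefl Φ i l = l + n • rootWt Φ i := by
      rw [wtRefl, show wtPair Φ i l = -(n : ℤ) by omega, neg_smul, natCast_zsmul, sub_neg_eq_add]
    rw [hw, hn, Int.toNat_natCast]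
    clear hw hn
    induction n with
    | zero => simp
    | succ n ih =>
      rw [Finset.sum_Icc_succ_top (by omega), neg_add, mul_add, ih, mul_neg, sub_mul, one_mul,
        e_mul_e]
      have : -rootWt Φ i + (l + (n + 1) • rootWt Φ i) = l + n • rootWt Φ i := by
        rw [add_smul, one_smul]; abel
      rw [this]; abel

/-- The Demazure–Lusztig operator `q s_α + (q - q⁻¹) (1 - e^{-α})⁻¹ (1 - s_α)` on `ℂ[P]`. -/
def demazureLusztig (Φ : RootPairing ι ℝ V N) [Φ.IsCrystallographic] (i : ι) (c : ℂ) :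
    Module.End ℂ (GroupAlg Φ) :=
  c • reflAlg Φ i + (c - c⁻¹) • divDiff Φ i

/-! ### The pairing, and the three structures on the affine Hecke algebra -/

/-- The sesquilinear pairing `(f, p) = (p̄ f)(0)` of `C(P)` with `ℂ[P]`, where `p̄` has the complex
conjugate coefficients and `e^λ` acts on `C(P)` by `t_λ`. -/
def pairing (Φ : RootPairing ι ℝ V N) (f : weightLattice Φ → ℂ) (p : GroupAlg Φ) : ℂ :=
  p.coeff.sum fun l c => (starRingEnd ℂ) c * transOp Φ l f 0

section Representations

variable [Finite ι] {Φ : RootPairing ι ℝ V N} [Φ.IsRootSystem] [Φ.IsCrystallographic]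

/-- A representation of `H` on `C(P)` with `T_j ↦ I_j` for the simple roots `α_j`, and
`Y^λ ↦ t_λ`. -/
def IsIntReflRep (b : Φ.Base) (q : affWeyl Φ → ℝ)
    (I : HeckeAlgebra b q →ₐ[ℂ] Module.End ℂ (weightLattice Φ → ℂ)) : Prop :=
  (∀ j ∈ b.support, I (T b q (refl Φ j 0)) = intReflOp Φ j (q (refl Φ j 0))) ∧
    ∀ l, I (Y b q l) = transOp Φ l

/-- A representation of `H` on `ℂ[P]` with the `T_j` acting by the Demazure–Lusztig operators, and
`Y^λ` by multiplication with `e^λ`. -/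
def IsPolynomialRep (b : Φ.Base) (q : affWeyl Φ → ℝ)
    (R : HeckeAlgebra b q →ₐ[ℂ] Module.End ℂ (GroupAlg Φ)) : Prop :=
  (∀ j ∈ b.support, R (T b q (refl Φ j 0)) = demazureLusztig Φ j (q (refl Φ j 0))) ∧
    ∀ l, R (Y b q l) = LinearMap.mulLeft ℂ (e Φ l)

/-- An antilinear anti-involution of `H` with `T_w Y^λ ↦ Y^λ T_{w⁻¹}` for `w ∈ W₀`, `λ ∈ P`. -/
def IsStarInvolution (b : Φ.Base) (q : affWeyl Φ → ℝ)
    (σ : HeckeAlgebra b q →ₛₗ[starRingEnd ℂ] HeckeAlgebra b q) : Prop :=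
  (∀ g h, σ (g * h) = σ h * σ g) ∧ (∀ h, σ (σ h) = h) ∧
    ∀ w : affWeyl Φ, (w : V ≃ᵃ[ℝ] V) ∈ finWeyl Φ → ∀ l : weightLattice Φ,
      σ (T b q w * Y b q l) = Y b q l * T b q w⁻¹

end Representations

end AffineHecke

end

/-! The heart of the matter is Bernstein's presentation of $\mathcal H$: the elements $T_wY^\lambda$
($w\in W_0$, $\lambda\in P$) form a basis, and $T_j$ commutes past $Y$ by the relation
$T_jY(x)=Y(s_jx)T_j+(q_j-q_j^{-1})Y(D_jx)$ for $x\in\mathbb C[P]$, where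
$D_j=(1-e^{-\alpha_j})^{-1}(1-s_j)$.

Independence rests on the $T_w$, $w\in W$, being independent, which the regular representation shows
(`exists_regular_representation`, `linearIndependent_T`). Its construction needs the length function
only through a few axioms, above all the exchange condition (`isLengthSystem`). These are checked
geometrically: a signed count `crossing` of the hyperplanes between $A$ and $wA$ is a cocycle in
$w$, and $\ell$ is the sum of its absolute values over the positive roots. The Bernstein relation
(`satisfiesBernstein`) passes from two weights to their sum, so it need only be checked on
$\pm\omega_j$ and on weights orthogonal to $\alpha_j$.

Given the basis, the four claims follow. The representation $\check T$ is induced from the character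
$T_w\mapsto q_w$ of the finite Hecke algebra: the projection $Y^\lambda T_w\mapsto q_we^\lambda$
identifies the induced module with $\mathbb C[P]$, and the Bernstein relation turns the action of
$T_j$ into the Demazure–Lusztig operator. The map $\star$ is prescribed on the basis, and it is an
anti-homomorphism because the multiplication rules for $T_w$ and the Bernstein relation have
matching left and right forms (`star_mul`). Then $I(h)$ is defined as the adjoint of $\check
T(h^\star)$, so that duality holds by construction and what remains is to compute the adjoints of
the generators. Uniqueness of the representations holds because the $T_j$ ($1\le j\le n$) and the
$Y^\lambda$ generate $\mathcal H$ (`adjoin_generators`), that of $\star$ because the $T_wY^\lambda$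
span. -/

noncomputable section

namespace AffineHecke

/-! ### Abstract length functions with the exchange condition. -/

/-- A length function on a group `W` with a set `S` of simple reflections, as for an extended
affine Weyl group: a Coxeter group extended by the elements of length zero. -/
structure IsLengthSystem {W : Type*} [Group W] (len : W → ℕ) (S : Set W) : Prop where
  mul_self : ∀ s ∈ S, s * s = 1
  one : len 1 = 0
  inv : ∀ w, len w⁻¹ = len w
  mul_le : ∀ w w', len (w * w') ≤ len w + len w'
  simple_mul : ∀ s ∈ S, ∀ w, len (s * w) = len w + 1 ∨ len (s * w) + 1 = len w
  exists_descent : ∀ w, len w ≠ 0 → ∃ s ∈ S, len (s * w) + 1 = len w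
  exchange : ∀ s ∈ S, ∀ t ∈ S, ∀ w, len w < len (s * w) → len (s * w * t) < len (w * t) →
    s * w = w * t

namespace IsLengthSystem

variable {W : Type*} [Group W] {len : W → ℕ} {S : Set W} (h : IsLengthSystem len S)
include h

theorem inv_simple {s : W} (hs : s ∈ S) : s⁻¹ = s :=
  inv_eq_of_mul_eq_one_left (h.mul_self s hs)

theorem simple_mul_cancel {s : W} (hs : s ∈ S) (w : W) : s * (s * w) = w := by
  rw [← mul_assoc, h.mul_self s hs, one_mul]

theorem mul_simple_cancel {s : W} (hs : s ∈ S) (w : W) : w * s * s = w := by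
  rw [mul_assoc, h.mul_self s hs, mul_one]

theorem len_simple {s : W} (hs : s ∈ S) : len s = 1 := by
  have := h.simple_mul s hs 1
  rw [mul_one, h.one] at this
  omega

theorem mul_simple {s : W} (hs : s ∈ S) (w : W) :
    len (w * s) = len w + 1 ∨ len (w * s) + 1 = len w := by
  have := h.simple_mul s hs w⁻¹
  rwa [← h.inv (w * s), ← h.inv w, mul_inv_rev, h.inv_simple hs]

theorem zero_mul {x : W} (hx : len x = 0) (w : W) : len (x * w) = len w := by
  have h1 := h.mul_le x w
  have h2 := h.mul_le x⁻¹ (x * w)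
  rw [inv_mul_cancel_left, h.inv] at h2
  omega

theorem mul_zero {x : W} (hx : len x = 0) (w : W) : len (w * x) = len w := by
  rw [← h.inv (w * x), mul_inv_rev, h.zero_mul (by rw [h.inv, hx]), h.inv]

theorem exists_right_descent (w : W) (hw : len w ≠ 0) : ∃ s ∈ S, len (w * s) + 1 = len w := by
  obtain ⟨s, hs, hsw⟩ := h.exists_descent w⁻¹ (by rwa [h.inv])
  refine ⟨s, hs, ?_⟩
  rwa [← h.inv (w * s), ← h.inv w, mul_inv_rev, h.inv_simple hs]

/-- Induction along reduced expressions, with left multiplication. -/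
theorem induction_left {p : W → Prop} (h0 : ∀ w, len w = 0 → p w)
    (h1 : ∀ s ∈ S, ∀ w, len (s * w) = len w + 1 → p w → p (s * w)) (w : W) : p w := by
  induction hn : len w generalizing w with
  | zero => exact h0 w hn
  | succ n ih =>
    obtain ⟨s, hs, hsw⟩ := h.exists_descent w (by omega)
    have := h1 s hs (s * w) (by rw [h.simple_mul_cancel hs]; omega) (ih _ (by omega))
    rwa [h.simple_mul_cancel hs] at this

/-- Induction along reduced expressions, with right multiplication. -/
theorem induction_right {p : W → Prop} (h0 : ∀ w, len w = 0 → p w)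
    (h1 : ∀ s ∈ S, ∀ w, len (w * s) = len w + 1 → p w → p (w * s)) (w : W) : p w := by
  induction hn : len w generalizing w with
  | zero => exact h0 w hn
  | succ n ih =>
    obtain ⟨s, hs, hsw⟩ := h.exists_right_descent w (by omega)
    have := h1 s hs (w * s) (by rw [h.mul_simple_cancel hs]; omega) (ih _ (by omega))
    rwa [h.mul_simple_cancel hs] at this

/-- The subgroup generated by a set of simple reflections has reduced expressions. -/
theorem closure_induction_right {S' : Set W} (hS : S' ⊆ S) {p : W → Prop} (h0 : p 1)
    (h1 : ∀ s ∈ S', ∀ w ∈ Subgroup.closure S', len (w * s) = len w + 1 → p w → p (w * s)) {w : W}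
    (hw : w ∈ Subgroup.closure S') : p w := by
  -- `q` is the smallest predicate containing `1` and stable under length-increasing right
  -- multiplication by `S'`. The point is to show that it is also stable under left multiplication
  -- by `S'`, whatever happens to the length.
  let q : W → Prop := fun w => w ∈ Subgroup.closure S' ∧
    ∀ r : W → Prop, r 1 → (∀ s ∈ S', ∀ w ∈ Subgroup.closure S', len (w * s) = len w + 1 →
      r w → r (w * s)) → r w
  have q1 : q 1 := ⟨one_mem _, fun r h0 _ => h0⟩
  have qs : ∀ s ∈ S', ∀ w, len (w * s) = len w + 1 → q w → q (w * s) := fun s hs w hl hw =>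
    ⟨mul_mem hw.1 (Subgroup.subset_closure hs), fun r h0 h1 => h1 s hs w hw.1 hl (hw.2 r h0 h1)⟩
  have key : ∀ s ∈ S', ∀ w, q w → q (s * w) := by
    intro s hs w hw
    refine (hw.2 (fun w => q w ∧ q (s * w)) ⟨q1, ?_⟩ ?_).2
    · simpa using qs s hs 1 (by rw [one_mul, h.len_simple (hS hs), h.one]) q1
    · rintro t ht w - hl ⟨h2, h3⟩
      refine ⟨qs t ht w hl h2, ?_⟩
      rw [← mul_assoc]
      rcases h.mul_simple (hS ht) (s * w) with h4 | h4
      · exact qs t ht _ h4 h3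
      · have h5 := h.simple_mul s (hS hs) w
        have h6 := h.simple_mul s (hS hs) (w * t)
        rw [← mul_assoc] at h6
        -- If the last factor `t` shortens `s * w`, parity leaves only the case where `s` lengthens
        -- `w` and shortens `w * t`. Exchange then gives `s * w = w * t`, so `s * w * t` is `w`
        -- again.
        have h7 := h.exchange s (hS hs) t (hS ht) w (by omega) (by omega)
        rwa [h7, h.mul_simple_cancel (hS ht)]
  have : q w := by
    induction hw using Subgroup.closure_induction_left with
    | one => exact q1
    | mul_left s hs w hw ih => exact key s hs w ih
    | inv_mul_cancel s hs w hw ih => rw [h.inv_simple (hS hs)]; exact key s hs w ih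
  exact this.2 p h0 h1

theorem closure_induction_left {S' : Set W} (hS : S' ⊆ S) {p : W → Prop} (h0 : p 1)
    (h1 : ∀ s ∈ S', ∀ w ∈ Subgroup.closure S', len (s * w) = len w + 1 → p w → p (s * w)) {w : W}
    (hw : w ∈ Subgroup.closure S') : p w := by
  have key := h.closure_induction_right hS (p := fun w => p w⁻¹) (by rwa [inv_one])
    (fun s hs w hw hl hp => ?_) (inv_mem hw)
  · rwa [inv_inv] at key
  · rw [mul_inv_rev, h.inv_simple (hS hs)]
    refine h1 s hs _ (inv_mem hw) ?_ hp
    rw [h.inv, ← hl, ← h.inv (w * s), mul_inv_rev, h.inv_simple (hS hs)]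

end IsLengthSystem

/-! ### The regular representation of a Hecke algebra. -/

section RegularRepresentation

variable {W : Type*} [Group W] (len : W → ℕ) (a : W → ℂ)

/-- Left multiplication by `T_y` in the regular representation of a Hecke algebra, if `y` is a
simple reflection or has length zero. -/
def leftOp (y : W) : Module.End ℂ (W →₀ ℂ) :=
  Finsupp.linearCombination ℂ fun w =>
    Finsupp.single (y * w) (1 : ℂ) + (if len (y * w) < len w then a y else 0) • Finsupp.single w 1

/-- Right multiplication by `T_y` in the regular representation of a Hecke algebra, if `y` is a
simple reflection or has length zero. -/
def rightOp (y : W) : Module.End ℂ (W →₀ ℂ) :=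
  Finsupp.linearCombination ℂ fun w =>
    Finsupp.single (w * y) (1 : ℂ) + (if len (w * y) < len w then a y else 0) • Finsupp.single w 1

theorem leftOp_single (y w : W) : leftOp len a y (Finsupp.single w 1) =
    Finsupp.single (y * w) (1 : ℂ) +
      (if len (y * w) < len w then a y else 0) • Finsupp.single w 1 := by
  simp [leftOp]

theorem rightOp_single (y w : W) : rightOp len a y (Finsupp.single w 1) =
    Finsupp.single (w * y) (1 : ℂ) +
      (if len (w * y) < len w then a y else 0) • Finsupp.single w 1 := by
  simp [rightOp]

theorem single_ext {W : Type*} {A B : Module.End ℂ (W →₀ ℂ)}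
    (h : ∀ w, A (Finsupp.single w 1) = B (Finsupp.single w 1)) : A = B := by
  ext w : 2
  simpa using h w

variable {len a} {S : Set W}

/-- The parameters of a Hecke algebra: functions on simple reflections that agree on conjugates. -/
def IsHeckeParameter (len : W → ℕ) (S : Set W) (a : W → ℂ) : Prop :=
  ∀ s ∈ S, ∀ t ∈ S, ∀ w, s * w = w * t → len (s * w) = len w + 1 → a s = a t

/-- The correction terms agree unless left multiplication changes whether `y` is a right descent, or
conversely. Exchange allows this only when `x * w = w * y`, and then `x` and `y` have the same
parameter. -/
theorem leftOp_mul_rightOp (h : IsLengthSystem len S) (ha : IsHeckeParameter len S a)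
    {x y : W} (hx : x ∈ S ∨ len x = 0) (hy : y ∈ S ∨ len y = 0) :
    leftOp len a x * rightOp len a y = rightOp len a y * leftOp len a x := by
  refine single_ext fun w => ?_
  simp only [Module.End.mul_apply, leftOp_single, rightOp_single, map_add, map_smul]
  rw [mul_assoc x w y]
  have key : ((len (x * (w * y)) < len (w * y) ↔ len (x * w) < len w) ∧
      (len (x * (w * y)) < len (x * w) ↔ len (w * y) < len w)) ∨
      (x ∈ S ∧ y ∈ S ∧ x * w = w * y) := by
    rcases hx with hx | hx
    · rcases hy with hy | hy
      · by_cases hxy : x * w = w * y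
        · exact Or.inr ⟨hx, hy, hxy⟩
        refine Or.inl ?_
        have h1 := h.simple_mul x hx w
        have h2 := h.simple_mul x hx (w * y)
        have h3 := h.mul_simple hy w
        have h4 := h.mul_simple hy (x * w)
        rw [mul_assoc] at h4
        have h5 := h.exchange x hx y hy w
        have h6 := h.exchange x hx y hy (x * w)
        rw [h.simple_mul_cancel hx, mul_assoc] at h6
        have h7 : w ≠ x * (w * y) := fun h8 => hxy (by
          conv_lhs => rw [h8]
          exact h.simple_mul_cancel hx _)
        have h9 : ¬ (len w < len (x * w) ∧ len (x * (w * y)) < len (w * y)) := fun h10 =>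
          hxy (h5 h10.1 (by rw [mul_assoc]; exact h10.2))
        have h11 : ¬ (len (x * w) < len w ∧ len (w * y) < len (x * (w * y))) := fun h10 =>
          h7 (h6 h10.1 h10.2)
        omega
      · have h1 := h.mul_zero hy w
        have h2 := h.mul_zero hy (x * w)
        rw [mul_assoc] at h2
        omega
    · have h1 := h.zero_mul hx w
      have h2 := h.zero_mul hx (w * y)
      omega
  rcases key with ⟨h1, h2⟩ | ⟨hx, hy, hxy⟩
  · simp only [h1, h2]
    simp only [smul_add, smul_smul, mul_comm (if len (w * y) < len w then a y else 0)]
    abel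
  · have h1 := h.simple_mul x hx w
    have h2 : x * (w * y) = w := by rw [← hxy, h.simple_mul_cancel hx]
    have h3 : a x = a y := by
      rcases h1 with h1 | h1
      · exact ha x hx y hy w hxy h1
      · refine ha x hx y hy (x * w) ?_ ?_
        · rw [h.simple_mul_cancel hx, mul_assoc, h2]
        · rw [h.simple_mul_cancel hx, h1]
    rw [h2, ← hxy, h3]

/-- The vector at `1` generates the whole space under the right operators, so an operator commuting
with them is determined by its value there. This turns each Hecke relation into a check on one
vector. -/
theorem eq_of_commute_rightOp (h : IsLengthSystem len S) {A B : Module.End ℂ (W →₀ ℂ)}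
    (hA : ∀ y, y ∈ S ∨ len y = 0 → A * rightOp len a y = rightOp len a y * A)
    (hB : ∀ y, y ∈ S ∨ len y = 0 → B * rightOp len a y = rightOp len a y * B)
    (h1 : A (Finsupp.single 1 1) = B (Finsupp.single 1 1)) : A = B := by
  have key : ∀ y w, (y ∈ S ∨ len y = 0) → ¬ len (w * y) < len w →
      A (Finsupp.single w 1) = B (Finsupp.single w 1) →
      A (Finsupp.single (w * y) 1) = B (Finsupp.single (w * y) 1) := by
    intro y w hy hl hw
    have h2 : (Finsupp.single (w * y) 1 : W →₀ ℂ) = rightOp len a y (Finsupp.single w 1) := by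
      rw [rightOp_single, if_neg hl, zero_smul, add_zero]
    have h3 := LinearMap.congr_fun (hA y hy) (Finsupp.single w 1)
    have h4 := LinearMap.congr_fun (hB y hy) (Finsupp.single w 1)
    simp only [Module.End.mul_apply] at h3 h4
    rw [h2, h3, h4, hw]
  refine single_ext fun w => ?_
  refine h.induction_right (p := fun w => A (Finsupp.single w 1) = B (Finsupp.single w 1))
    (fun w hw => ?_) (fun s hs w hl hw => ?_) w
  · simpa using key w 1 (Or.inr hw) (by rw [one_mul, h.one]; omega) h1
  · exact key s w (Or.inl hs) (by omega) hw

/-- The regular representation of the Hecke algebra of a length system. -/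
theorem exists_regular_representation (h : IsLengthSystem len S) (ha : IsHeckeParameter len S a) :
    ∃ X : W → Module.End ℂ (W →₀ ℂ), X 1 = 1 ∧
      (∀ w w', len (w * w') = len w + len w' → X (w * w') = X w * X w') ∧
      (∀ s ∈ S, X s * X s = 1 + a s • X s) ∧
      ∀ w, X w (Finsupp.single 1 1) = Finsupp.single w 1 := by
  -- Each operator is built along some reduced expression. Independence of the expression is never
  -- needed: commutation with the right operators pins the operator down.
  have ex : ∀ w, ∃ A : Module.End ℂ (W →₀ ℂ),
      (∀ y, y ∈ S ∨ len y = 0 → A * rightOp len a y = rightOp len a y * A) ∧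
      ∀ w', len (w * w') = len w + len w' → A (Finsupp.single w' 1) = Finsupp.single (w * w') 1 := by
    refine h.induction_left (fun w hw => ?_) (fun s hs w hl ⟨A, hA, hA'⟩ => ?_)
    · refine ⟨leftOp len a w, fun y hy => leftOp_mul_rightOp h ha (Or.inr hw) hy, fun w' hw' => ?_⟩
      rw [leftOp_single, if_neg (by omega), zero_smul, add_zero]
    · refine ⟨leftOp len a s * A, fun y hy => ?_, fun w' hw' => ?_⟩
      · rw [mul_assoc, hA y hy, ← mul_assoc, leftOp_mul_rightOp h ha (Or.inl hs) hy, mul_assoc]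
      · have h1 := h.mul_le w w'
        have h2 := h.simple_mul s hs (w * w')
        rw [← mul_assoc] at h2
        rw [Module.End.mul_apply, hA' w' (by omega), leftOp_single, ← mul_assoc,
          if_neg (by omega), zero_smul, add_zero]
  choose X hX hX' using ex
  have hX1 : ∀ w, X w (Finsupp.single 1 1) = Finsupp.single w 1 := fun w => by
    simpa using hX' w 1 (by rw [mul_one, h.one, add_zero])
  have comm_mul : ∀ w w' y, y ∈ S ∨ len y = 0 →
      X w * X w' * rightOp len a y = rightOp len a y * (X w * X w') := fun w w' y hy => by
    rw [mul_assoc, hX _ y hy, ← mul_assoc, hX _ y hy, mul_assoc]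
  refine ⟨X, ?_, ?_, ?_, hX1⟩
  · exact eq_of_commute_rightOp h (a := a) (hX 1) (fun y _ => by simp) (by simp [hX1])
  · intro w w' hl
    refine eq_of_commute_rightOp h (a := a) (hX _) (comm_mul w w') ?_
    rw [Module.End.mul_apply, hX1, hX1, hX' w w' hl]
  · intro s hs
    have hs1 : X s = leftOp len a s := by
      refine eq_of_commute_rightOp h (a := a) (hX s)
        (fun y hy => leftOp_mul_rightOp h ha (Or.inl hs) hy) ?_
      rw [hX1, leftOp_single, mul_one, h.one, if_neg (by omega), zero_smul, add_zero]
    refine eq_of_commute_rightOp h (a := a) (comm_mul s s) (fun y hy => ?_) ?_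
    · rw [add_mul, mul_add, smul_mul_assoc, mul_smul_comm, hX s y hy, one_mul, mul_one]
    · rw [Module.End.mul_apply, hX1, hs1, leftOp_single, h.mul_self s hs, h.one, h.len_simple hs,
        if_pos (by omega), LinearMap.add_apply, Module.End.one_apply, LinearMap.smul_apply, ← hs1,
        hX1]

end RegularRepresentation

/-! ### The highest root of an irreducible root system. -/

section HighestRoot

variable {ι V N : Type*} [AddCommGroup V] [Module ℝ V] [AddCommGroup N] [Module ℝ N]
  {Φ : RootPairing ι ℝ V N} (b : Φ.Base)

theorem exists_root_eq_sum_of_isPos {i : ι} (hi : b.IsPos i) : ∃ f : ι → ℤ, 0 ≤ f ∧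
    Function.support f ⊆ b.support ∧ Φ.root i = ∑ j ∈ b.support, f j • Φ.root j := by
  obtain ⟨f, h1, h2, h3⟩ := b.exists_root_eq_sum_int i
  refine ⟨f, ?_, h1, h3⟩
  rcases h2 with h2 | h2
  · exact h2.le
  · rw [RootPairing.Base.isPos_iff, RootPairing.Base.height_eq_sum h3] at hi
    have : ∑ j ∈ b.support, f j ≤ 0 := Finset.sum_nonpos fun j _ => h2.le j
    omega

theorem root_mem_closure_of_isPos {i : ι} (hi : b.IsPos i) :
    Φ.root i ∈ AddSubmonoid.closure (Φ.root '' b.support) := by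
  obtain ⟨f, h1, -, h3⟩ := exists_root_eq_sum_of_isPos b hi
  rw [h3]
  refine sum_mem fun j hj => ?_
  rw [← Int.toNat_of_nonneg (h1 j), natCast_zsmul]
  exact nsmul_mem (AddSubmonoid.subset_closure (Set.mem_image_of_mem _ hj)) _

theorem exists_isPos_neg (i : ι) (hi : ¬ b.IsPos i) : ∃ j, b.IsPos j ∧ Φ.root j = -Φ.root i := by
  let := Φ.indexNeg
  exact ⟨-i, (RootPairing.Base.IsPos.or_neg b i).resolve_left hi, by simp⟩

variable [Φ.IsCrystallographic]

theorem pairingIn_eq_sum {i : ι} {f : ι → ℤ}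
    (hf : Φ.root i = ∑ j ∈ b.support, f j • Φ.root j) (k : ι) :
    Φ.pairingIn ℤ i k = ∑ j ∈ b.support, f j * Φ.pairingIn ℤ j k := by
  have h : ((Φ.pairingIn ℤ i k : ℤ) : ℝ) =
      ((∑ j ∈ b.support, f j * Φ.pairingIn ℤ j k : ℤ) : ℝ) := by
    have h0 : ∀ j, ((Φ.pairingIn ℤ j k : ℤ) : ℝ) = Φ.coroot' k (Φ.root j) := fun j => by
      have := Φ.algebraMap_pairingIn ℤ j k
      simpa using this
    push_cast
    simp only [h0]
    rw [hf, map_sum]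
    simp
  exact_mod_cast h

variable {b} [Finite ι]

theorem pairingIn_nonneg_of_maximal {i j : ι} (hi : b.IsPos i) (hj : b.IsPos j)
    (hmax : ∀ k, b.IsPos k → Φ.root i + Φ.root k ∉ Set.range Φ.root) :
    0 ≤ Φ.pairingIn ℤ i j := by
  by_contra! h
  refine hmax j hj (Φ.root_add_root_mem_of_pairingIn_neg h fun h1 => ?_)
  rw [Φ.root_eq_neg_iff] at h1
  rw [h1] at hi
  exact (RootPairing.Base.IsPos.neg_iff_not b j).mp hi hj

variable [Φ.IsReduced]

/-- If $\alpha_k$ had coefficient zero, nonnegativity of the pairing with $\alpha_k^\vee$ would make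
$\alpha_k$ orthogonal to every simple root that occurs. The span of those roots is then stable under
all reflections, hence is $V$ by irreducibility, and $\alpha_k$ would be fixed by its own
reflection. -/
theorem coeff_pos_of_maximal [Φ.IsIrreducible] {i : ι} (hi : b.IsPos i)
    (hmax : ∀ k, b.IsPos k → Φ.root i + Φ.root k ∉ Set.range Φ.root) {f : ι → ℤ} (hf : 0 ≤ f)
    (hfi : Φ.root i = ∑ j ∈ b.support, f j • Φ.root j) {k : ι} (hk : k ∈ b.support) : 0 < f k := by
  set q : Submodule ℝ V := Submodule.span ℝ (Φ.root '' {j | j ∈ b.support ∧ 0 < f j}) with hq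
  have fixed : ∀ k ∈ b.support, ¬ 0 < f k → ∀ x ∈ q, Φ.reflection k x = x := by
    intro k hk hfk x hx
    have h1 := pairingIn_nonneg_of_maximal hi (b.isPos_of_mem_support hk) hmax
    rw [pairingIn_eq_sum b hfi k] at h1
    have h2 : ∀ j ∈ b.support, f j * Φ.pairingIn ℤ j k ≤ 0 := by
      intro j hj
      rcases eq_or_ne j k with rfl | hjk
      · have : f j = 0 := le_antisymm (not_lt.mp hfk) (hf j)
        simp [this]
      · exact mul_nonpos_of_nonneg_of_nonpos (hf j) (b.pairingIn_le_zero_of_ne hjk hj hk)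
    have h3 := (Finset.sum_eq_zero_iff_of_nonpos h2).mp (le_antisymm (Finset.sum_nonpos h2) h1)
    induction hx using Submodule.span_induction with
    | mem x hx =>
      obtain ⟨j, ⟨hj, hfj⟩, rfl⟩ := hx
      have h4 : Φ.pairingIn ℤ j k = 0 := (mul_eq_zero.mp (h3 j hj)).resolve_left hfj.ne'
      have h5 : Φ.pairing j k = 0 := by rw [← Φ.algebraMap_pairingIn ℤ, h4, map_zero]
      rw [Φ.reflection_apply_root, h5, zero_smul, sub_zero]
    | zero => simp
    | add x y _ _ hx hy => rw [map_add, hx, hy]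
    | smul c x _ hx => rw [map_smul, hx]
  have htop : q = ⊤ := by
    refine RootPairing.IsIrreducible.eq_top_of_invtSubmodule_reflection (P := Φ) q ?_ ?_
    · refine (b.forall_mem_support_invtSubmodule_iff q).mp fun k hk => ?_
      by_cases hfk : 0 < f k
      · exact Submodule.mem_invtSubmodule_reflection_of_mem _ _
          (Submodule.subset_span ⟨k, ⟨hk, hfk⟩, rfl⟩)
      · intro x hx
        change Φ.reflection k x ∈ q
        rwa [fixed k hk hfk x hx]
    · intro hbot
      refine Φ.ne_zero i ?_
      rw [hfi]
      refine Finset.sum_eq_zero fun j hj => ?_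
      rcases (hf j).eq_or_lt with h | h
      · rw [← h]; simp
      · have : Φ.root j ∈ q := Submodule.subset_span ⟨j, ⟨hj, h⟩, rfl⟩
        rw [hbot, Submodule.mem_bot] at this
        exact absurd this (Φ.ne_zero j)
  by_contra hfk
  have h1 := fixed k hk hfk (Φ.root k) (htop ▸ Submodule.mem_top)
  rw [Φ.reflection_apply_self] at h1
  have : IsAddTorsionFree V := .of_isTorsionFree ℝ V
  exact Φ.ne_zero k (self_eq_neg.mp h1.symm)

/-- Expand one maximal root in simple roots. All coefficients are positive, all pairings with the
other maximal root are nonnegative, and one is positive. -/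
theorem pairingIn_pos_of_maximal [Φ.IsIrreducible] {i j : ι} (hi : b.IsPos i)
    (hi' : ∀ k, b.IsPos k → Φ.root i + Φ.root k ∉ Set.range Φ.root) (hj : b.IsPos j)
    (hj' : ∀ k, b.IsPos k → Φ.root j + Φ.root k ∉ Set.range Φ.root) :
    0 < Φ.pairingIn ℤ j i := by
  obtain ⟨f, h1, -, h3⟩ := exists_root_eq_sum_of_isPos b hj
  rw [pairingIn_eq_sum b h3]
  obtain ⟨k, hk, hk'⟩ := hi.exists_mem_support_pos_pairingIn
  refine Finset.sum_pos' (fun l hl => mul_nonneg (h1 l) ?_)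
    ⟨k, hk, mul_pos (coeff_pos_of_maximal hj hj' h1 h3 hk) hk'⟩
  by_contra! h
  rw [Φ.pairingIn_lt_zero_iff] at h
  have := pairingIn_nonneg_of_maximal hi (b.isPos_of_mem_support hl) hi'
  omega

variable (b)

/-- Existence of the highest root of an irreducible root system. -/
theorem exists_highest_root [Nonempty ι] [Φ.IsIrreducible] :
    ∃ i, ∀ j, Φ.root i - Φ.root j ∈ AddSubmonoid.closure (Φ.root '' b.support) := by
  set C := AddSubmonoid.closure (Φ.root '' b.support) with hC
  obtain ⟨i, hi⟩ := Finite.exists_max b.height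
  have not_add : ∀ {i k l}, b.IsPos k → Φ.root l = Φ.root i + Φ.root k → b.height i < b.height l := by
    intro i k l hk hl
    rw [b.height_add hl]
    have : 0 < b.height k := hk
    omega
  have hipos : b.IsPos i := by
    obtain ⟨k, hk⟩ := b.support_nonempty
    exact lt_of_lt_of_le (b.isPos_of_mem_support hk) (hi k)
  have himax : ∀ k, b.IsPos k → Φ.root i + Φ.root k ∉ Set.range Φ.root := by
    rintro k hk ⟨l, hl⟩
    exact absurd (hi l) (not_le.mpr (not_add hk hl))
  refine ⟨i, fun j => ?_⟩
  by_cases hj : b.IsPos j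
  swap
  · obtain ⟨k, hk, hk'⟩ := exists_isPos_neg b j hj
    rw [sub_eq_add_neg, ← hk']
    exact add_mem (root_mem_closure_of_isPos b hipos) (root_mem_closure_of_isPos b hk)
  -- Among the roots above $\alpha_j$ take one of maximal height; it is a maximal root. The height
  -- bound keeps it positive.
  obtain ⟨⟨m, hm⟩, hmax⟩ := @Finite.exists_max {m : ι // b.height j ≤ b.height m ∧
    Φ.root m - Φ.root j ∈ C} ℤ _ ⟨⟨j, le_rfl, by rw [sub_self]; exact zero_mem _⟩⟩ _
    (fun m => b.height m)
  have hmpos : b.IsPos m := lt_of_lt_of_le hj hm.1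
  have hmmax : ∀ k, b.IsPos k → Φ.root m + Φ.root k ∉ Set.range Φ.root := by
    rintro k hk ⟨l, hl⟩
    have h1 := not_add hk hl
    refine absurd (hmax ⟨l, hm.1.trans h1.le, ?_⟩) (not_le.mpr h1)
    rw [hl, add_sub_right_comm]
    exact add_mem hm.2 (root_mem_closure_of_isPos b hk)
  have hp := pairingIn_pos_of_maximal hmpos hmmax hipos himax
  rcases eq_or_ne i m with rfl | him
  · exact hm.2
  -- Two distinct maximal roots have positive pairing, so their difference is a root; whichever sign
  -- it has, one of the two was not maximal.
  exfalso
  obtain ⟨k, hk⟩ := Φ.root_sub_root_mem_of_pairingIn_pos hp him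
  by_cases hkpos : b.IsPos k
  · exact hmmax k hkpos ⟨i, by rw [hk]; abel⟩
  · obtain ⟨l, hl, hl'⟩ := exists_isPos_neg b k hkpos
    exact himax l hl ⟨m, by rw [hl', hk]; abel⟩

variable [Φ.IsRootSystem] [Φ.IsIrreducible]

/-- Applies the existence of a highest root to the dual base `b.flip`. It guarantees that the
reflection $s_0$ exists at all. -/
theorem exists_isHighestCoroot : ∃ i, IsHighestCoroot b i := by
  have : Nonempty ι := by
    have := RootPairing.IsIrreducible.nontrivial Φ
    obtain ⟨x, hx⟩ := exists_ne (0 : V)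
    by_contra h
    rw [not_nonempty_iff] at h
    exact hx (Φ.eq_zero_iff_forall_coroot'_eq_zero.mpr fun i => h.elim i)
  exact exists_highest_root b.flip

end HighestRoot

/-! ### Elements of $W$ as a permutation of the roots and a weight. -/

section AffineWeyl

variable {ι V N : Type*} [AddCommGroup V] [Module ℝ V] [AddCommGroup N] [Module ℝ N]

theorem affineEquiv_apply (g : V ≃ᵃ[ℝ] V) (x : V) : g x = g.linear x + g 0 := by
  have := g.map_vadd 0 x
  simpa using this

/-- The affine transformations that permute the roots and preserve the weight lattice. -/
def rootPreserving (Φ : RootPairing ι ℝ V N) : Subgroup (V ≃ᵃ[ℝ] V) where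
  carrier := {g | (∃ π : Equiv.Perm ι, (∀ i, g.linear (Φ.root i) = Φ.root (π i)) ∧
    ∀ i x, Φ.coroot' (π i) (g.linear x) = Φ.coroot' i x) ∧ g 0 ∈ weightLattice Φ}
  one_mem' := ⟨⟨1, fun _ => rfl, fun _ _ => rfl⟩, zero_mem _⟩
  mul_mem' := by
    rintro g h ⟨⟨π, h1, h2⟩, h3⟩ ⟨⟨ρ, h4, h5⟩, h6⟩
    have hl : ∀ x, (g * h).linear x = g.linear (h.linear x) := fun _ => rfl
    refine ⟨⟨π * ρ, fun i => ?_, fun i x => ?_⟩, ?_⟩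
    · rw [hl, h4, h1]; rfl
    · rw [hl, Equiv.Perm.mul_apply, h2, h5]
    · change g (h 0) ∈ _
      rw [affineEquiv_apply]
      refine add_mem (fun i => ?_) h3
      obtain ⟨z, hz⟩ := h6 (π.symm i)
      refine ⟨z, ?_⟩
      rw [hz, ← h2, Equiv.apply_symm_apply]
  inv_mem' := by
    rintro g ⟨⟨π, h1, h2⟩, h3⟩
    have hl : ∀ x, g.linear (g⁻¹.linear x) = x := fun x => g.linear.apply_symm_apply x
    refine ⟨⟨π.symm, fun i => ?_, fun i x => ?_⟩, fun i => ?_⟩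
    · apply g.linear.injective
      rw [hl, h1, Equiv.apply_symm_apply]
    · rw [← h2, hl, Equiv.apply_symm_apply]
    · have h4 := affineEquiv_apply g (g⁻¹ 0)
      have h5 : g (g⁻¹ 0) = 0 := g.apply_symm_apply 0
      rw [h5, eq_comm, add_eq_zero_iff_eq_neg] at h4
      obtain ⟨z, hz⟩ := h3 (π i)
      refine ⟨-z, ?_⟩
      rw [← h2, h4, map_neg, ← hz, Int.cast_neg]

variable {Φ : RootPairing ι ℝ V N}

theorem trans_add (l m : weightLattice Φ) : trans Φ (l + m) = trans Φ l * trans Φ m := by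
  apply Subtype.ext
  ext x
  change (l : V) + m + x = l + (m + x)
  rw [add_assoc]

theorem trans_zero : trans Φ (0 : weightLattice Φ) = 1 := by
  apply Subtype.ext
  ext x
  change (0 : V) + x = x
  rw [zero_add]

theorem mul_apply (w w' : affWeyl Φ) (x : V) :
    ((w * w' : affWeyl Φ) : V ≃ᵃ[ℝ] V) x = (w : V ≃ᵃ[ℝ] V) ((w' : V ≃ᵃ[ℝ] V) x) := rfl

theorem wtPair_eq_iff (i : ι) (l : weightLattice Φ) (z : ℤ) :
    wtPair Φ i l = z ↔ Φ.coroot' i (l : V) = z := by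
  rw [← wtPair_cast, Int.cast_inj]

theorem wtPair_add (i : ι) (l m : weightLattice Φ) :
    wtPair Φ i (l + m) = wtPair Φ i l + wtPair Φ i m := by
  rw [wtPair_eq_iff, AddSubgroup.coe_add, map_add, ← wtPair_cast, ← wtPair_cast, Int.cast_add]

/-- The pairing with a coroot, as a homomorphism on the weight lattice. -/
def wtPairHom (Φ : RootPairing ι ℝ V N) (i : ι) : weightLattice Φ →+ ℤ :=
  AddMonoidHom.mk' (wtPair Φ i) (wtPair_add i)

theorem wtPair_zero (i : ι) : wtPair Φ i 0 = 0 := map_zero (wtPairHom Φ i)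

theorem wtPair_neg (i : ι) (l : weightLattice Φ) : wtPair Φ i (-l) = -wtPair Φ i l :=
  map_neg (wtPairHom Φ i) l

theorem wtPair_sub (i : ι) (l m : weightLattice Φ) :
    wtPair Φ i (l - m) = wtPair Φ i l - wtPair Φ i m := map_sub (wtPairHom Φ i) l m

theorem wtPair_zsmul (i : ι) (k : ℤ) (l : weightLattice Φ) :
    wtPair Φ i (k • l) = k * wtPair Φ i l := by
  exact (map_zsmul (wtPairHom Φ i) k l).trans (smul_eq_mul _ _)

theorem isDominant_iff (b : Φ.Base) (l : weightLattice Φ) :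
    IsDominant b l ↔ ∀ i, b.IsPos i → 0 ≤ wtPair Φ i l := by
  simp only [IsDominant, ← wtPair_cast, Int.cast_nonneg_iff]

theorem coroot_neg (i : ι) (x : V) :
    Φ.coroot' (Φ.reflectionPerm i i) x = -Φ.coroot' i x := by
  rw [← Φ.coroot'_reflection, Φ.reflection_apply, map_sub, map_smul, smul_eq_mul,
    Φ.coroot_root_two]
  ring

theorem wtPair_reflPerm_self (i : ι) (l : weightLattice Φ) :
    wtPair Φ (Φ.reflectionPerm i i) l = -wtPair Φ i l := by
  rw [wtPair_eq_iff, coroot_neg, ← wtPair_cast, Int.cast_neg]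

variable [Φ.IsCrystallographic]

theorem affRefl_mem_rootPreserving (i : ι) (k : ℤ) : affRefl Φ i k ∈ rootPreserving Φ := by
  have hl : ∀ x, (affRefl Φ i k).linear x = Φ.reflection i x := fun _ => rfl
  refine ⟨⟨Φ.reflectionPerm i, fun j => ?_, fun j x => ?_⟩, ?_⟩
  · rw [hl, Φ.root_reflectionPerm]
  · rw [hl, Φ.coroot'_reflection, Φ.reflectionPerm_self]
  · rw [affRefl_apply, map_zero, zero_sub, zero_sub, neg_smul, neg_neg, Int.cast_smul_eq_zsmul]
    exact zsmul_mem (rootWt Φ i).2 k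

theorem affWeyl_le_rootPreserving : affWeyl Φ ≤ rootPreserving Φ := by
  refine (Subgroup.closure_le _).mpr (Set.union_subset ?_ ?_)
  · refine (Subgroup.closure_le _).mpr ?_
    rintro _ ⟨i, rfl⟩
    exact affRefl_mem_rootPreserving i 0
  · rintro _ ⟨l, rfl⟩
    refine ⟨⟨1, fun _ => rfl, fun _ _ => rfl⟩, ?_⟩
    have : AffineEquiv.constVAdd ℝ V (l : V) 0 = l := by simp
    rw [this]
    exact l.2

/-- The permutation of the roots by the linear part of an element of `W`. -/
def rootPerm (w : affWeyl Φ) : Equiv.Perm ι := (affWeyl_le_rootPreserving w.2).1.choose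

/-- The weight `w 0`, for `w` in `W`. -/
def transPart (w : affWeyl Φ) : weightLattice Φ :=
  ⟨(w : V ≃ᵃ[ℝ] V) 0, (affWeyl_le_rootPreserving w.2).2⟩

theorem linear_root (w : affWeyl Φ) (i : ι) :
    (w : V ≃ᵃ[ℝ] V).linear (Φ.root i) = Φ.root (rootPerm w i) :=
  (affWeyl_le_rootPreserving w.2).1.choose_spec.1 i

theorem coroot_rootPerm (w : affWeyl Φ) (i : ι) (x : V) :
    Φ.coroot' (rootPerm w i) ((w : V ≃ᵃ[ℝ] V).linear x) = Φ.coroot' i x :=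
  (affWeyl_le_rootPreserving w.2).1.choose_spec.2 i x

/-- This formula lets every question about the position of $wA$ be answered from `rootPerm` and
`transPart` alone. -/
theorem coroot_apply (w : affWeyl Φ) (i : ι) (x : V) : Φ.coroot' i ((w : V ≃ᵃ[ℝ] V) x) =
    wtPair Φ i (transPart w) + Φ.coroot' ((rootPerm w).symm i) x := by
  rw [affineEquiv_apply, map_add, ← coroot_rootPerm w ((rootPerm w).symm i),
    Equiv.apply_symm_apply, wtPair_cast, add_comm]
  rfl

theorem rootPerm_eq {w : affWeyl Φ} {π : Equiv.Perm ι}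
    (h : ∀ i, (w : V ≃ᵃ[ℝ] V).linear (Φ.root i) = Φ.root (π i)) : rootPerm w = π :=
  Equiv.ext fun i => Φ.root.injective (by rw [← linear_root, h])

theorem rootPerm_mul (w w' : affWeyl Φ) : rootPerm (w * w') = rootPerm w * rootPerm w' := by
  refine rootPerm_eq fun i => ?_
  have : ((w * w' : affWeyl Φ) : V ≃ᵃ[ℝ] V).linear (Φ.root i) =
    (w : V ≃ᵃ[ℝ] V).linear ((w' : V ≃ᵃ[ℝ] V).linear (Φ.root i)) := rfl
  rw [this, linear_root, linear_root]; rfl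

theorem rootPerm_one : rootPerm (1 : affWeyl Φ) = 1 := rootPerm_eq fun _ => rfl

theorem rootPerm_refl (i : ι) (k : ℤ) : rootPerm (refl Φ i k) = Φ.reflectionPerm i :=
  rootPerm_eq fun j => (Φ.root_reflectionPerm i j).symm

theorem rootPerm_trans (l : weightLattice Φ) : rootPerm (trans Φ l) = 1 :=
  rootPerm_eq fun _ => rfl

theorem transPart_trans (l : weightLattice Φ) : transPart (trans Φ l) = l := by
  ext
  change AffineEquiv.constVAdd ℝ V (l : V) 0 = l
  simp

theorem transPart_one : transPart (1 : affWeyl Φ) = 0 := rfl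

theorem transPart_refl (i : ι) (k : ℤ) : transPart (refl Φ i k) = k • rootWt Φ i := by
  ext
  change affRefl Φ i k 0 = k • Φ.root i
  rw [affRefl_apply, map_zero, zero_sub, zero_sub, neg_smul, neg_neg, Int.cast_smul_eq_zsmul]

theorem refl_apply (i : ι) (k : ℤ) (x : V) :
    (refl Φ i k : V ≃ᵃ[ℝ] V) x = x - (Φ.coroot' i x - k) • Φ.root i := affRefl_apply Φ i k x

theorem refl_zero_mul_trans (i : ι) (l : weightLattice Φ) :
    refl Φ i 0 * trans Φ l = trans Φ (wtRefl Φ i l) * refl Φ i 0 := by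
  apply Subtype.ext
  ext x
  change (refl Φ i 0 : V ≃ᵃ[ℝ] V) ((l : V) + x) =
    (wtRefl Φ i l : V) + (refl Φ i 0 : V ≃ᵃ[ℝ] V) x
  rw [refl_apply, refl_apply, wtRefl_coe, Φ.reflection_apply, map_add]
  module

theorem refl_mul_self (i : ι) (k : ℤ) : refl Φ i k * refl Φ i k = 1 := by
  apply Subtype.ext
  ext x
  rw [mul_apply, refl_apply i k x, refl_apply]
  change _ = x
  rw [map_sub, map_smul, smul_eq_mul, Φ.coroot_root_two]
  module

/-! ### Pairings of weights with coroots -/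

theorem wtPair_rootWt_self (i : ι) : wtPair Φ i (rootWt Φ i) = 2 := by
  rw [wtPair_eq_iff]
  rw [Int.cast_ofNat]
  exact Φ.coroot_root_two i

theorem wtPair_rootWt (i j : ι) : wtPair Φ i (rootWt Φ j) = Φ.pairingIn ℤ j i := by
  rw [wtPair_eq_iff]
  exact (Φ.algebraMap_pairingIn ℤ j i).symm

theorem wtPair_transPart_mul (w w' : affWeyl Φ) (i : ι) : wtPair Φ i (transPart (w * w')) =
    wtPair Φ i (transPart w) + wtPair Φ ((rootPerm w).symm i) (transPart w') := by
  rw [wtPair_eq_iff]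
  change Φ.coroot' i ((w : V ≃ᵃ[ℝ] V) (transPart w' : V)) = _
  rw [coroot_apply, ← wtPair_cast, Int.cast_add]

theorem rootPerm_reflPerm_self (w : affWeyl Φ) (i : ι) :
    rootPerm w (Φ.reflectionPerm i i) = Φ.reflectionPerm (rootPerm w i) (rootPerm w i) := by
  apply Φ.root.injective
  rw [← linear_root, Φ.root_reflectionPerm, Φ.root_reflectionPerm, Φ.reflection_apply_self,
    Φ.reflection_apply_self, map_neg, linear_root]

theorem rootPerm_symm_reflPerm_self (w : affWeyl Φ) (i : ι) :
    (rootPerm w).symm (Φ.reflectionPerm i i) =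
      Φ.reflectionPerm ((rootPerm w).symm i) ((rootPerm w).symm i) := by
  rw [Equiv.symm_apply_eq, rootPerm_reflPerm_self, Equiv.apply_symm_apply]

/-- The permutation form of $ws_\alpha w^{-1}=s_{w\alpha}$ for linear parts. -/
theorem reflPerm_rootPerm (w : affWeyl Φ) (i j : ι) :
    Φ.reflectionPerm (rootPerm w i) (rootPerm w j) = rootPerm w (Φ.reflectionPerm i j) := by
  apply Φ.root.injective
  rw [← linear_root, Φ.root_reflectionPerm, Φ.root_reflectionPerm, Φ.reflection_apply,
    Φ.reflection_apply, map_sub, map_smul, ← linear_root, ← linear_root, coroot_rootPerm]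

variable [Φ.IsRootSystem]

theorem affWeyl_ext {w w' : affWeyl Φ} (h1 : rootPerm w = rootPerm w')
    (h2 : transPart w = transPart w') : w = w' := by
  apply Subtype.ext
  have h3 : (w : V ≃ᵃ[ℝ] V).linear.toLinearMap = (w' : V ≃ᵃ[ℝ] V).linear.toLinearMap := by
    refine LinearMap.ext_on_range (v := Φ.root) ?_ fun i => ?_
    · exact RootPairing.IsRootSystem.span_root_eq_top
    · change (w : V ≃ᵃ[ℝ] V).linear (Φ.root i) = (w' : V ≃ᵃ[ℝ] V).linear (Φ.root i)
      rw [linear_root, linear_root, h1]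
  ext x
  rw [affineEquiv_apply, affineEquiv_apply (w' : V ≃ᵃ[ℝ] V)]
  exact congrArg₂ (· + ·) (LinearMap.congr_fun h3 x) (congrArg Subtype.val h2)

end AffineWeyl

/-! ### The length as a sum of signed hyperplane crossings. -/

section Length

variable {ι V N : Type*} [AddCommGroup V] [Module ℝ V] [AddCommGroup N] [Module ℝ N]
  {Φ : RootPairing ι ℝ V N}

open Classical in
/-- The integer part of the values of a coroot on the alcove `A`. -/
def alcoveFloor (b : Φ.Base) (i : ι) : ℤ := if b.IsPos i then 0 else -1

theorem alcoveFloor_of_isPos {b : Φ.Base} {i : ι} (hi : b.IsPos i) : alcoveFloor b i = 0 :=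
  if_pos hi

theorem alcoveFloor_of_not_isPos {b : Φ.Base} {i : ι} (hi : ¬ b.IsPos i) :
    alcoveFloor b i = -1 :=
  if_neg hi

theorem isPos_neg_iff (b : Φ.Base) (i : ι) : b.IsPos (Φ.reflectionPerm i i) ↔ ¬ b.IsPos i :=
  RootPairing.Base.IsPos.neg_iff_not b i

theorem reflPerm_neg_neg (Φ : RootPairing ι ℝ V N) (i : ι) :
    Φ.reflectionPerm (Φ.reflectionPerm i i) (Φ.reflectionPerm i i) = i := by
  let := Φ.indexNeg
  exact neg_neg i

theorem alcoveFloor_neg (b : Φ.Base) (i : ι) :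
    alcoveFloor b (Φ.reflectionPerm i i) = -1 - alcoveFloor b i := by
  by_cases hi : b.IsPos i
  · rw [alcoveFloor_of_isPos hi, alcoveFloor_of_not_isPos (by rwa [isPos_neg_iff, not_not])]
    rfl
  · rw [alcoveFloor_of_not_isPos hi, alcoveFloor_of_isPos (by rwa [isPos_neg_iff])]
    rfl

theorem coroot_mem_alcove {b : Φ.Base} {x : V} (hx : x ∈ alcove b) (i : ι) :
    alcoveFloor b i < Φ.coroot' i x ∧ Φ.coroot' i x < alcoveFloor b i + 1 := by
  by_cases hi : b.IsPos i
  · rw [alcoveFloor_of_isPos hi]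
    simpa using hx i hi
  · rw [alcoveFloor_of_not_isPos hi]
    have h := hx _ ((isPos_neg_iff b i).mpr hi)
    rw [coroot_neg] at h
    push_cast
    constructor <;> linarith

theorem isPos_iff_coroot_pos {b : Φ.Base} {x : V} (hx : x ∈ alcove b) (i : ι) :
    b.IsPos i ↔ 0 < Φ.coroot' i x := by
  refine ⟨fun hi => (hx i hi).1, fun h => ?_⟩
  by_contra hi
  have := (coroot_mem_alcove hx i).2
  rw [alcoveFloor_of_not_isPos hi] at this
  push_cast at this
  linarith

theorem coroot_nonneg_of_mem_closure {b : Φ.Base} {x : V}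
    (hx : ∀ i ∈ b.support, 0 ≤ Φ.coroot' i x) {y : N}
    (hy : y ∈ AddSubmonoid.closure (Φ.coroot '' b.support)) : 0 ≤ Φ.toLinearMap x y := by
  induction hy using AddSubmonoid.closure_induction with
  | mem y hy => obtain ⟨i, hi, rfl⟩ := hy; exact hx i hi
  | zero => simp
  | add y z _ _ hy hz => rw [map_add]; exact add_nonneg hy hz

/-- A gap: a nonzero sum of simple coroots takes at least the value that the simple coroots all
reach. It gives strict inequalities where membership in the cone alone gives weak ones. -/
theorem eq_zero_or_le_of_mem_closure {b : Φ.Base} {x : V} {c : ℝ} (hc : 0 ≤ c)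
    (hx : ∀ i ∈ b.support, c ≤ Φ.coroot' i x) {y : N}
    (hy : y ∈ AddSubmonoid.closure (Φ.coroot '' b.support)) : y = 0 ∨ c ≤ Φ.toLinearMap x y := by
  induction hy using AddSubmonoid.closure_induction with
  | mem y hy => obtain ⟨i, hi, rfl⟩ := hy; exact Or.inr (hx i hi)
  | zero => exact Or.inl rfl
  | add y z _ _ hy hz =>
    rcases hy with rfl | hy
    · rwa [zero_add]
    · rcases hz with rfl | hz
      · rw [add_zero]; exact Or.inr hy
      · rw [map_add]; exact Or.inr (by linarith)

variable [Φ.IsCrystallographic]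

theorem alcove_nonempty [Finite ι] [Φ.IsRootSystem] (b : Φ.Base) : (alcove b).Nonempty := by
  obtain ⟨x, hx⟩ := (LinearMap.IsPerfPair.bijective_left Φ.toLinearMap).surjective
    (b.toCoweightBasis.constr ℝ fun _ : b.support => (1 : ℝ))
  have hxs : ∀ i ∈ b.support, Φ.coroot' i x = 1 := by
    intro i hi
    have h := congrArg (fun f => f (b.toCoweightBasis ⟨i, hi⟩)) hx
    simp only [Module.Basis.constr_basis] at h
    rw [← h]
    simp
  have hpos : ∀ i, b.IsPos i → 1 ≤ Φ.coroot' i x := by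
    intro i hi
    have h0 := nonneg_of_simple b x (fun j hj => by rw [hxs j hj]; exact zero_le_one) i hi
    rcases b.coroot_mem_or_neg_mem i with h | h
    · exact (eq_zero_or_le_of_mem_closure zero_le_one (fun j hj => (hxs j hj).ge) h).resolve_left
        (Φ.flip.ne_zero i)
    · have h1 := (eq_zero_or_le_of_mem_closure zero_le_one (fun j hj => (hxs j hj).ge)
        h).resolve_left (neg_ne_zero.mpr (Φ.flip.ne_zero i))
      have h2 : Φ.toLinearMap x (-Φ.coroot i) = -Φ.coroot' i x := map_neg _ _
      rw [h2] at h1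
      linarith
  obtain ⟨M, hM⟩ := (Set.finite_range fun i => Φ.coroot' i x).bddAbove
  -- All positive coroots take values in $[1,M]$ at `x`; scaling moves these into $(0,1)$.
  refine ⟨(|M| + 1)⁻¹ • x, fun i hi => ?_⟩
  have h1 := hpos i hi
  have h2 : Φ.coroot' i x ≤ M := hM (Set.mem_range_self i)
  have h3 := le_abs_self M
  rw [map_smul, smul_eq_mul, inv_mul_eq_div]
  exact ⟨by positivity, by rw [div_lt_one (by positivity)]; linarith⟩

/-- The signed number of hyperplanes orthogonal to a root that separate `A` and `wA`. -/
def crossing (b : Φ.Base) (w : affWeyl Φ) (i : ι) : ℤ :=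
  wtPair Φ i (transPart w) + alcoveFloor b ((rootPerm w).symm i) - alcoveFloor b i

variable {b : Φ.Base}

/-- The cocycle identity: go from $A$ to $wA$, then from $wA$ to $ww'A$, the latter being the
$w$-image of the passage from $A$ to $w'A$. -/
theorem crossing_mul (w w' : affWeyl Φ) (i : ι) : crossing b (w * w') i =
    crossing b w i + crossing b w' ((rootPerm w).symm i) := by
  have h : (rootPerm (w * w')).symm i = (rootPerm w').symm ((rootPerm w).symm i) := by
    rw [rootPerm_mul]; rfl
  rw [crossing, crossing, crossing, wtPair_transPart_mul, h]
  ring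

theorem crossing_one (i : ι) : crossing b 1 i = 0 := by
  rw [crossing, transPart_one, wtPair_zero, rootPerm_one]
  change 0 + alcoveFloor b i - alcoveFloor b i = 0
  ring

theorem crossing_neg (w : affWeyl Φ) (i : ι) :
    crossing b w (Φ.reflectionPerm i i) = -crossing b w i := by
  rw [crossing, crossing, wtPair_reflPerm_self, rootPerm_symm_reflPerm_self, alcoveFloor_neg,
    alcoveFloor_neg]
  ring

theorem crossing_inv (w : affWeyl Φ) (i : ι) :
    crossing b w⁻¹ i = -crossing b w (rootPerm w i) := by
  have h := crossing_mul (b := b) w w⁻¹ (rootPerm w i)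
  rw [mul_inv_cancel, crossing_one, Equiv.symm_apply_apply] at h
  omega

theorem coroot_mem_image_alcove {x : V} (hx : x ∈ alcove b) (w : affWeyl Φ) (i : ι) :
    ((crossing b w i + alcoveFloor b i : ℤ) : ℝ) < Φ.coroot' i ((w : V ≃ᵃ[ℝ] V) x) ∧
      Φ.coroot' i ((w : V ≃ᵃ[ℝ] V) x) < ((crossing b w i + alcoveFloor b i : ℤ) : ℝ) + 1 := by
  have h := coroot_mem_alcove hx ((rootPerm w).symm i)
  rw [coroot_apply, crossing]
  push_cast
  constructor <;> linarith [h.1, h.2]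

/-- For a positive root, $\langle\cdot,\alpha^\vee\rangle$ maps $A$ into $(0,1)$ and $wA$ into
$(c,c+1)$, with $c$ the crossing number. The separating levels are therefore $1,\dots,c$ if $c>0$
and $c+1,\dots,0$ if $c<0$. -/
theorem separates_iff [Finite ι] [Φ.IsRootSystem] (w : affWeyl Φ) {i : ι} (hi : b.IsPos i)
    (k : ℤ) : Separates Φ i k (alcove b) ((w : V ≃ᵃ[ℝ] V) '' alcove b) ↔
      k ∈ Finset.Ioc (min 0 (crossing b w i)) (max 0 (crossing b w i)) := by
  have hw : ∀ x ∈ alcove b, (crossing b w i : ℝ) < Φ.coroot' i ((w : V ≃ᵃ[ℝ] V) x) ∧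
      Φ.coroot' i ((w : V ≃ᵃ[ℝ] V) x) < (crossing b w i : ℝ) + 1 := by
    intro x hx
    have := coroot_mem_image_alcove hx w i
    rwa [alcoveFloor_of_isPos hi, add_zero] at this
  obtain ⟨x, hx⟩ := alcove_nonempty b
  rw [Finset.mem_Ioc, min_lt_iff, le_max_iff]
  constructor
  · rintro (⟨h1, h2⟩ | ⟨h1, h2⟩)
    · have h3 : (0 : ℝ) < k := (hx i hi).1.trans (h1 x hx)
      have h4 := (h2 _ ⟨x, hx, rfl⟩).trans (hw x hx).2
      norm_cast at h3 h4
      omega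
    · have h3 : (k : ℝ) < 1 := (h1 x hx).trans (hx i hi).2
      have h4 := (hw x hx).1.trans (h2 _ ⟨x, hx, rfl⟩)
      norm_cast at h3 h4
      omega
  · intro h
    by_cases hk : 0 < k
    · refine Or.inl ⟨fun y hy => ?_, ?_⟩
      · have : (1 : ℝ) ≤ k := by exact_mod_cast hk
        linarith [(hx i hi).2, (hy i hi).2]
      · rintro _ ⟨y, hy, rfl⟩
        have : (k : ℝ) ≤ crossing b w i := by exact_mod_cast (by omega : k ≤ crossing b w i)
        linarith [(hw y hy).1]
    · refine Or.inr ⟨fun y hy => ?_, ?_⟩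
      · have : (k : ℝ) ≤ 0 := by exact_mod_cast (by omega : k ≤ 0)
        linarith [(hy i hi).1]
      · rintro _ ⟨y, hy, rfl⟩
        have : (crossing b w i : ℝ) + 1 ≤ k := by
          exact_mod_cast (by omega : crossing b w i + 1 ≤ k)
        linarith [(hw y hy).2]

open Classical in
theorem length_eq_sum [Fintype ι] [Φ.IsRootSystem] (w : affWeyl Φ) :
    length b w = ∑ i with b.IsPos i, (crossing b w i).natAbs := by
  have h : {p : ι × ℤ | b.IsPos p.1 ∧
      Separates Φ p.1 p.2 (alcove b) ((w : V ≃ᵃ[ℝ] V) '' alcove b)} =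
      ((Finset.univ.filter fun i => b.IsPos i).sigma fun i =>
        Finset.Ioc (min 0 (crossing b w i)) (max 0 (crossing b w i))).map
          (Equiv.sigmaEquivProd ι ℤ).toEmbedding := by
    ext ⟨i, k⟩
    simp only [Set.mem_ofPred_eq, Finset.coe_map, Set.mem_image, Finset.mem_coe, Finset.mem_sigma,
      Finset.mem_filter, Finset.mem_univ, true_and]
    constructor
    · rintro ⟨h1, h2⟩
      exact ⟨⟨i, k⟩, ⟨h1, (separates_iff w h1 k).mp h2⟩, rfl⟩
    · rintro ⟨⟨j, l⟩, ⟨h1, h2⟩, h3⟩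
      obtain ⟨rfl, rfl⟩ := Prod.mk.inj h3
      exact ⟨h1, (separates_iff w h1 _).mpr h2⟩
  rw [length, h, Set.ncard_coe_finset, Finset.card_map, Finset.card_sigma]
  refine Finset.sum_congr rfl fun i _ => ?_
  rw [Int.card_Ioc]
  omega

/-- Unlike the sum over positive roots, the sum over all roots is invariant under the permutation by
$w$ that enters the cocycle identity. -/
theorem two_mul_length [Fintype ι] [Φ.IsRootSystem] (w : affWeyl Φ) :
    (2 * length b w : ℤ) = ∑ i, |crossing b w i| := by
  classical
  rw [length_eq_sum, ← Finset.sum_filter_add_sum_filter_not Finset.univ (fun i => b.IsPos i)]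
  have h : ∑ i with ¬ b.IsPos i, |crossing b w i| = ∑ i with b.IsPos i, |crossing b w i| := by
    refine Finset.sum_nbij' (fun i => Φ.reflectionPerm i i) (fun i => Φ.reflectionPerm i i)
      ?_ ?_ ?_ ?_ ?_
    · intro i hi
      simpa [isPos_neg_iff] using hi
    · intro i hi
      simpa [isPos_neg_iff] using hi
    · intro i _
      exact reflPerm_neg_neg Φ i
    · intro i _
      exact reflPerm_neg_neg Φ i
    · intro i _
      rw [crossing_neg, abs_neg]
  rw [h]
  push_cast
  ring

theorem sum_crossing_perm [Fintype ι] [Φ.IsRootSystem] (w w' : affWeyl Φ) :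
    ∑ i, |crossing b w' ((rootPerm w).symm i)| = (2 * length b w' : ℤ) := by
  rw [two_mul_length, Equiv.sum_comp (rootPerm w).symm fun i => |crossing b w' i|]

variable [Finite ι] [Φ.IsRootSystem]

theorem length_mul_le (w w' : affWeyl Φ) : length b (w * w') ≤ length b w + length b w' := by
  have := Fintype.ofFinite ι
  have h1 := two_mul_length (b := b) w
  have h2 := sum_crossing_perm (b := b) w w'
  have h3 := two_mul_length (b := b) (w * w')
  simp only [crossing_mul] at h3
  have h4 := Finset.sum_le_sum fun i (_ : i ∈ Finset.univ) =>
    abs_add_le (crossing b w i) (crossing b w' ((rootPerm w).symm i))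
  rw [Finset.sum_add_distrib] at h4
  omega

/-- Equality in the triangle inequality: no hyperplane is crossed back. This criterion yields the
length additivities for translations below. -/
theorem length_mul_eq {w w' : affWeyl Φ}
    (h : ∀ i, b.IsPos i → 0 ≤ crossing b w i * crossing b w' ((rootPerm w).symm i)) :
    length b (w * w') = length b w + length b w' := by
  have := Fintype.ofFinite ι
  have hall : ∀ i, 0 ≤ crossing b w i * crossing b w' ((rootPerm w).symm i) := by
    intro i
    by_cases hi : b.IsPos i
    · exact h i hi
    · have := h _ ((isPos_neg_iff b i).mpr hi)
      rwa [rootPerm_symm_reflPerm_self, crossing_neg, crossing_neg, neg_mul_neg] at this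
  have h1 := two_mul_length (b := b) w
  have h2 := sum_crossing_perm (b := b) w w'
  have h3 := two_mul_length (b := b) (w * w')
  simp only [crossing_mul] at h3
  have h4 : ∀ i, |crossing b w i + crossing b w' ((rootPerm w).symm i)| =
      |crossing b w i| + |crossing b w' ((rootPerm w).symm i)| := fun i =>
    (abs_add_eq_add_abs_iff _ _).mpr (mul_nonneg_iff.mp (hall i))
  simp only [h4, Finset.sum_add_distrib] at h3
  omega

theorem length_one : length b (1 : affWeyl Φ) = 0 := by
  have := Fintype.ofFinite ι
  have h := two_mul_length (b := b) 1
  simp only [crossing_one, abs_zero, Finset.sum_const_zero] at h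
  omega

theorem length_inv (w : affWeyl Φ) : length b w⁻¹ = length b w := by
  have := Fintype.ofFinite ι
  have h := two_mul_length (b := b) w⁻¹
  simp only [crossing_inv, abs_neg] at h
  rw [Equiv.sum_comp (rootPerm w) fun i => |crossing b w i|, ← two_mul_length] at h
  omega

theorem length_eq_zero_iff {w : affWeyl Φ} :
    length b w = 0 ↔ ∀ i, b.IsPos i → crossing b w i = 0 := by
  classical
  have := Fintype.ofFinite ι
  rw [length_eq_sum, Finset.sum_eq_zero_iff]
  simp

theorem crossing_eq_zero {w : affWeyl Φ} (h : length b w = 0) (i : ι) : crossing b w i = 0 := by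
  rw [length_eq_zero_iff] at h
  by_cases hi : b.IsPos i
  · exact h i hi
  · have := h _ ((isPos_neg_iff b i).mpr hi)
    rw [crossing_neg] at this
    omega

end Length

/-! ### Simple reflections, exchange and descent in $W$. -/

section SimpleReflections

variable {ι V N : Type*} [AddCommGroup V] [Module ℝ V] [AddCommGroup N] [Module ℝ N]
  {Φ : RootPairing ι ℝ V N} [Φ.IsCrystallographic] {b : Φ.Base}

theorem crossing_trans (l : weightLattice Φ) (i : ι) :
    crossing b (trans Φ l) i = wtPair Φ i l := by
  rw [crossing, transPart_trans, rootPerm_trans]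
  change wtPair Φ i l + alcoveFloor b i - alcoveFloor b i = _
  ring

theorem crossing_refl (i : ι) (k : ℤ) (j : ι) : crossing b (refl Φ i k) j =
    k * Φ.pairingIn ℤ i j + alcoveFloor b (Φ.reflectionPerm i j) - alcoveFloor b j := by
  rw [crossing, transPart_refl, wtPair_zsmul, wtPair_rootWt, rootPerm_refl, Φ.reflectionPerm_symm]

theorem isPos_of_isHighestCoroot [Finite ι] [Φ.IsRootSystem] [Nonempty ι] {i : ι}
    (hi : IsHighestCoroot b i) : b.IsPos i := by
  obtain ⟨x, hx⟩ := alcove_nonempty b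
  obtain ⟨j, hj⟩ := b.support_nonempty
  rw [isPos_iff_coroot_pos hx]
  have h1 := coroot_nonneg_of_mem_closure (b := b) (x := x)
    (fun k hk => (hx k (b.isPos_of_mem_support hk)).1.le) (hi j)
  rw [map_sub] at h1
  have h2 : 0 < Φ.toLinearMap x (Φ.coroot j) := (hx j (b.isPos_of_mem_support hj)).1
  have h3 : Φ.coroot' i x = Φ.toLinearMap x (Φ.coroot i) := rfl
  linarith

theorem coroot_reflPerm (i j : ι) (x : V) : Φ.coroot' (Φ.reflectionPerm i j) x =
    Φ.coroot' j x - Φ.pairingIn ℤ i j * Φ.coroot' i x := by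
  rw [← Φ.coroot'_reflection, Φ.reflection_apply, map_sub, map_smul, smul_eq_mul]
  have : ((Φ.pairingIn ℤ i j : ℤ) : ℝ) = Φ.coroot' j (Φ.root i) := Φ.algebraMap_pairingIn ℤ i j
  rw [this]
  ring

/-- At a point of $A$ the highest coroot takes strictly the largest value among all coroots. Applied
to $\pm s_{\alpha_0}\alpha_j^\vee$ this forces $\langle\alpha_0,\alpha_j^\vee\rangle\in\{0,1\}$, and
in both cases the integer shift cancels the change of floor. -/
theorem crossing_refl_of_isHighestCoroot [Finite ι] [Φ.IsRootSystem] {i : ι}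
    (hi : IsHighestCoroot b i) {j : ι} (hj : b.IsPos j) (hji : j ≠ i) :
    crossing b (refl Φ i 1) j = 0 := by
  obtain ⟨x, hx⟩ := alcove_nonempty b
  have : Nonempty ι := ⟨i⟩
  have hx0 : ∀ k ∈ b.support, 0 ≤ Φ.coroot' k x := fun k hk =>
    (hx k (b.isPos_of_mem_support hk)).1.le
  have hle : ∀ k, Φ.coroot' k x ≤ Φ.coroot' i x := by
    intro k
    have h1 := coroot_nonneg_of_mem_closure hx0 (hi k)
    rw [map_sub] at h1
    exact sub_nonneg.mp h1
  have hlt : Φ.coroot' j x < Φ.coroot' i x := by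
    obtain ⟨c, hc, hc'⟩ : ∃ c : ℝ, 0 < c ∧ ∀ k ∈ b.support, c ≤ Φ.coroot' k x := by
      obtain ⟨k, hk, hk'⟩ := b.support.exists_min_image (fun k => Φ.coroot' k x)
        b.support_nonempty
      exact ⟨_, (hx k (b.isPos_of_mem_support hk)).1, hk'⟩
    rcases eq_zero_or_le_of_mem_closure hc.le hc' (hi j) with h1 | h1
    · exact absurd (Φ.coroot.injective (sub_eq_zero.mp h1)) hji.symm
    · rw [map_sub] at h1
      exact sub_pos.mp (hc.trans_le h1)
  have hj0 := hx j hj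
  have h1 := hle (Φ.reflectionPerm i j)
  have h2 := hle (Φ.reflectionPerm (Φ.reflectionPerm i j) (Φ.reflectionPerm i j))
  rw [coroot_neg] at h2
  rw [coroot_reflPerm] at h1 h2
  have h3 : -1 < Φ.pairingIn ℤ i j := by
    by_contra! h
    have : (Φ.pairingIn ℤ i j : ℝ) ≤ -1 := by exact_mod_cast h
    nlinarith
  have h4 : Φ.pairingIn ℤ i j < 2 := by
    by_contra! h
    have : (2 : ℝ) ≤ Φ.pairingIn ℤ i j := by exact_mod_cast h
    nlinarith
  have h5 := isPos_iff_coroot_pos hx (Φ.reflectionPerm i j)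
  rw [coroot_reflPerm] at h5
  rw [crossing_refl, alcoveFloor_of_isPos hj]
  obtain h | h : Φ.pairingIn ℤ i j = 0 ∨ Φ.pairingIn ℤ i j = 1 := by omega
  · rw [h] at h5 ⊢
    rw [alcoveFloor_of_isPos (h5.mpr (by simpa using hj0.1))]
    rfl
  · rw [h] at h5 ⊢
    rw [alcoveFloor_of_not_isPos (fun h6 => ?_)]
    · rfl
    · have := h5.mp h6
      push_cast at this
      linarith

theorem crossing_refl_self {i : ι} (hi : b.IsPos i) (k : ℤ) :
    crossing b (refl Φ i k) i = 2 * k - 1 := by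
  rw [crossing_refl, alcoveFloor_neg, alcoveFloor_of_isPos hi, Φ.pairingIn_same]
  ring

variable [Finite ι] [Φ.IsRootSystem]

theorem length_eq_one_of_crossing {s : affWeyl Φ} {i : ι} (hi : b.IsPos i)
    (h1 : crossing b s i = 1 ∨ crossing b s i = -1)
    (h2 : ∀ j, b.IsPos j → j ≠ i → crossing b s j = 0) : length b s = 1 := by
  classical
  have := Fintype.ofFinite ι
  rw [length_eq_sum, Finset.sum_eq_single i]
  · rcases h1 with h1 | h1 <;> rw [h1] <;> rfl
  · intro j hj hji
    rw [h2 j (Finset.mem_filter.mp hj).2 hji]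
    rfl
  · intro h
    exact absurd (Finset.mem_filter.mpr ⟨Finset.mem_univ i, hi⟩) h

/-- The reflection negates its own root, so in the cocycle identity the crossing number of $w$
enters with the opposite sign. -/
theorem length_refl_mul {i : ι} {k : ℤ} (hi : b.IsPos i)
    (h1 : crossing b (refl Φ i k) i = 1 ∨ crossing b (refl Φ i k) i = -1)
    (h2 : ∀ j, b.IsPos j → j ≠ i → crossing b (refl Φ i k) j = 0) {w : affWeyl Φ}
    (hw : crossing b (refl Φ i k) i * crossing b w i ≤ 0) :
    length b (refl Φ i k * w) = length b w + 1 := by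
  rw [length_mul_eq, length_eq_one_of_crossing hi h1 h2, add_comm]
  intro j hj
  rcases eq_or_ne j i with rfl | hji
  · rw [rootPerm_refl, Φ.reflectionPerm_symm, crossing_neg]
    linarith
  · rw [h2 j hj hji, zero_mul]

theorem length_refl_mul_of_pos {i : ι} {k : ℤ} (hi : b.IsPos i)
    (h1 : crossing b (refl Φ i k) i = 1 ∨ crossing b (refl Φ i k) i = -1)
    (h2 : ∀ j, b.IsPos j → j ≠ i → crossing b (refl Φ i k) j = 0) {w : affWeyl Φ}
    (hw : 0 < crossing b (refl Φ i k) i * crossing b w i) :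
    length b (refl Φ i k * w) + 1 = length b w := by
  rw [← length_refl_mul hi h1 h2 (w := refl Φ i k * w), ← mul_assoc, refl_mul_self, one_mul]
  rw [crossing_mul, rootPerm_refl, Φ.reflectionPerm_symm, crossing_neg]
  rcases h1 with h1 | h1 <;> rw [h1] at hw ⊢ <;> omega

variable [Φ.IsReduced]

/-- A simple reflection crosses exactly one hyperplane. -/
theorem IsSimpleRefl.exists_crossing {s : affWeyl Φ} (hs : IsSimpleRefl b s) :
    ∃ (i : ι) (k : ℤ), b.IsPos i ∧ s = refl Φ i k ∧
      (crossing b s i = 1 ∨ crossing b s i = -1) ∧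
      ∀ j, b.IsPos j → j ≠ i → crossing b s j = 0 := by
  rcases hs with ⟨i, hi, rfl⟩ | ⟨i, hi, rfl⟩
  · have : Nonempty ι := ⟨i⟩
    have hpos := isPos_of_isHighestCoroot hi
    exact ⟨i, 1, hpos, rfl, Or.inl (by rw [crossing_refl_self hpos]; rfl), fun j hj hji =>
      crossing_refl_of_isHighestCoroot hi hj hji⟩
  · have hpos := b.isPos_of_mem_support hi
    refine ⟨i, 0, hpos, rfl, Or.inr (by rw [crossing_refl_self hpos]; rfl), fun j hj hji => ?_⟩
    rw [crossing_refl, alcoveFloor_of_isPos hj, alcoveFloor_of_isPos (hj.reflectionPerm hi hji)]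
    ring

/-- Geometrically, $wA$ and $wtA$ are adjacent and lie on different sides of the wall of $s$. That
wall is thus the $w$-image of the wall of $t$, whence $s=wtw^{-1}$. -/
theorem simple_exchange {s t w : affWeyl Φ} (hs : IsSimpleRefl b s) (ht : IsSimpleRefl b t)
    (h1 : length b w < length b (s * w)) (h2 : length b (s * w * t) < length b (w * t)) :
    s * w = w * t := by
  obtain ⟨i, k, hi, rfl, hsi, hsj⟩ := hs.exists_crossing
  obtain ⟨j, m, hj, rfl, htj, hti⟩ := ht.exists_crossing
  have h3 : crossing b (refl Φ i k) i * crossing b w i ≤ 0 := by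
    by_contra! h
    have := length_refl_mul_of_pos hi hsi hsj h
    omega
  have h4 : 0 < crossing b (refl Φ i k) i * crossing b (w * refl Φ j m) i := by
    by_contra! h
    have := length_refl_mul hi hsi hsj h
    rw [← mul_assoc] at this
    omega
  rw [crossing_mul] at h4
  set p := (rootPerm w).symm i with hp
  have hpi : rootPerm w p = i := (rootPerm w).apply_symm_apply i
  -- The crossing number at `i` changes when `t` is appended, and `t` crosses only hyperplanes
  -- orthogonal to its own root.
  have h5 : p = j ∨ p = Φ.reflectionPerm j j := by
    by_contra! h
    have h6 : crossing b (refl Φ j m) p = 0 := by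
      by_cases hpos : b.IsPos p
      · exact hti p hpos h.1
      · have := hti _ ((isPos_neg_iff b p).mpr hpos) fun h7 => h.2 (by
          rw [← h7, reflPerm_neg_neg])
        rw [crossing_neg] at this
        omega
    rw [h6, add_zero] at h4
    omega
  have h6 : crossing b (refl Φ j m) p = 1 ∨ crossing b (refl Φ j m) p = -1 := by
    rcases h5 with h5 | h5
    · rwa [h5]
    · rw [h5, crossing_neg]
      omega
  have h7 : crossing b (refl Φ i k * w) i = crossing b (w * refl Φ j m) i := by
    rw [crossing_mul, crossing_mul, rootPerm_refl, Φ.reflectionPerm_symm, crossing_neg, ← hp]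
    rcases hsi with h | h <;> rw [h] at h3 h4 ⊢ <;> omega
  have hperm : rootPerm (refl Φ i k * w) = rootPerm (w * refl Φ j m) := by
    rw [rootPerm_mul, rootPerm_mul, rootPerm_refl, rootPerm_refl]
    ext l
    change Φ.reflectionPerm i (rootPerm w l) = rootPerm w (Φ.reflectionPerm j l)
    rw [← hpi, reflPerm_rootPerm]
    rcases h5 with h5 | h5
    · rw [h5]
    · rw [h5]
      congr 1
      apply Φ.root.injective
      rw [Φ.root_reflectionPerm, Φ.root_reflectionPerm, Φ.reflection_apply, Φ.reflection_apply,
        coroot_neg, Φ.root_reflectionPerm, Φ.reflection_apply_self]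
      module
  -- With equal linear parts, the two elements differ by a translation along $\alpha_i$. By `h7`
  -- their crossing numbers at `i` agree, which forces $2c=0$.
  obtain ⟨c, hc⟩ : ∃ c : ℤ,
      transPart (refl Φ i k * w) = transPart (w * refl Φ j m) + c • rootWt Φ i := by
    have hroot : (w : V ≃ᵃ[ℝ] V).linear (Φ.root j) = Φ.root i ∨
        (w : V ≃ᵃ[ℝ] V).linear (Φ.root j) = -Φ.root i := by
      rw [← hpi, ← linear_root]
      rcases h5 with h5 | h5
      · exact Or.inl (by rw [h5])
      · exact Or.inr (by rw [h5, Φ.root_reflectionPerm, Φ.reflection_apply_self, map_neg, neg_neg])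
    have hl : (transPart (refl Φ i k * w) : V) =
        transPart w - (Φ.coroot' i (transPart w : V) - k) • Φ.root i := refl_apply i k _
    have hr : (transPart (w * refl Φ j m) : V) =
        (m : ℝ) • (w : V ≃ᵃ[ℝ] V).linear (Φ.root j) + transPart w := by
      change (w : V ≃ᵃ[ℝ] V) ((refl Φ j m : V ≃ᵃ[ℝ] V) 0) = _
      rw [affineEquiv_apply, refl_apply, map_zero, zero_sub, zero_sub, neg_smul, neg_neg, map_smul]
      rfl
    rw [← wtPair_cast] at hl
    rcases hroot with h | h
    · refine ⟨k - wtPair Φ i (transPart w) - m, Subtype.ext ?_⟩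
      rw [AddSubgroup.coe_add, hl, hr, h, AddSubgroup.coe_zsmul, ← Int.cast_smul_eq_zsmul ℝ]
      push_cast
      change _ = _ + _ • Φ.root i
      module
    · refine ⟨k - wtPair Φ i (transPart w) + m, Subtype.ext ?_⟩
      rw [AddSubgroup.coe_add, hl, hr, h, AddSubgroup.coe_zsmul, ← Int.cast_smul_eq_zsmul ℝ]
      push_cast
      change _ = _ + _ • Φ.root i
      module
  refine affWeyl_ext hperm ?_
  rw [crossing, crossing, hperm, hc, wtPair_add, wtPair_zsmul, wtPair_rootWt_self] at h7
  have : c = 0 := by omega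
  rw [hc, this, zero_smul, add_zero]

/-- If no simple reflection shortens $w$, then a point of $wA$ is nonnegative on the simple coroots
and below $1$ on the highest coroot. These walls already bound $A$, so no hyperplane is crossed. -/
theorem exists_simple_descent [Φ.IsIrreducible] (w : affWeyl Φ) (hw : length b w ≠ 0) :
    ∃ s, IsSimpleRefl b s ∧ length b (s * w) + 1 = length b w := by
  by_contra! hcon
  have key : ∀ {i : ι} {k : ℤ}, b.IsPos i → IsSimpleRefl b (refl Φ i k) →
      crossing b (refl Φ i k) i * crossing b w i ≤ 0 := by
    intro i k hi hs
    by_contra! h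
    obtain ⟨j, m, hj, heq, hsj, hsi⟩ := hs.exists_crossing
    obtain rfl : i = j := by
      by_contra hij
      rw [hsi i hi hij] at h
      omega
    exact hcon _ hs (length_refl_mul_of_pos hi hsj hsi h)
  obtain ⟨i, hi⟩ := exists_isHighestCoroot b
  have : Nonempty ι := ⟨i⟩
  have hipos := isPos_of_isHighestCoroot hi
  obtain ⟨x, hx⟩ := alcove_nonempty b
  have hval : ∀ j, b.IsPos j → (crossing b w j : ℝ) < Φ.coroot' j ((w : V ≃ᵃ[ℝ] V) x) ∧
      Φ.coroot' j ((w : V ≃ᵃ[ℝ] V) x) < (crossing b w j : ℝ) + 1 := by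
    intro j hj
    have := coroot_mem_image_alcove hx w j
    rwa [alcoveFloor_of_isPos hj, add_zero] at this
  have hsimple : ∀ j ∈ b.support, 0 ≤ Φ.coroot' j ((w : V ≃ᵃ[ℝ] V) x) := by
    intro j hj
    have hjpos := b.isPos_of_mem_support hj
    have h1 := key hjpos (Or.inr ⟨j, hj, rfl⟩)
    rw [crossing_refl_self hjpos] at h1
    have h2 : (0 : ℝ) ≤ crossing b w j := by exact_mod_cast (by omega : 0 ≤ crossing b w j)
    linarith [(hval j hjpos).1]
  have htop : Φ.coroot' i ((w : V ≃ᵃ[ℝ] V) x) < 1 := by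
    have h1 := key hipos (Or.inl ⟨i, hi, rfl⟩)
    rw [crossing_refl_self hipos] at h1
    have h2 : (crossing b w i : ℝ) ≤ 0 := by exact_mod_cast (by omega : crossing b w i ≤ 0)
    linarith [(hval i hipos).2]
  refine hw (length_eq_zero_iff.mpr fun j hj => ?_)
  have h1 := nonneg_of_simple b _ hsimple j hj
  have h2 := coroot_nonneg_of_mem_closure hsimple (hi j)
  rw [map_sub] at h2
  have h3 : Φ.coroot' j ((w : V ≃ᵃ[ℝ] V) x) ≤ Φ.coroot' i ((w : V ≃ᵃ[ℝ] V) x) :=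
    sub_nonneg.mp h2
  have h4 := hval j hj
  have h5 : (crossing b w j : ℝ) < 1 := by linarith
  have h6 : (0 : ℝ) < crossing b w j + 1 := by linarith
  norm_cast at h5 h6
  omega

variable (b) in
/-- The length function of the extended affine Weyl group, with its simple reflections. -/
theorem isLengthSystem [Φ.IsIrreducible] : IsLengthSystem (length b) {s | IsSimpleRefl b s} where
  mul_self := by
    intro s hs
    obtain ⟨i, k, -, rfl, -, -⟩ := IsSimpleRefl.exists_crossing hs
    exact refl_mul_self i k
  one := length_one
  inv := length_inv
  mul_le := length_mul_le
  simple_mul := by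
    intro s hs w
    obtain ⟨i, k, hi, rfl, h1, h2⟩ := IsSimpleRefl.exists_crossing hs
    rcases le_or_gt (crossing b (refl Φ i k) i * crossing b w i) 0 with h | h
    · exact Or.inl (length_refl_mul hi h1 h2 h)
    · exact Or.inr (length_refl_mul_of_pos hi h1 h2 h)
  exists_descent := exists_simple_descent
  exchange := fun _ hs _ ht _ => simple_exchange hs ht

/-! ### The finite Weyl group -/

variable (b) in
/-- The simple reflections of the finite Weyl group. -/
def finSimple : Set (affWeyl Φ) := {s | ∃ i ∈ b.support, s = refl Φ i 0}

omit [Finite ι] [Φ.IsRootSystem] [Φ.IsReduced] in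
theorem finSimple_subset : finSimple b ⊆ {s | IsSimpleRefl b s} := fun _ hs => Or.inr hs

theorem refl_mem_closure (i : ι) : refl Φ i 0 ∈ Subgroup.closure (finSimple b) := by
  refine b.induction_reflect i (p := fun i => refl Φ i 0 ∈ Subgroup.closure (finSimple b))
    ?_ ?_ ?_
  · intro i hi
    convert hi using 1
    apply Subtype.ext
    ext x
    rw [refl_apply, refl_apply, coroot_neg, Φ.root_reflectionPerm, Φ.reflection_apply_self]
    module
  · exact fun i hi => Subgroup.subset_closure ⟨i, hi, rfl⟩
  · intro i j hi hj
    have hj' : refl Φ j 0 ∈ Subgroup.closure (finSimple b) :=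
      Subgroup.subset_closure ⟨j, hj, rfl⟩
    convert mul_mem (mul_mem hj' hi) hj' using 1
    apply affWeyl_ext
    · rw [rootPerm_mul, rootPerm_mul, rootPerm_refl, rootPerm_refl, rootPerm_refl]
      ext l
      apply Φ.root.injective
      change Φ.root (Φ.reflectionPerm (Φ.reflectionPerm j i) l) =
        Φ.root (Φ.reflectionPerm j (Φ.reflectionPerm i (Φ.reflectionPerm j l)))
      simp only [Φ.root_reflectionPerm, Φ.reflection_reflectionPerm]
      rfl
    · ext
      change (refl Φ (Φ.reflectionPerm j i) 0 : V ≃ᵃ[ℝ] V) 0 = (refl Φ j 0 : V ≃ᵃ[ℝ] V)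
        ((refl Φ i 0 : V ≃ᵃ[ℝ] V) ((refl Φ j 0 : V ≃ᵃ[ℝ] V) 0))
      simp [refl_apply]

theorem mem_closure_of_mem_finWeyl {w : affWeyl Φ} (hw : (w : V ≃ᵃ[ℝ] V) ∈ finWeyl Φ) :
    w ∈ Subgroup.closure (finSimple b) := by
  have h : finWeyl Φ ≤ (Subgroup.closure (finSimple b)).map (affWeyl Φ).subtype := by
    refine (Subgroup.closure_le _).mpr ?_
    rintro _ ⟨i, rfl⟩
    exact ⟨refl Φ i 0, refl_mem_closure i, rfl⟩
  obtain ⟨v, hv, hvw⟩ := h hw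
  rwa [Subtype.ext hvw] at hv

omit [Finite ι] [Φ.IsRootSystem] [Φ.IsReduced] in
theorem refl_mem_finWeyl (i : ι) : (refl Φ i 0 : V ≃ᵃ[ℝ] V) ∈ finWeyl Φ :=
  Subgroup.subset_closure ⟨i, rfl⟩

omit [Finite ι] [Φ.IsRootSystem] [Φ.IsReduced] in
theorem transPart_of_mem_finWeyl {w : affWeyl Φ} (hw : (w : V ≃ᵃ[ℝ] V) ∈ finWeyl Φ) :
    transPart w = 0 := by
  ext
  change (w : V ≃ᵃ[ℝ] V) 0 = 0
  generalize (w : V ≃ᵃ[ℝ] V) = g at hw ⊢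
  induction hw using Subgroup.closure_induction with
  | mem g hg =>
    obtain ⟨i, rfl⟩ := hg
    simp [affRefl_apply]
  | one => rfl
  | mul g h _ _ hg hh =>
    change g (h 0) = 0
    rw [hh, hg]
  | inv g _ hg => exact (AffineEquiv.symm_apply_eq g).mpr hg.symm

omit [Finite ι] [Φ.IsRootSystem] [Φ.IsReduced] in
theorem exists_eq_trans_mul (w : affWeyl Φ) :
    ∃ v : affWeyl Φ, (v : V ≃ᵃ[ℝ] V) ∈ finWeyl Φ ∧ w = trans Φ (transPart w) * v := by
  have h : ∀ g ∈ affWeyl Φ, g.linear.toAffineEquiv ∈ finWeyl Φ := by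
    intro g hg
    induction hg using Subgroup.closure_induction with
    | mem g hg =>
      rcases hg with hg | ⟨l, rfl⟩
      · induction hg using Subgroup.closure_induction with
        | mem g hg =>
          obtain ⟨i, rfl⟩ := hg
          convert refl_mem_finWeyl (Φ := Φ) i using 1
          ext x
          rw [refl_apply, Int.cast_zero, sub_zero]
          exact Φ.reflection_apply i x
        | one => exact one_mem _
        | mul g h _ _ hg hh => exact mul_mem hg hh
        | inv g _ hg => exact inv_mem hg
      · exact one_mem (finWeyl Φ)
    | one => exact one_mem _
    | mul g h _ _ hg hh => exact mul_mem hg hh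
    | inv g _ hg => exact inv_mem hg
  refine ⟨⟨_, Subgroup.subset_closure (Or.inl (h w w.2))⟩, h w w.2, Subtype.ext ?_⟩
  ext x
  change _ = (transPart w : V) + (w : V ≃ᵃ[ℝ] V).linear x
  rw [affineEquiv_apply, add_comm]
  rfl

end SimpleReflections

/-! ### The elements $T_w$ and $Y^\lambda$, and the operators on $\mathbb C[P]$. -/

section HeckeAlgebra

variable {ι V N : Type*} [AddCommGroup V] [Module ℝ V] [AddCommGroup N] [Module ℝ N]
  {Φ : RootPairing ι ℝ V N} [Φ.IsCrystallographic] {b : Φ.Base} {q : affWeyl Φ → ℝ}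

variable (q) in
/-- The coefficient `q_s - q_s⁻¹` of the quadratic relations. -/
def heckeCoeff (s : affWeyl Φ) : ℂ := (q s : ℂ) - (q s : ℂ)⁻¹

theorem T_one : T b q 1 = 1 := by
  rw [T, RingQuot.mkAlgHom_rel ℂ HeckeRel.one, map_one]

theorem T_mul {w w' : affWeyl Φ} (h : length b (w * w') = length b w + length b w') :
    T b q (w * w') = T b q w * T b q w' := by
  rw [T, RingQuot.mkAlgHom_rel ℂ (HeckeRel.braid w w' h), map_mul]
  rfl

theorem T_quadratic {s : affWeyl Φ} (hs : IsSimpleRefl b s) :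
    (T b q s - algebraMap ℂ _ (q s : ℂ)) * (T b q s + algebraMap ℂ _ (q s : ℂ)⁻¹) = 0 := by
  have h := RingQuot.mkAlgHom_rel ℂ (HeckeRel.quadratic (q := q) s hs)
  rw [map_mul, map_sub, map_add, AlgHom.commutes, AlgHom.commutes, map_zero] at h
  exact h

theorem mul_self_of_quadratic {A : Type*} [Ring A] [Algebra ℂ A] {x : A} {c : ℂ} (hc : c ≠ 0) :
    (x - algebraMap ℂ A c) * (x + algebraMap ℂ A c⁻¹) = 0 ↔ x * x = 1 + (c - c⁻¹) • x := by
  have h : (x - algebraMap ℂ A c) * (x + algebraMap ℂ A c⁻¹) =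
      x * x - (1 + (c - c⁻¹) • x) := by
    rw [sub_mul, mul_add, mul_add, ← map_mul, mul_inv_cancel₀ hc, map_one,
      ← Algebra.commutes c⁻¹ x, ← Algebra.smul_def, ← Algebra.smul_def, sub_smul]
    abel
  rw [h, sub_eq_zero]

theorem T_mul_self (hq : IsLengthMultiplicative b q) {s : affWeyl Φ} (hs : IsSimpleRefl b s) :
    T b q s * T b q s = 1 + heckeCoeff q s • T b q s :=
  (mul_self_of_quadratic (Complex.ofReal_ne_zero.mpr (hq.ne_zero s))).mp (T_quadratic hs)

variable [Finite ι] [Φ.IsRootSystem] [Φ.IsReduced] [Φ.IsIrreducible]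

/-- From $sw=wt$ with lengths adding, $q_sq_w=q_wq_t$. -/
theorem isHeckeParameter (hq : IsLengthMultiplicative b q) :
    IsHeckeParameter (length b) {s | IsSimpleRefl b s} (heckeCoeff q) := by
  intro s hs t ht w hw hl
  have hL := isLengthSystem b
  have h1 := hq.map_mul s w (by rw [hl, hL.len_simple hs, add_comm])
  have h2 := hq.map_mul w t (by rw [← hw, hl, hL.len_simple ht])
  rw [← hw, h1, mul_comm] at h2
  rw [heckeCoeff, heckeCoeff, mul_left_cancel₀ (hq.ne_zero w) h2]

/-- The elements `T_w` of the affine Hecke algebra are linearly independent. -/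
theorem linearIndependent_T (hq : IsLengthMultiplicative b q) :
    LinearIndependent ℂ (T b q) := by
  obtain ⟨X, hX1, hXmul, hXquad, hX⟩ :=
    exists_regular_representation (isLengthSystem b) (isHeckeParameter hq)
  let ρ : HeckeAlgebra b q →ₐ[ℂ] Module.End ℂ (affWeyl Φ →₀ ℂ) :=
    RingQuot.liftAlgHom ℂ ⟨FreeAlgebra.lift ℂ X, by
      rintro _ _ (_ | ⟨w, w', h⟩ | ⟨s, hs⟩)
      · rw [FreeAlgebra.lift_ι_apply, hX1, map_one]
      · rw [map_mul, FreeAlgebra.lift_ι_apply, FreeAlgebra.lift_ι_apply,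
          FreeAlgebra.lift_ι_apply, hXmul w w' h]
      · rw [map_mul, map_sub, map_add, AlgHom.commutes, AlgHom.commutes, map_zero,
          FreeAlgebra.lift_ι_apply]
        exact (mul_self_of_quadratic (A := Module.End ℂ (affWeyl Φ →₀ ℂ)) (x := X s)
          (Complex.ofReal_ne_zero.mpr (hq.ne_zero s))).mpr (hXquad s hs)⟩
  have hρ : ∀ w, ρ (T b q w) = X w := by
    intro w
    rw [T]
    change RingQuot.liftAlgHom ℂ _ _ = _
    rw [RingQuot.liftAlgHom_mkAlgHom_apply, FreeAlgebra.lift_ι_apply]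
  -- Applying the regular representation to the vector at `1` sends $T_w$ to the basis vector at
  -- $w$.
  let f : HeckeAlgebra b q →ₗ[ℂ] (affWeyl Φ →₀ ℂ) :=
    (LinearMap.applyₗ (Finsupp.single 1 1)).comp ρ.toLinearMap
  refine LinearIndependent.of_comp f ?_
  have hf : f ∘ T b q = fun w => Finsupp.single w 1 := by
    funext w
    change ρ (T b q w) (Finsupp.single 1 1) = _
    rw [hρ, hX]
  rw [hf]
  exact Finsupp.basisSingleOne.linearIndependent

/-- The quadratic relation gives $T_s^{-1}=T_s-(q_s-q_s^{-1})$, and length-zero elements are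
inverted by $T_{w^{-1}}$. -/
theorem isUnit_T (hq : IsLengthMultiplicative b q) (w : affWeyl Φ) : IsUnit (T b q w) := by
  have hL := isLengthSystem b
  refine hL.induction_left (p := fun w => IsUnit (T b q w)) (fun w hw => ?_)
    (fun s hs w hl hw => ?_) w
  · refine isUnit_iff_exists.mpr ⟨T b q w⁻¹, ?_, ?_⟩
    · rw [← T_mul, mul_inv_cancel, T_one]
      rw [mul_inv_cancel, hL.inv, hw, hL.one]
    · rw [← T_mul, inv_mul_cancel, T_one]
      rw [inv_mul_cancel, hL.inv, hw, hL.one]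
  · rw [T_mul (by rw [hl, hL.len_simple hs, add_comm])]
    refine IsUnit.mul (isUnit_iff_exists.mpr ⟨T b q s - heckeCoeff q s • 1, ?_, ?_⟩) hw
    · rw [mul_sub, T_mul_self hq hs, mul_smul_comm, mul_one, add_sub_cancel_right]
    · rw [sub_mul, T_mul_self hq hs, smul_mul_assoc, one_mul, add_sub_cancel_right]

/-! ### The commutative subalgebra of the `Y^λ` -/

omit [Finite ι] [Φ.IsCrystallographic] [Φ.IsRootSystem] [Φ.IsReduced] [Φ.IsIrreducible] in
theorem IsDominant.add {l m : weightLattice Φ} (hl : IsDominant b l) (hm : IsDominant b m) :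
    IsDominant b (l + m) := fun i hi => by
  rw [AddSubgroup.coe_add, map_add]
  exact add_nonneg (hl i hi) (hm i hi)

omit [Φ.IsReduced] [Φ.IsIrreducible] in
theorem T_trans_add {l m : weightLattice Φ} (hl : IsDominant b l) (hm : IsDominant b m) :
    T b q (trans Φ (l + m)) = T b q (trans Φ l) * T b q (trans Φ m) := by
  rw [trans_add, T_mul (length_mul_eq fun i hi => ?_)]
  rw [crossing_trans, crossing_trans, rootPerm_trans]
  exact mul_nonneg ((isDominant_iff b l).mp hl i hi) ((isDominant_iff b m).mp hm i hi)

omit [Φ.IsReduced] [Φ.IsIrreducible] in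
theorem T_trans_comm {l m : weightLattice Φ} (hl : IsDominant b l) (hm : IsDominant b m) :
    T b q (trans Φ l) * T b q (trans Φ m) = T b q (trans Φ m) * T b q (trans Φ l) := by
  rw [← T_trans_add hl hm, add_comm, T_trans_add hm hl]

/-- Independence of the dominant weights chosen in the definition of `Y`. Since $T_{t_\nu}$ is
invertible, this characterizes $Y^\lambda$ and replaces the definition from here on. -/
theorem Y_mul_T_trans (hq : IsLengthMultiplicative b q) {l μ ν : weightLattice Φ}
    (hμ : IsDominant b μ) (hν : IsDominant b ν) (hl : l = μ - ν) :
    Y b q l * T b q (trans Φ ν) = T b q (trans Φ μ) := by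
  obtain ⟨h1, h2, h3⟩ := (exists_dominant_sub b l).choose_spec
  rw [Y]
  set m := (exists_dominant_sub b l).choose
  refine (isUnit_T hq (trans Φ m.2)).mul_right_cancel ?_
  rw [mul_assoc, T_trans_comm hν h2, ← mul_assoc,
    mul_assoc _ (Ring.inverse _), Ring.inverse_mul_cancel _ (isUnit_T hq _), mul_one,
    ← T_trans_add h1 hν, ← T_trans_add hμ h2]
  congr 2
  rw [hl, sub_eq_sub_iff_add_eq_add] at h3
  exact h3.symm

theorem Y_of_isDominant (hq : IsLengthMultiplicative b q) {l : weightLattice Φ}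
    (hl : IsDominant b l) : Y b q l = T b q (trans Φ l) := by
  have h := Y_mul_T_trans hq hl (ν := 0) (fun i _ => by simp) (sub_zero l).symm
  rwa [trans_zero, T_one, mul_one] at h

theorem Y_zero (hq : IsLengthMultiplicative b q) : Y b q (0 : weightLattice Φ) = 1 := by
  rw [Y_of_isDominant hq (fun i _ => by simp), trans_zero, T_one]

theorem Y_add (hq : IsLengthMultiplicative b q) (l m : weightLattice Φ) :
    Y b q (l + m) = Y b q l * Y b q m := by
  obtain ⟨⟨μ, ν⟩, h1, h2, h3⟩ := exists_dominant_sub b l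
  obtain ⟨⟨μ', ν'⟩, h4, h5, h6⟩ := exists_dominant_sub b m
  refine (isUnit_T hq (trans Φ (ν' + ν))).mul_right_cancel ?_
  rw [Y_mul_T_trans hq (h1.add h4) (h5.add h2) (by rw [h3, h6]; abel), T_trans_add h5 h2,
    mul_assoc, ← mul_assoc (Y b q m), Y_mul_T_trans hq h4 h5 h6, T_trans_comm h4 h2, ← mul_assoc,
    Y_mul_T_trans hq h1 h2 h3, T_trans_add h1 h4]

/-- The homomorphism `e^λ ↦ Y^λ` from the group algebra of the weight lattice. -/
def YHom (hq : IsLengthMultiplicative b q) : GroupAlg Φ →ₐ[ℂ] HeckeAlgebra b q :=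
  AddMonoidAlgebra.lift ℂ _ _
    { toFun := fun l => Y b q l.toAdd
      map_one' := Y_zero hq
      map_mul' := fun l m => Y_add hq l.toAdd m.toAdd }

theorem YHom_e (hq : IsLengthMultiplicative b q) (l : weightLattice Φ) :
    YHom hq (e Φ l) = Y b q l := by
  rw [YHom, e, AddMonoidAlgebra.lift_single, one_smul]
  rfl

/-! ### The operators on the group algebra -/

omit [Finite ι] [Φ.IsRootSystem] [Φ.IsReduced] [Φ.IsIrreducible] in
theorem wtRefl_add (i : ι) (l m : weightLattice Φ) :
    wtRefl Φ i (l + m) = wtRefl Φ i l + wtRefl Φ i m := by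
  rw [wtRefl, wtRefl, wtRefl, wtPair_add, add_smul]
  abel

omit [Finite ι] [Φ.IsRootSystem] [Φ.IsReduced] [Φ.IsIrreducible] in
theorem wtRefl_wtRefl (i : ι) (l : weightLattice Φ) : wtRefl Φ i (wtRefl Φ i l) = l := by
  rw [wtRefl, wtRefl, wtPair_sub, wtPair_zsmul, wtPair_rootWt_self]
  module

omit [Finite ι] [Φ.IsCrystallographic] [Φ.IsRootSystem] [Φ.IsReduced] [Φ.IsIrreducible] in
theorem e_zero : e Φ 0 = 1 := rfl

omit [Finite ι] [Φ.IsCrystallographic] [Φ.IsRootSystem] [Φ.IsReduced] [Φ.IsIrreducible] in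
theorem e_induction {p : GroupAlg Φ → Prop} (h0 : p 0) (hadd : ∀ x y, p x → p y → p (x + y))
    (he : ∀ l (c : ℂ), p (c • e Φ l)) (x : GroupAlg Φ) : p x := by
  induction x using AddMonoidAlgebra.induction_linear with
  | zero => exact h0
  | add x y hx hy => exact hadd x y hx hy
  | single l c =>
    have hs : AddMonoidAlgebra.single l c = c • e Φ l := by simp [e]
    rw [hs]
    exact he l c

omit [Finite ι] [Φ.IsRootSystem] [Φ.IsReduced] [Φ.IsIrreducible] in
theorem reflAlg_e (i : ι) (l : weightLattice Φ) : reflAlg Φ i (e Φ l) = e Φ (wtRefl Φ i l) :=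
  onBasis_e Φ _ l

omit [Finite ι] [Φ.IsRootSystem] [Φ.IsReduced] [Φ.IsIrreducible] in
theorem reflAlg_mul (i : ι) (x y : GroupAlg Φ) :
    reflAlg Φ i (x * y) = reflAlg Φ i x * reflAlg Φ i y := by
  refine e_induction (p := fun x => reflAlg Φ i (x * y) = reflAlg Φ i x * reflAlg Φ i y)
    (by simp) (fun x x' h h' => by rw [add_mul, map_add, map_add, add_mul, h, h'])
    (fun l c => ?_) x
  refine e_induction (p := fun y => reflAlg Φ i (c • e Φ l * y) =
    reflAlg Φ i (c • e Φ l) * reflAlg Φ i y)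
    (by simp) (fun x x' h h' => by rw [mul_add, map_add, map_add, mul_add, h, h'])
    (fun m d => ?_) y
  rw [smul_mul_smul_comm, e_mul_e, map_smul, map_smul, map_smul, smul_mul_smul_comm, reflAlg_e,
    reflAlg_e, reflAlg_e, e_mul_e, wtRefl_add]

-- Allows cancelling $1-e^{-\alpha}$, so that identities for `divDiff` follow from its defining
-- quotient property.
omit [Finite ι] [Φ.IsCrystallographic] [Φ.IsRootSystem] [Φ.IsReduced] [Φ.IsIrreducible] in
theorem noZeroDivisors_groupAlg : NoZeroDivisors (GroupAlg Φ) := by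
  let : Module ℚ V := Module.compHom V (algebraMap ℚ ℝ)
  have : TwoUniqueSums (weightLattice Φ) := TwoUniqueSums.of_injective_addHom
    (weightLattice Φ).subtype.toAddHom Subtype.val_injective inferInstance
  infer_instance

omit [Finite ι] [Φ.IsRootSystem] [Φ.IsReduced] [Φ.IsIrreducible] in
theorem one_sub_e_ne_zero (i : ι) : (1 : GroupAlg Φ) - e Φ (-rootWt Φ i) ≠ 0 := by
  intro h
  rw [sub_eq_zero, ← e_zero] at h
  have h1 := Finsupp.single_left_injective (one_ne_zero (α := ℂ)) (congrArg (·.coeff) h)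
  have h2 := wtPair_rootWt_self (Φ := Φ) i
  rw [zero_eq_neg.mp h1, wtPair_zero] at h2
  omega

omit [Finite ι] [Φ.IsRootSystem] [Φ.IsReduced] [Φ.IsIrreducible] in
/-- The twisted Leibniz rule for `(1 - e^{-α})⁻¹ (1 - s_α)`. -/
theorem divDiff_mul (i : ι) (x y : GroupAlg Φ) :
    divDiff Φ i (x * y) = reflAlg Φ i x * divDiff Φ i y + divDiff Φ i x * y := by
  have := noZeroDivisors_groupAlg (Φ := Φ)
  refine mul_left_cancel₀ (one_sub_e_ne_zero i) ?_
  rw [one_sub_mul_divDiff, reflAlg_mul, mul_add, mul_left_comm, ← mul_assoc _ (divDiff Φ i x),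
    one_sub_mul_divDiff, one_sub_mul_divDiff]
  ring

omit [Finite ι] [Φ.IsRootSystem] [Φ.IsReduced] [Φ.IsIrreducible] in
theorem divDiff_e_of_zero {i : ι} {l : weightLattice Φ} (hl : wtPair Φ i l = 0) :
    divDiff Φ i (e Φ l) = 0 := by
  rw [divDiff, onBasis_e, if_neg (by omega), if_pos hl]

omit [Finite ι] [Φ.IsRootSystem] [Φ.IsReduced] [Φ.IsIrreducible] in
theorem divDiff_e_of_one {i : ι} {l : weightLattice Φ} (hl : wtPair Φ i l = 1) :
    divDiff Φ i (e Φ l) = e Φ l := by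
  rw [divDiff, onBasis_e, if_pos (by omega), hl]
  simp

omit [Finite ι] [Φ.IsRootSystem] [Φ.IsReduced] [Φ.IsIrreducible] in
theorem divDiff_e_of_neg_one {i : ι} {l : weightLattice Φ} (hl : wtPair Φ i l = -1) :
    divDiff Φ i (e Φ l) = -e Φ (wtRefl Φ i l) := by
  rw [divDiff, onBasis_e, if_neg (by omega), if_neg (by omega), wtRefl, hl]
  simp

end HeckeAlgebra

/-! ### The Bernstein relation. -/

section Bernstein

variable {ι V N : Type*} [AddCommGroup V] [Module ℝ V] [AddCommGroup N] [Module ℝ N]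
  {Φ : RootPairing ι ℝ V N} [Φ.IsCrystallographic] {b : Φ.Base} {q : affWeyl Φ → ℝ}
  [Finite ι] [Φ.IsRootSystem]

omit [Φ.IsCrystallographic] [Finite ι] in
variable (b) in
/-- Weights with prescribed integral pairings with the simple coroots exist. -/
theorem exists_weight (f : ι → ℤ) : ∃ l : weightLattice Φ, ∀ i ∈ b.support, wtPair Φ i l = f i := by
  obtain ⟨x, hx⟩ := (LinearMap.IsPerfPair.bijective_left Φ.toLinearMap).surjective
    (b.toCoweightBasis.constr ℝ fun i : b.support => (f i : ℝ))
  have hxs : ∀ i ∈ b.support, Φ.coroot' i x = f i := by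
    intro i hi
    have h := congrArg (fun g => g (b.toCoweightBasis ⟨i, hi⟩)) hx
    simp only [Module.Basis.constr_basis] at h
    rw [← h]
    simp
  have hxP : x ∈ weightLattice Φ := by
    intro i
    refine Submodule.span_induction (p := fun y _ => ∃ z : ℤ, (z : ℝ) = Φ.toLinearMap x y)
      ?_ ?_ ?_ ?_ (b.coroot_mem_span_int i)
    · rintro _ ⟨j, hj, rfl⟩
      exact ⟨_, (hxs j hj).symm⟩
    · exact ⟨0, by simp⟩
    · rintro y z - - ⟨c, hc⟩ ⟨d, hd⟩
      exact ⟨c + d, by rw [map_add, ← hc, ← hd, Int.cast_add]⟩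
    · rintro a y - ⟨c, hc⟩
      exact ⟨a * c, by rw [map_zsmul, ← hc, Int.cast_mul, zsmul_eq_mul]⟩
  exact ⟨⟨x, hxP⟩, fun i hi => (wtPair_eq_iff i _ _).mpr (hxs i hi)⟩

omit [Φ.IsRootSystem] in
theorem isDominant_of_simple {l : weightLattice Φ} (hl : ∀ i ∈ b.support, 0 ≤ wtPair Φ i l) :
    IsDominant b l := fun i hi =>
  nonneg_of_simple b l (fun j hj => by rw [← wtPair_cast]; exact_mod_cast hl j hj) i hi

/-- For a positive root, the crossing number of $v$ is $-1$ exactly when $v^{-1}\alpha$ is negative,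
and there a dominant $\lambda$ pairs nonpositively; hence no crossing is undone. -/
theorem length_mul_trans {v : affWeyl Φ} (hv : (v : V ≃ᵃ[ℝ] V) ∈ finWeyl Φ)
    {l : weightLattice Φ} (hl : IsDominant b l) :
    length b (v * trans Φ l) = length b v + length b (trans Φ l) := by
  refine length_mul_eq fun i hi => ?_
  rw [isDominant_iff] at hl
  rw [crossing_trans, crossing, transPart_of_mem_finWeyl hv, wtPair_zero, alcoveFloor_of_isPos hi]
  by_cases h : b.IsPos ((rootPerm v).symm i)
  · rw [alcoveFloor_of_isPos h]
    simp
  · rw [alcoveFloor_of_not_isPos h]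
    have := hl _ ((isPos_neg_iff b _).mpr h)
    rw [wtPair_reflPerm_self] at this
    omega

theorem T_refl_comm {j : ι} {l : weightLattice Φ} (hl : IsDominant b l)
    (hl0 : wtPair Φ j l = 0) :
    T b q (refl Φ j 0) * T b q (trans Φ l) = T b q (trans Φ l) * T b q (refl Φ j 0) := by
  have h1 : refl Φ j 0 * trans Φ l = trans Φ l * refl Φ j 0 := by
    rw [refl_zero_mul_trans, wtRefl, hl0, zero_smul, sub_zero]
  have h2 := length_mul_trans (refl_mem_finWeyl j) hl
  rw [← T_mul h2, h1, T_mul (by rw [← h1, h2, add_comm])]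

variable [Φ.IsReduced]

omit [Φ.IsRootSystem] in
theorem crossing_refl_of_mem_support {i j : ι} (hj : j ∈ b.support) (hi : b.IsPos i)
    (hij : i ≠ j) : crossing b (refl Φ j 0) i = 0 := by
  rw [crossing_refl, alcoveFloor_of_isPos hi, alcoveFloor_of_isPos (hi.reflectionPerm hj hij)]
  ring

variable [Φ.IsIrreducible]

theorem T_refl_comm_Y (hq : IsLengthMultiplicative b q) {j : ι} (hj : j ∈ b.support)
    {l : weightLattice Φ} (hl : wtPair Φ j l = 0) :
    T b q (refl Φ j 0) * Y b q l = Y b q l * T b q (refl Φ j 0) := by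
  -- The absolute values make both `μ` and `l + μ` dominant while keeping `μ` orthogonal to
  -- $\alpha_j$, which reduces the claim to dominant weights.
  obtain ⟨μ, hμ⟩ := exists_weight b fun i => |wtPair Φ i l|
  have hμd : IsDominant b μ := isDominant_of_simple fun i hi => by rw [hμ i hi]; exact abs_nonneg _
  have hμl : IsDominant b (l + μ) := isDominant_of_simple fun i hi => by
    rw [wtPair_add, hμ i hi]
    linarith [neg_abs_le (wtPair Φ i l)]
  have hμ0 : wtPair Φ j μ = 0 := by rw [hμ j hj, hl, abs_zero]
  refine (isUnit_T hq (trans Φ μ)).mul_right_cancel ?_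
  rw [mul_assoc, Y_mul_T_trans hq hμl hμd (add_sub_cancel_right l μ).symm, mul_assoc,
    T_refl_comm hμd hμ0, ← mul_assoc, Y_mul_T_trans hq hμl hμd (add_sub_cancel_right l μ).symm,
    T_refl_comm hμl (by rw [wtPair_add, hl, hμ0, add_zero])]

/-- The Bernstein relation for a dominant weight `λ` with `⟨λ, α_j^∨⟩ = 1`. -/
theorem T_mul_Y_mul_T (hq : IsLengthMultiplicative b q) {j : ι} (hj : j ∈ b.support)
    {l : weightLattice Φ} (hl : IsDominant b l) (hl1 : wtPair Φ j l = 1) :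
    T b q (refl Φ j 0) * Y b q (wtRefl Φ j l) * T b q (refl Φ j 0) = Y b q l := by
  classical
  have hjpos := b.isPos_of_mem_support hj
  have hlp := (isDominant_iff b l).mp hl
  have hw : wtRefl Φ j l = l - rootWt Φ j := by rw [wtRefl, hl1, one_smul]
  -- Although $s_j\lambda$ need not be dominant, $\kappa=s_j\lambda+\lambda$ is, so
  -- $Y^{s_j\lambda}=T_{t_\kappa}T_{t_\lambda}^{-1}$.
  have hκ : IsDominant b (wtRefl Φ j l + l) := by
    refine isDominant_of_simple fun i hi => ?_
    rw [hw, wtPair_add, wtPair_sub, wtPair_rootWt]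
    rcases eq_or_ne j i with rfl | hij
    · rw [hl1, Φ.pairingIn_same]
      omega
    · have h1 := b.pairingIn_le_zero_of_ne hij hj hi
      have h2 := hlp i (b.isPos_of_mem_support hi)
      omega
  have hcr : ∀ i, b.IsPos i → crossing b (trans Φ l * refl Φ j 0) i =
      if i = j then 0 else wtPair Φ i l := by
    intro i hi
    rw [crossing_mul, crossing_trans, rootPerm_trans]
    change wtPair Φ i l + crossing b (refl Φ j 0) i = _
    split_ifs with hij
    · rw [hij, hl1, crossing_refl_self hjpos]
      rfl
    · rw [crossing_refl_of_mem_support hj hi hij, add_zero]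
  have hperm : (rootPerm (trans Φ l * refl Φ j 0)).symm = Φ.reflectionPerm j := by
    rw [rootPerm_mul, rootPerm_trans, one_mul, rootPerm_refl, Φ.reflectionPerm_symm]
  -- Put $u=t_\lambda s_j$. As $\langle\lambda,\alpha_j^\vee\rangle=1$, $u$ crosses nothing at
  -- $\alpha_j$, and appending $s_j$ restores the full length of $t_\lambda$.
  have hTl : T b q (trans Φ l) = T b q (trans Φ l * refl Φ j 0) * T b q (refl Φ j 0) := by
    rw [← T_mul, mul_assoc, refl_mul_self, mul_one]
    refine length_mul_eq fun i hi => ?_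
    rw [hcr i hi, hperm]
    split_ifs with hij
    · rw [zero_mul]
    · rw [crossing_refl_of_mem_support hj (hi.reflectionPerm hj hij), mul_zero]
      intro h
      have h2 : i = Φ.reflectionPerm j j := by rw [← Φ.reflectionPerm_self j i, h]
      rw [h2] at hi
      exact (isPos_neg_iff b j).mp hi hjpos
  -- Both sides are $T$ of the same element $ut_\lambda=s_jt_\kappa$, with lengths adding in either
  -- factorization. Cancelling $T_{t_\lambda}$ gives $T_u=T_jY^{s_j\lambda}$.
  have hTll : T b q (trans Φ l * refl Φ j 0) * T b q (trans Φ l) =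
      T b q (refl Φ j 0) * T b q (trans Φ (wtRefl Φ j l + l)) := by
    have h1 : trans Φ l * refl Φ j 0 * trans Φ l =
        refl Φ j 0 * trans Φ (wtRefl Φ j l + l) := by
      rw [mul_assoc, refl_zero_mul_trans, refl_zero_mul_trans, ← mul_assoc, ← trans_add,
        wtRefl_add, wtRefl_wtRefl]
    rw [← T_mul (length_mul_trans (refl_mem_finWeyl j) hκ), ← h1]
    refine (T_mul (length_mul_eq fun i hi => ?_)).symm
    rw [hcr i hi, hperm, crossing_trans]
    split_ifs with hij
    · rw [zero_mul]
    · exact mul_nonneg (hlp i hi) (hlp _ (hi.reflectionPerm hj hij))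
  have h1 : T b q (trans Φ l * refl Φ j 0) = T b q (refl Φ j 0) * Y b q (wtRefl Φ j l) := by
    refine (isUnit_T hq (trans Φ l)).mul_right_cancel ?_
    rw [hTll, mul_assoc, Y_mul_T_trans hq hκ hl (by abel)]
  rw [Y_of_isDominant hq hl, ← h1, ← hTl]

/-- The Bernstein relation in the affine Hecke algebra, for an element of the group algebra. -/
def SatisfiesBernstein (hq : IsLengthMultiplicative b q) (j : ι) (x : GroupAlg Φ) : Prop :=
  T b q (refl Φ j 0) * YHom hq x = YHom hq (reflAlg Φ j x) * T b q (refl Φ j 0) +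
    heckeCoeff q (refl Φ j 0) • YHom hq (divDiff Φ j x)

/-- The twisted Leibniz rule of `divDiff` is exactly what multiplicativity requires. -/
theorem SatisfiesBernstein.mul {hq : IsLengthMultiplicative b q} {j : ι} {x y : GroupAlg Φ}
    (hx : SatisfiesBernstein hq j x) (hy : SatisfiesBernstein hq j y) :
    SatisfiesBernstein hq j (x * y) := by
  unfold SatisfiesBernstein at *
  rw [map_mul, ← mul_assoc, hx, add_mul, mul_assoc, hy, reflAlg_mul, divDiff_mul, map_mul, map_add,
    map_mul, map_mul, mul_add, smul_add, smul_mul_assoc, mul_smul_comm, mul_assoc]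
  abel

theorem satisfiesBernstein_of_zero (hq : IsLengthMultiplicative b q) {j : ι} (hj : j ∈ b.support)
    {l : weightLattice Φ} (hl : wtPair Φ j l = 0) : SatisfiesBernstein hq j (e Φ l) := by
  rw [SatisfiesBernstein, divDiff_e_of_zero hl, reflAlg_e, wtRefl, hl, zero_smul, sub_zero,
    map_zero, smul_zero, add_zero, YHom_e, T_refl_comm_Y hq hj hl]

theorem satisfiesBernstein_of_one (hq : IsLengthMultiplicative b q) {j : ι} (hj : j ∈ b.support)
    {l : weightLattice Φ} (hd : IsDominant b l) (hl : wtPair Φ j l = 1) :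
    SatisfiesBernstein hq j (e Φ l) := by
  rw [SatisfiesBernstein, divDiff_e_of_one hl, reflAlg_e, YHom_e, YHom_e]
  conv_lhs => rw [← T_mul_Y_mul_T hq hj hd hl]
  rw [← mul_assoc, ← mul_assoc, T_mul_self hq (Or.inr ⟨j, hj, rfl⟩), add_mul, add_mul, one_mul,
    smul_mul_assoc, smul_mul_assoc, T_mul_Y_mul_T hq hj hd hl]

/-- Inverting $T_jY^{s_j\lambda}T_j=Y^\lambda$ gives $Y^{s_j\lambda}T_jY^{-\lambda}=T_j^{-1}$, and
$T_j^{-1}=T_j-(q_j-q_j^{-1})$. -/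
theorem satisfiesBernstein_of_neg_one (hq : IsLengthMultiplicative b q) {j : ι}
    (hj : j ∈ b.support) {l : weightLattice Φ} (hd : IsDominant b l) (hl : wtPair Φ j l = 1) :
    SatisfiesBernstein hq j (e Φ (-l)) := by
  have hneg : wtPair Φ j (-l) = -1 := by rw [wtPair_neg, hl]
  have hrefl : wtRefl Φ j (-l) = -wtRefl Φ j l := by
    rw [wtRefl, wtRefl, wtPair_neg]
    module
  rw [SatisfiesBernstein, divDiff_e_of_neg_one hneg, reflAlg_e, map_neg, YHom_e, YHom_e, hrefl]
  set t := T b q (refl Φ j 0)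
  have ht : t * (t - heckeCoeff q (refl Φ j 0) • 1) = 1 := by
    rw [mul_sub, T_mul_self hq (Or.inr ⟨j, hj, rfl⟩), mul_smul_comm, mul_one,
      add_sub_cancel_right]
  have h1 : Y b q (wtRefl Φ j l) * t * Y b q (-l) = t - heckeCoeff q (refl Φ j 0) • 1 := by
    refine (isUnit_T hq (refl Φ j 0)).mul_left_cancel ?_
    change t * _ = t * _
    rw [ht, ← mul_assoc, ← mul_assoc, T_mul_Y_mul_T hq hj hd hl, ← Y_add hq, add_neg_cancel,
      Y_zero hq]
  have h2 := congrArg (Y b q (-wtRefl Φ j l) * ·) h1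
  simp only [← mul_assoc] at h2
  rw [← Y_add hq, neg_add_cancel, Y_zero hq, one_mul] at h2
  rw [h2, mul_sub, mul_smul_comm, mul_one, smul_neg, sub_eq_add_neg]

/-- The Bernstein relation in the affine Hecke algebra. -/
theorem satisfiesBernstein (hq : IsLengthMultiplicative b q) {j : ι} (hj : j ∈ b.support)
    (x : GroupAlg Φ) : SatisfiesBernstein hq j x := by
  classical
  -- The fundamental weight of $\alpha_j$: every weight is a multiple of it plus a weight orthogonal
  -- to $\alpha_j$.
  obtain ⟨ω, hω⟩ := exists_weight b fun i => if i = j then 1 else 0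
  have hωd : IsDominant b ω := isDominant_of_simple fun i hi => by
    rw [hω i hi]
    split_ifs <;> omega
  have hω1 : wtPair Φ j ω = 1 := by rw [hω j hj, if_pos rfl]
  have hmul : ∀ n : ℤ, SatisfiesBernstein hq j (e Φ (n • ω)) := by
    intro n
    induction n with
    | zero =>
      rw [zero_smul]
      exact satisfiesBernstein_of_zero hq hj (wtPair_zero j)
    | succ n ih =>
      rw [add_smul, one_smul, ← e_mul_e]
      exact ih.mul (satisfiesBernstein_of_one hq hj hωd hω1)
    | pred n ih =>
      rw [sub_smul, one_smul, sub_eq_add_neg, ← e_mul_e]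
      exact ih.mul (satisfiesBernstein_of_neg_one hq hj hωd hω1)
  refine e_induction (p := SatisfiesBernstein hq j) ?_ ?_ ?_ x
  · simp [SatisfiesBernstein]
  · intro x y hx hy
    unfold SatisfiesBernstein at *
    rw [map_add, map_add, map_add, map_add, map_add, mul_add, add_mul, smul_add, hx, hy]
    abel
  · intro l c
    have hl : SatisfiesBernstein hq j (e Φ l) := by
      have h0 : wtPair Φ j (l - wtPair Φ j l • ω) = 0 := by
        rw [wtPair_sub, wtPair_zsmul, hω1]
        ring
      have := (hmul (wtPair Φ j l)).mul (satisfiesBernstein_of_zero hq hj h0)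
      rwa [e_mul_e, add_sub_cancel] at this
    unfold SatisfiesBernstein at *
    rw [map_smul, map_smul, map_smul, map_smul, map_smul, mul_smul_comm, smul_mul_assoc,
      smul_comm (heckeCoeff q _) c, ← smul_add, hl]

theorem T_mul_YHom (hq : IsLengthMultiplicative b q) {j : ι} (hj : j ∈ b.support)
    (x : GroupAlg Φ) : T b q (refl Φ j 0) * YHom hq x =
      YHom hq (reflAlg Φ j x) * T b q (refl Φ j 0) +
        heckeCoeff q (refl Φ j 0) • YHom hq (divDiff Φ j x) :=
  satisfiesBernstein hq hj x

end Bernstein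

/-! ### Generators and the basis $T_wY^\lambda$. -/

section Basis

variable {ι V N : Type*} [AddCommGroup V] [Module ℝ V] [AddCommGroup N] [Module ℝ N]
  {Φ : RootPairing ι ℝ V N} [Φ.IsCrystallographic] {b : Φ.Base} {q : affWeyl Φ → ℝ}
  [Finite ι] [Φ.IsRootSystem] [Φ.IsReduced] [Φ.IsIrreducible]

/-- Induction along reduced expressions in the finite Weyl group, with left multiplication. -/
theorem finWeyl_induction_left {p : affWeyl Φ → Prop} (h0 : p 1)
    (h1 : ∀ j ∈ b.support, ∀ w : affWeyl Φ, (w : V ≃ᵃ[ℝ] V) ∈ finWeyl Φ →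
      length b (refl Φ j 0 * w) = length b w + 1 → p w → p (refl Φ j 0 * w)) {w : affWeyl Φ}
    (hw : (w : V ≃ᵃ[ℝ] V) ∈ finWeyl Φ) : p w := by
  have hle : Subgroup.closure (finSimple b) ≤ (finWeyl Φ).subgroupOf (affWeyl Φ) := by
    refine (Subgroup.closure_le _).mpr ?_
    rintro _ ⟨j, -, rfl⟩
    exact refl_mem_finWeyl j
  refine (isLengthSystem b).closure_induction_left finSimple_subset h0 ?_
    (mem_closure_of_mem_finWeyl hw)
  rintro _ ⟨j, hj, rfl⟩ w hw hl hp
  exact h1 j hj w (hle hw) hl hp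

omit [Finite ι] [Φ.IsRootSystem] [Φ.IsReduced] [Φ.IsIrreducible] in
theorem inv_refl (j : ι) : (refl Φ j 0)⁻¹ = refl Φ j 0 :=
  inv_eq_of_mul_eq_one_left (refl_mul_self j 0)

open Classical in
theorem T_simple_mul (hq : IsLengthMultiplicative b q) {s : affWeyl Φ} (hs : IsSimpleRefl b s)
    (w : affWeyl Φ) : T b q s * T b q w = T b q (s * w) +
      (if length b (s * w) < length b w then heckeCoeff q s else 0) • T b q w := by
  have hL := isLengthSystem b
  have h1 := hL.len_simple hs
  rcases hL.simple_mul s hs w with h | h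
  · rw [if_neg (by omega), zero_smul, add_zero, T_mul (by omega)]
  · have h2 : T b q w = T b q s * T b q (s * w) := by
      rw [← T_mul (by rw [hL.simple_mul_cancel hs]; omega), hL.simple_mul_cancel hs]
    rw [if_pos (by omega)]
    conv_lhs => rw [h2, ← mul_assoc, T_mul_self hq hs, add_mul, one_mul, smul_mul_assoc, ← h2]

open Classical in
theorem T_mul_simple (hq : IsLengthMultiplicative b q) {s : affWeyl Φ} (hs : IsSimpleRefl b s)
    (w : affWeyl Φ) : T b q w * T b q s = T b q (w * s) +
      (if length b (w * s) < length b w then heckeCoeff q s else 0) • T b q w := by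
  have hL := isLengthSystem b
  have h1 := hL.len_simple hs
  rcases hL.mul_simple hs w with h | h
  · rw [if_neg (by omega), zero_smul, add_zero, T_mul (by omega)]
  · have h2 : T b q w = T b q (w * s) * T b q s := by
      rw [← T_mul (by rw [hL.mul_simple_cancel hs]; omega), hL.mul_simple_cancel hs]
    rw [if_pos (by omega)]
    conv_lhs => rw [h2, mul_assoc, T_mul_self hq hs, mul_add, mul_one, mul_smul_comm, ← h2]

/-! ### Generators -/

variable (b q) in
/-- The generators `T_j` (`1 ≤ j ≤ n`) and `Y^λ` of the affine Hecke algebra. -/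
def generators : Set (HeckeAlgebra b q) :=
  (fun j => T b q (refl Φ j 0)) '' b.support ∪ Set.range (Y b q)

omit [Φ.IsReduced] [Φ.IsIrreducible] in
theorem T_refl_mem_adjoin {j : ι} (hj : j ∈ b.support) :
    T b q (refl Φ j 0) ∈ Algebra.adjoin ℂ (generators b q) :=
  Algebra.subset_adjoin (Or.inl ⟨j, hj, rfl⟩)

omit [Φ.IsReduced] [Φ.IsIrreducible] in
theorem Y_mem_adjoin (l : weightLattice Φ) : Y b q l ∈ Algebra.adjoin ℂ (generators b q) :=
  Algebra.subset_adjoin (Or.inr ⟨l, rfl⟩)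

theorem T_finWeyl_mem_adjoin (hq : IsLengthMultiplicative b q) {w : affWeyl Φ}
    (hw : (w : V ≃ᵃ[ℝ] V) ∈ finWeyl Φ) : T b q w ∈ Algebra.adjoin ℂ (generators b q) ∧
      ∃ x ∈ Algebra.adjoin ℂ (generators b q), T b q w * x = 1 := by
  refine finWeyl_induction_left (b := b) (p := fun w => T b q w ∈ Algebra.adjoin ℂ (generators b q) ∧
      ∃ x ∈ Algebra.adjoin ℂ (generators b q), T b q w * x = 1) ?_ ?_ hw
  · rw [T_one]
    exact ⟨one_mem _, 1, one_mem _, one_mul 1⟩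
  · rintro j hj w - hl ⟨h1, x, hx, hwx⟩
    have hs : IsSimpleRefl b (refl Φ j 0) := Or.inr ⟨j, hj, rfl⟩
    rw [T_mul (by rw [hl, (isLengthSystem b).len_simple hs, add_comm])]
    refine ⟨mul_mem (T_refl_mem_adjoin hj) h1, x * (T b q (refl Φ j 0) -
      heckeCoeff q (refl Φ j 0) • 1), mul_mem hx (sub_mem (T_refl_mem_adjoin hj)
        (Subalgebra.smul_mem _ (one_mem _) _)), ?_⟩
    rw [mul_assoc, ← mul_assoc _ x, hwx, one_mul, mul_sub, T_mul_self hq hs, mul_smul_comm,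
      mul_one, add_sub_cancel_right]

/-- Writing $w=t_\lambda v$, the sign condition makes $\lambda$ dominant and
$\ell(t_\lambda)=\ell(w)+\ell(v^{-1})$, so $T_w=Y^\lambda T_{v^{-1}}^{-1}$. This covers both $s_0$
and the elements of length zero. -/
theorem T_mem_adjoin_of_crossing_nonneg (hq : IsLengthMultiplicative b q) {w : affWeyl Φ}
    (hw : ∀ i, b.IsPos i → 0 ≤ crossing b w i) :
    T b q w ∈ Algebra.adjoin ℂ (generators b q) := by
  obtain ⟨v, hv, hwv⟩ := exists_eq_trans_mul w
  set l := transPart w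
  have hcv : ∀ i, b.IsPos i → crossing b v i ≤ 0 := by
    intro i hi
    rw [crossing, transPart_of_mem_finWeyl hv, wtPair_zero, alcoveFloor_of_isPos hi]
    by_cases h : b.IsPos ((rootPerm v).symm i)
    · rw [alcoveFloor_of_isPos h]
      omega
    · rw [alcoveFloor_of_not_isPos h]
      omega
  have hc : ∀ i, crossing b w i = wtPair Φ i l + crossing b v i := by
    intro i
    rw [hwv, crossing_mul, crossing_trans, rootPerm_trans]
    rfl
  have hl : IsDominant b l := by
    rw [isDominant_iff]
    intro i hi
    have h1 := hw i hi
    have h2 := hcv i hi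
    rw [hc] at h1
    omega
  have hperm : rootPerm w = rootPerm v := by
    rw [hwv, rootPerm_mul, rootPerm_trans, one_mul]
  have hY : Y b q l = T b q w * T b q v⁻¹ := by
    rw [Y_of_isDominant hq hl, ← T_mul, hwv, mul_inv_cancel_right]
    refine length_mul_eq fun i hi => ?_
    rw [crossing_inv, hperm, Equiv.apply_symm_apply]
    exact mul_nonneg (hw i hi) (by have := hcv i hi; omega)
  obtain ⟨x, hx, hx'⟩ := (T_finWeyl_mem_adjoin (b := b) hq (w := v⁻¹)
    ((finWeyl Φ).inv_mem hv)).2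
  have : T b q w = Y b q l * x := by
    rw [hY, mul_assoc, hx', mul_one]
  rw [this]
  exact mul_mem (Y_mem_adjoin l) hx

theorem T_mem_adjoin (hq : IsLengthMultiplicative b q) (w : affWeyl Φ) :
    T b q w ∈ Algebra.adjoin ℂ (generators b q) := by
  have hL := isLengthSystem b
  refine hL.induction_left (p := fun w => T b q w ∈ Algebra.adjoin ℂ (generators b q))
    (fun w hw => ?_) (fun s hs w hl hw => ?_) w
  · exact T_mem_adjoin_of_crossing_nonneg hq fun i _ => (crossing_eq_zero hw i).ge
  · rw [T_mul (by rw [hl, hL.len_simple hs, add_comm])]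
    refine mul_mem ?_ hw
    rcases hs with ⟨i, hi, rfl⟩ | ⟨j, hj, rfl⟩
    · refine T_mem_adjoin_of_crossing_nonneg hq fun j hj => ?_
      rcases eq_or_ne j i with rfl | hji
      · rw [crossing_refl_self hj]
        omega
      · rw [crossing_refl_of_isHighestCoroot hi hj hji]
    · exact T_refl_mem_adjoin hj

/-- The affine Hecke algebra is generated by the `T_j` (`1 ≤ j ≤ n`) and the `Y^λ`. -/
theorem adjoin_generators (hq : IsLengthMultiplicative b q) :
    Algebra.adjoin ℂ (generators b q) = ⊤ := by
  refine Algebra.eq_top_iff.mpr fun x => ?_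
  obtain ⟨y, rfl⟩ := RingQuot.mkAlgHom_surjective ℂ (HeckeRel b q) x
  induction y using FreeAlgebra.induction with
  | grade0 r => rw [AlgHom.commutes]; exact Subalgebra.algebraMap_mem _ r
  | grade1 w => exact T_mem_adjoin hq w
  | mul x y hx hy => rw [map_mul]; exact mul_mem hx hy
  | add x y hx hy => rw [map_add]; exact add_mem hx hy

/-! ### The basis `T_w Y^λ` -/

variable (Φ) in
/-- Pairs of an element of the finite Weyl group and a weight. -/
abbrev PairIndex : Type _ := {v : affWeyl Φ // (v : V ≃ᵃ[ℝ] V) ∈ finWeyl Φ} × weightLattice Φ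

variable (b q) in
/-- The elements `T_w Y^λ`, for `w` in the finite Weyl group. -/
def TY (x : PairIndex Φ) : HeckeAlgebra b q := T b q x.1 * Y b q x.2

omit [Φ.IsReduced] [Φ.IsIrreducible] in
theorem exists_dominant_shift (s : Finset (PairIndex Φ)) :
    ∃ ν : weightLattice Φ, IsDominant b ν ∧ ∀ x ∈ s, IsDominant b (x.2 + ν) := by
  classical
  induction s using Finset.induction_on with
  | empty => exact ⟨0, fun i _ => by simp, by simp⟩
  | insert x s _ ih =>
    obtain ⟨ν, h1, h2⟩ := ih
    obtain ⟨⟨μ, κ⟩, h3, h4, h5⟩ := exists_dominant_sub b x.2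
    refine ⟨ν + κ, h1.add h4, fun y hy => ?_⟩
    rcases Finset.mem_insert.mp hy with rfl | hy
    · rw [h5, add_comm ν, ← add_assoc, sub_add_cancel]
      exact h3.add h1
    · rw [← add_assoc]
      exact (h2 y hy).add h4

/-- Right multiplication by $T_{t_\nu}$, with $\nu$ so dominant that each $\lambda+\nu$ occurring is
dominant, turns the $T_wY^\lambda$ into distinct elements $T_{wt_{\lambda+\nu}}$. -/
theorem linearIndependent_TY (hq : IsLengthMultiplicative b q) :
    LinearIndependent ℂ (TY b q) := by
  refine linearIndependent_iff'.mpr fun s g hg => ?_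
  obtain ⟨ν, hν, hs⟩ := exists_dominant_shift (b := b) s
  let f : PairIndex Φ → affWeyl Φ := fun x => x.1 * trans Φ (x.2 + ν)
  have hf : Function.Injective f := by
    rintro ⟨⟨v, hv⟩, l⟩ ⟨⟨w, hw⟩, m⟩ h
    have hperm := congrArg rootPerm h
    simp only [f, rootPerm_mul, rootPerm_trans, mul_one] at hperm
    have hvw : v = w := affWeyl_ext hperm (by
      rw [transPart_of_mem_finWeyl hv, transPart_of_mem_finWeyl hw])
    subst hvw
    have h2 := congrArg transPart (mul_left_cancel h)
    rw [transPart_trans, transPart_trans, add_left_inj] at h2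
    exact Prod.ext rfl h2
  have hT : ∀ x ∈ s, TY b q x * T b q (trans Φ ν) = T b q (f x) := by
    intro x hx
    rw [TY, mul_assoc, Y_mul_T_trans hq (hs x hx) hν (add_sub_cancel_right x.2 ν).symm,
      ← T_mul (length_mul_trans x.1.2 (hs x hx))]
  refine linearIndependent_iff'.mp ((linearIndependent_T hq).comp f hf) s g ?_
  have h := congrArg (· * T b q (trans Φ ν)) hg
  simp only [Finset.sum_mul, zero_mul, smul_mul_assoc] at h
  rw [← h]
  exact Finset.sum_congr rfl fun x hx => by rw [Function.comp_apply, hT x hx]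

/-- The Bernstein relation solved for the opposite order, by substituting $s_jx$ for $x$. -/
theorem YHom_mul_T (hq : IsLengthMultiplicative b q) {j : ι} (hj : j ∈ b.support)
    (x : GroupAlg Φ) : YHom hq x * T b q (refl Φ j 0) =
      T b q (refl Φ j 0) * YHom hq (reflAlg Φ j x) -
        heckeCoeff q (refl Φ j 0) • YHom hq (divDiff Φ j (reflAlg Φ j x)) := by
  have h : reflAlg Φ j (reflAlg Φ j x) = x := by
    refine LinearMap.congr_fun (f := reflAlg Φ j * reflAlg Φ j) (g := 1)
      (endo_ext Φ fun l => ?_) x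
    rw [Module.End.mul_apply, reflAlg_e, reflAlg_e, wtRefl_wtRefl]
    rfl
  rw [T_mul_YHom hq hj, h, add_sub_cancel_right]

theorem T_mul_YHom_mem_span (hq : IsLengthMultiplicative b q) {w : affWeyl Φ}
    (hw : (w : V ≃ᵃ[ℝ] V) ∈ finWeyl Φ) (x : GroupAlg Φ) :
    T b q w * YHom hq x ∈ Submodule.span ℂ (Set.range (TY b q)) := by
  refine e_induction (p := fun x => T b q w * YHom hq x ∈
    Submodule.span ℂ (Set.range (TY b q))) ?_ ?_ ?_ x
  · simp
  · intro x y hx hy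
    rw [map_add, mul_add]
    exact add_mem hx hy
  · intro l c
    rw [map_smul, mul_smul_comm, YHom_e]
    exact Submodule.smul_mem _ _ (Submodule.subset_span ⟨⟨⟨w, hw⟩, l⟩, rfl⟩)

theorem span_TY (hq : IsLengthMultiplicative b q) :
    Submodule.span ℂ (Set.range (TY b q)) = ⊤ := by
  classical
  set M := Submodule.span ℂ (Set.range (TY b q)) with hM
  -- The span contains $1$, so it suffices that it is a right ideal; this is tested on the
  -- generators.
  have key : ∀ g ∈ Algebra.adjoin ℂ (generators b q), ∀ h ∈ M, h * g ∈ M := by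
    intro g hg
    induction hg using Algebra.adjoin_induction with
    | mem g hg =>
      intro h hh
      induction hh using Submodule.span_induction with
      | mem h hh =>
        obtain ⟨⟨⟨w, hw⟩, l⟩, rfl⟩ := hh
        rcases hg with ⟨j, hj, rfl⟩ | ⟨m, rfl⟩
        · have hs : IsSimpleRefl b (refl Φ j 0) := Or.inr ⟨j, hj, rfl⟩
          change T b q w * Y b q l * T b q (refl Φ j 0) ∈ M
          rw [← YHom_e hq, mul_assoc, YHom_mul_T hq hj, mul_sub, ← mul_assoc,
            T_mul_simple hq hs, add_mul, smul_mul_assoc, mul_smul_comm]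
          exact sub_mem (add_mem
            (T_mul_YHom_mem_span hq ((finWeyl Φ).mul_mem hw (refl_mem_finWeyl j)) _)
            (M.smul_mem _ (T_mul_YHom_mem_span hq hw _)))
            (M.smul_mem _ (T_mul_YHom_mem_span hq hw _))
        · change T b q w * Y b q l * Y b q m ∈ M
          rw [mul_assoc, ← Y_add hq]
          exact Submodule.subset_span ⟨⟨⟨w, hw⟩, l + m⟩, rfl⟩
      | zero => rw [zero_mul]; exact zero_mem _
      | add x y _ _ hx hy => rw [add_mul]; exact add_mem hx hy
      | smul c x _ hx => rw [smul_mul_assoc]; exact M.smul_mem _ hx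
    | algebraMap r =>
      intro h hh
      rw [← Algebra.commutes, ← Algebra.smul_def]
      exact M.smul_mem _ hh
    | add x y _ _ hx hy =>
      intro h hh
      rw [mul_add]
      exact add_mem (hx h hh) (hy h hh)
    | mul x y _ _ hx hy =>
      intro h hh
      rw [← mul_assoc]
      exact hy _ (hx h hh)
  refine Submodule.eq_top_iff'.mpr fun x => ?_
  have h1 : (1 : HeckeAlgebra b q) ∈ M := by
    have := T_mul_YHom_mem_span hq (w := 1) (one_mem (finWeyl Φ)) 1
    rwa [T_one, map_one, mul_one] at this
  have := key x (by rw [adjoin_generators hq]; exact Algebra.mem_top) 1 h1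
  rwa [one_mul] at this

/-- The basis `T_w Y^λ` of the affine Hecke algebra. -/
def basisTY (hq : IsLengthMultiplicative b q) :
    Module.Basis (PairIndex Φ) ℂ (HeckeAlgebra b q) :=
  Module.Basis.mk (linearIndependent_TY hq) (span_TY hq).ge

theorem basisTY_apply (hq : IsLengthMultiplicative b q) (x : PairIndex Φ) :
    basisTY hq x = TY b q x :=
  Module.Basis.mk_apply _ _ x

end Basis

/-! ### The anti-involution and the basis $Y^\lambda T_w$. -/

section Star

variable {ι V N : Type*} [AddCommGroup V] [Module ℝ V] [AddCommGroup N] [Module ℝ N]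
  {Φ : RootPairing ι ℝ V N} [Φ.IsCrystallographic] {b : Φ.Base} {q : affWeyl Φ → ℝ}
  [Finite ι] [Φ.IsRootSystem] [Φ.IsReduced] [Φ.IsIrreducible]

variable (b q) in
/-- The elements `Y^λ T_w`, for `w` in the finite Weyl group. -/
def YT (x : PairIndex Φ) : HeckeAlgebra b q := Y b q x.2 * T b q x.1

/-- The antilinear map `T_w Y^λ ↦ Y^λ T_{w⁻¹}`. -/
def star (hq : IsLengthMultiplicative b q) :
    HeckeAlgebra b q →ₛₗ[starRingEnd ℂ] HeckeAlgebra b q :=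
  (Finsupp.linearCombination ℂ fun x : PairIndex Φ => Y b q x.2 * T b q (x.1 : affWeyl Φ)⁻¹).comp
    ((Finsupp.mapRange.linearMap (starLinearEquiv ℂ : ℂ ≃ₗ⋆[ℂ] ℂ).toLinearMap).comp
      (basisTY hq).repr.toLinearMap)

variable (hq : IsLengthMultiplicative b q)
include hq

theorem star_T_mul_Y {w : affWeyl Φ} (hw : (w : V ≃ᵃ[ℝ] V) ∈ finWeyl Φ) (l : weightLattice Φ) :
    star hq (T b q w * Y b q l) = Y b q l * T b q w⁻¹ := by
  have h : T b q w * Y b q l = basisTY hq ((⟨w, hw⟩, l) : PairIndex Φ) :=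
    (basisTY_apply hq ((⟨w, hw⟩, l) : PairIndex Φ)).symm
  rw [star, h]
  simp

theorem star_T {w : affWeyl Φ} (hw : (w : V ≃ᵃ[ℝ] V) ∈ finWeyl Φ) :
    star hq (T b q w) = T b q w⁻¹ := by
  have := star_T_mul_Y hq hw 0
  rwa [Y_zero hq, mul_one, one_mul] at this

theorem star_Y (l : weightLattice Φ) : star hq (Y b q l) = Y b q l := by
  have := star_T_mul_Y hq (w := 1) (one_mem (finWeyl Φ)) l
  rwa [inv_one, T_one, mul_one, one_mul] at this

theorem TY_induction {p : HeckeAlgebra b q → Prop} (h0 : p 0)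
    (hadd : ∀ x y, p x → p y → p (x + y)) (hsmul : ∀ (c : ℂ) x, p x → p (c • x))
    (h : ∀ w : affWeyl Φ, (w : V ≃ᵃ[ℝ] V) ∈ finWeyl Φ → ∀ l, p (T b q w * Y b q l))
    (x : HeckeAlgebra b q) : p x := by
  have hx : x ∈ Submodule.span ℂ (Set.range (TY b q)) := by
    rw [span_TY hq]
    exact Submodule.mem_top
  induction hx using Submodule.span_induction with
  | mem x hx => obtain ⟨⟨⟨w, hw⟩, l⟩, rfl⟩ := hx; exact h w hw l
  | zero => exact h0
  | add x y _ _ hx hy => exact hadd x y hx hy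
  | smul c x _ hx => exact hsmul c x hx

omit [Φ.IsCrystallographic] [Finite ι] [Φ.IsRootSystem] [Φ.IsReduced] [Φ.IsIrreducible] hq in
theorem conj_heckeCoeff (s : affWeyl Φ) :
    (starRingEnd ℂ) (heckeCoeff q s) = heckeCoeff q s := by
  rw [heckeCoeff, map_sub, map_inv₀, Complex.conj_ofReal]

/-- The set of elements `g` such that `(g h)^⋆ = h^⋆ g^⋆` for all `h`. -/
def IsAntiMul (g : HeckeAlgebra b q) : Prop :=
  ∀ h, star hq (g * h) = star hq h * star hq g

/-- The left and right multiplication rules for $T_j$ are mirror images under inversion: $\ell$ is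
inversion invariant and the coefficients are real. -/
theorem isAntiMul_T {j : ι} (hj : j ∈ b.support) : IsAntiMul hq (T b q (refl Φ j 0)) := by
  classical
  have hs : IsSimpleRefl b (refl Φ j 0) := Or.inr ⟨j, hj, rfl⟩
  refine TY_induction hq ?_ ?_ ?_ ?_
  · simp
  · intro x y hx hy
    rw [mul_add, map_add, map_add, add_mul, hx, hy]
  · intro c x hx
    rw [mul_smul_comm, LinearMap.map_smulₛₗ, LinearMap.map_smulₛₗ, smul_mul_assoc, hx]
  · intro w hw l
    have hlen : length b (refl Φ j 0 * w) = length b (w⁻¹ * refl Φ j 0) := by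
      rw [← length_inv, mul_inv_rev, inv_refl]
    rw [← mul_assoc, T_simple_mul hq hs, add_mul, smul_mul_assoc, map_add, LinearMap.map_smulₛₗ,
      star_T_mul_Y hq ((finWeyl Φ).mul_mem (refl_mem_finWeyl j) hw), star_T_mul_Y hq hw,
      star_T hq (refl_mem_finWeyl j), inv_refl, mul_assoc, T_mul_simple hq hs, mul_add,
      mul_smul_comm, mul_inv_rev, inv_refl, hlen, length_inv]
    congr 2
    split_ifs
    · exact conj_heckeCoeff _
    · exact map_zero _

theorem star_YHom_divDiff_e (j : ι) (l : weightLattice Φ) :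
    star hq (YHom hq (divDiff Φ j (e Φ l))) = YHom hq (divDiff Φ j (e Φ l)) := by
  rw [divDiff, onBasis_e]
  split_ifs
  · simp only [map_sum, YHom_e, star_Y]
  · simp only [map_zero]
  · simp only [map_neg, map_sum, YHom_e, star_Y]

/-- The mirror image of `YHom_mul_T`. On $e^\lambda$ it is the Bernstein relation again, because
$D_js_j=-D_j$. -/
theorem T_mul_star_YHom {j : ι} (hj : j ∈ b.support) (x : GroupAlg Φ) :
    T b q (refl Φ j 0) * star hq (YHom hq x) =
      star hq (YHom hq (reflAlg Φ j x)) * T b q (refl Φ j 0) -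
        heckeCoeff q (refl Φ j 0) • star hq (YHom hq (divDiff Φ j (reflAlg Φ j x))) := by
  refine e_induction (p := fun x => T b q (refl Φ j 0) * star hq (YHom hq x) =
      star hq (YHom hq (reflAlg Φ j x)) * T b q (refl Φ j 0) -
        heckeCoeff q (refl Φ j 0) • star hq (YHom hq (divDiff Φ j (reflAlg Φ j x)))) ?_ ?_ ?_ x
  · simp
  · intro x y hx hy
    simp only [map_add, mul_add, add_mul, smul_add]
    rw [hx, hy]
    abel
  · intro l c
    simp only [map_smul, LinearMap.map_smulₛₗ, mul_smul_comm, smul_mul_assoc]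
    rw [smul_comm (heckeCoeff q _), ← smul_sub]
    congr 1
    have h0 : divDiff Φ j (e Φ l) = -divDiff Φ j (e Φ (wtRefl Φ j l)) := by
      have := noZeroDivisors_groupAlg (Φ := Φ)
      refine mul_left_cancel₀ (one_sub_e_ne_zero j) ?_
      rw [mul_neg, one_sub_mul_divDiff, one_sub_mul_divDiff, reflAlg_e, reflAlg_e, wtRefl_wtRefl,
        neg_sub]
    have h := T_mul_YHom hq hj (e Φ l)
    rw [h0, map_neg, smul_neg, ← sub_eq_add_neg, reflAlg_e, YHom_e, YHom_e] at h
    rw [reflAlg_e, YHom_e, YHom_e, star_Y, star_Y, star_YHom_divDiff_e, h]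

/-- Induction on $w$: the Bernstein relation moves $Y(x)$ past the first $T_j$ for all $x$ at once,
and its mirror image reassembles the result. -/
theorem isAntiMul_YHom (x : GroupAlg Φ) : IsAntiMul hq (YHom hq x) := by
  have key : ∀ w : affWeyl Φ, (w : V ≃ᵃ[ℝ] V) ∈ finWeyl Φ → ∀ x l,
      star hq (YHom hq x * (T b q w * Y b q l)) =
        star hq (T b q w * Y b q l) * star hq (YHom hq x) := by
    intro w hw
    refine finWeyl_induction_left (b := b) (p := fun w => ∀ x l,
      star hq (YHom hq x * (T b q w * Y b q l)) =
        star hq (T b q w * Y b q l) * star hq (YHom hq x)) ?_ ?_ hw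
    · intro x l
      rw [T_one, one_mul, star_Y]
      refine e_induction (p := fun x => star hq (YHom hq x * Y b q l) =
        Y b q l * star hq (YHom hq x)) ?_ ?_ ?_ x
      · simp
      · intro x y hx hy
        rw [map_add, add_mul, map_add, map_add, mul_add, hx, hy]
      · intro m c
        rw [map_smul, smul_mul_assoc, LinearMap.map_smulₛₗ, LinearMap.map_smulₛₗ, mul_smul_comm,
          YHom_e, ← Y_add hq, star_Y, star_Y, add_comm, Y_add hq]
    · intro j hj w hw hl ih x l
      have hs : IsSimpleRefl b (refl Φ j 0) := Or.inr ⟨j, hj, rfl⟩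
      rw [T_mul (by rw [hl, (isLengthSystem b).len_simple hs, add_comm]), mul_assoc,
        isAntiMul_T hq hj, ← mul_assoc, YHom_mul_T hq hj, sub_mul, smul_mul_assoc, mul_assoc,
        map_sub, LinearMap.map_smulₛₗ, conj_heckeCoeff, isAntiMul_T hq hj, ih, ih,
        star_T hq (refl_mem_finWeyl j), inv_refl, mul_assoc _ (T b q (refl Φ j 0)),
        T_mul_star_YHom hq hj, mul_sub, mul_smul_comm, mul_assoc]
  refine TY_induction hq ?_ ?_ ?_ ?_
  · simp
  · intro y z hy hz
    rw [mul_add, map_add, map_add, add_mul, hy, hz]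
  · intro c y hy
    rw [mul_smul_comm, LinearMap.map_smulₛₗ, LinearMap.map_smulₛₗ, smul_mul_assoc, hy]
  · intro w hw l
    exact key w hw x l

theorem star_mul (g h : HeckeAlgebra b q) : star hq (g * h) = star hq h * star hq g := by
  have hg : g ∈ Algebra.adjoin ℂ (generators b q) := by
    rw [adjoin_generators hq]
    exact Algebra.mem_top
  have h1 : star hq 1 = 1 := by
    rw [← Y_zero hq, star_Y]
  induction hg using Algebra.adjoin_induction generalizing h with
  | mem g hg =>
    rcases hg with ⟨j, hj, rfl⟩ | ⟨l, rfl⟩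
    · exact isAntiMul_T hq hj h
    · have := isAntiMul_YHom hq (e Φ l) h
      rwa [YHom_e] at this
  | algebraMap r =>
    rw [Algebra.algebraMap_eq_smul_one, smul_mul_assoc, one_mul, LinearMap.map_smulₛₗ,
      LinearMap.map_smulₛₗ, h1, mul_smul_comm, mul_one]
  | add x y _ _ hx hy => rw [add_mul, map_add, map_add, mul_add, hx, hy]
  | mul x y _ _ hx hy => rw [mul_assoc, hx, hy, hx, mul_assoc]

theorem star_star (h : HeckeAlgebra b q) : star hq (star hq h) = h := by
  refine TY_induction hq (p := fun h => star hq (star hq h) = h) ?_ ?_ ?_ ?_ h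
  · simp
  · intro x y hx hy
    rw [map_add, map_add, hx, hy]
  · intro c x hx
    rw [LinearMap.map_smulₛₗ, LinearMap.map_smulₛₗ, hx, Complex.conj_conj]
  · intro w hw l
    rw [star_T_mul_Y hq hw, star_mul, star_Y, star_T hq ((finWeyl Φ).inv_mem hw), inv_inv]

theorem isStarInvolution_star : IsStarInvolution b q (star hq) :=
  ⟨star_mul hq, star_star hq, fun _ hw l => star_T_mul_Y hq hw l⟩

theorem IsStarInvolution.eq_star {σ : HeckeAlgebra b q →ₛₗ[starRingEnd ℂ] HeckeAlgebra b q}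
    (hσ : IsStarInvolution b q σ) : σ = star hq := by
  refine LinearMap.ext fun x => TY_induction hq (p := fun x => σ x = star hq x) ?_ ?_ ?_ ?_ x
  · simp
  · intro x y hx hy
    rw [map_add, map_add, hx, hy]
  · intro c x hx
    rw [LinearMap.map_smulₛₗ, LinearMap.map_smulₛₗ, hx]
  · intro w hw l
    rw [hσ.2.2 w hw, star_T_mul_Y hq hw]

/-! ### The basis `Y^λ T_w` -/

theorem star_YT (x : PairIndex Φ) : star hq (YT b q x) =
    TY b q (⟨(x.1 : affWeyl Φ)⁻¹, (finWeyl Φ).inv_mem x.1.2⟩, x.2) := by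
  rw [YT, star_mul, star_Y, star_T hq x.1.2, TY]

/-- The antilinear bijection $\star$ carries this family to $T_{w^{-1}}Y^\lambda$, a reindexing of
the basis already found. -/
theorem linearIndependent_YT : LinearIndependent ℂ (YT b q) := by
  refine linearIndependent_iff'.mpr fun s g hg x hx => ?_
  have hinj : Function.Injective fun x : PairIndex Φ =>
      ((⟨⟨(x.1 : affWeyl Φ)⁻¹, (finWeyl Φ).inv_mem x.1.2⟩, x.2⟩) : PairIndex Φ) := by
    rintro ⟨⟨v, hv⟩, l⟩ ⟨⟨w, hw⟩, m⟩ h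
    have h1 : v⁻¹ = w⁻¹ := congrArg (fun x : PairIndex Φ => (x.1 : affWeyl Φ)) h
    have h2 : l = m := congrArg (fun x : PairIndex Φ => x.2) h
    rw [inv_inj] at h1
    subst h1 h2
    rfl
  have h := congrArg (star hq) hg
  simp only [map_sum, LinearMap.map_smulₛₗ, star_YT, map_zero] at h
  exact (map_eq_zero (starRingEnd ℂ)).mp (linearIndependent_iff'.mp
    ((linearIndependent_TY hq).comp _ hinj) s (fun x => (starRingEnd ℂ) (g x)) h x hx)

theorem span_YT : Submodule.span ℂ (Set.range (YT b q)) = ⊤ := by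
  refine Submodule.eq_top_iff'.mpr fun x => ?_
  rw [← star_star hq x]
  refine TY_induction hq (p := fun x => star hq x ∈ Submodule.span ℂ (Set.range (YT b q)))
    ?_ ?_ ?_ ?_ (star hq x)
  · rw [map_zero]
    exact zero_mem _
  · intro x y hx hy
    rw [map_add]
    exact add_mem hx hy
  · intro c x hx
    rw [LinearMap.map_smulₛₗ]
    exact Submodule.smul_mem _ _ hx
  · intro w hw l
    rw [star_T_mul_Y hq hw]
    exact Submodule.subset_span ⟨(⟨w⁻¹, (finWeyl Φ).inv_mem hw⟩, l), rfl⟩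

/-- The basis `Y^λ T_w` of the affine Hecke algebra. -/
def basisYT : Module.Basis (PairIndex Φ) ℂ (HeckeAlgebra b q) :=
  Module.Basis.mk (linearIndependent_YT hq) (span_YT hq).ge

theorem basisYT_apply (x : PairIndex Φ) : basisYT hq x = YT b q x :=
  Module.Basis.mk_apply _ _ x

theorem YT_ext {M : Type*} [AddCommGroup M] [Module ℂ M] {f g : HeckeAlgebra b q →ₗ[ℂ] M}
    (h : ∀ w : affWeyl Φ, (w : V ≃ᵃ[ℝ] V) ∈ finWeyl Φ → ∀ l,
      f (Y b q l * T b q w) = g (Y b q l * T b q w)) : f = g := by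
  refine LinearMap.ext_on_range (v := YT b q) (span_YT hq) ?_
  rintro ⟨⟨w, hw⟩, l⟩
  exact h w hw l

end Star

/-! ### Adjoint operators for the pairing of $C(P)$ with $\mathbb C[P]$. -/

section Transpose

variable {ι V N : Type*} [AddCommGroup V] [Module ℝ V] [AddCommGroup N] [Module ℝ N]
  {Φ : RootPairing ι ℝ V N}

theorem pairing_e (f : weightLattice Φ → ℂ) (l : weightLattice Φ) :
    pairing Φ f (e Φ l) = f (-l) := by
  simp [pairing, e, transOp, LinearMap.funLeft]

theorem pairing_add_right (f : weightLattice Φ → ℂ) (x y : GroupAlg Φ) :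
    pairing Φ f (x + y) = pairing Φ f x + pairing Φ f y := by
  simp only [pairing, AddMonoidAlgebra.coeff_add]
  exact Finsupp.sum_add_index' (by simp) (by simp [add_mul])

theorem pairing_smul_right (f : weightLattice Φ → ℂ) (c : ℂ) (x : GroupAlg Φ) :
    pairing Φ f (c • x) = (starRingEnd ℂ) c * pairing Φ f x := by
  simp only [pairing, AddMonoidAlgebra.coeff_smul]
  rw [Finsupp.sum_smul_index (by simp), Finsupp.mul_sum]
  simp [mul_assoc]

variable (Φ) in
/-- The pairing with a fixed element of `C(P)`, as an antilinear map on `ℂ[P]`. -/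
def pairingHom (f : weightLattice Φ → ℂ) : GroupAlg Φ →ₛₗ[starRingEnd ℂ] ℂ where
  toFun := pairing Φ f
  map_add' := pairing_add_right f
  map_smul' := pairing_smul_right f

theorem pairing_add_left (f g : weightLattice Φ → ℂ) (x : GroupAlg Φ) :
    pairing Φ (f + g) x = pairing Φ f x + pairing Φ g x := by
  simp [pairing, mul_add, Finsupp.sum_add]

theorem pairing_smul_left (c : ℂ) (f : weightLattice Φ → ℂ) (x : GroupAlg Φ) :
    pairing Φ (c • f) x = c * pairing Φ f x := by
  simp only [pairing, map_smul, Pi.smul_apply, smul_eq_mul, Finsupp.mul_sum]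
  simp only [mul_left_comm]

/-- The operator on `C(P)` that is adjoint to an operator on `ℂ[P]`. -/
def transpose (A : Module.End ℂ (GroupAlg Φ)) : Module.End ℂ (weightLattice Φ → ℂ) where
  toFun f l := pairing Φ f (A (e Φ (-l)))
  map_add' f g := funext fun _ => pairing_add_left f g _
  map_smul' c f := funext fun _ => pairing_smul_left c f _

theorem transpose_apply (A : Module.End ℂ (GroupAlg Φ)) (f : weightLattice Φ → ℂ)
    (l : weightLattice Φ) : transpose A f l = pairing Φ f (A (e Φ (-l))) := rfl

theorem pairing_transpose (A : Module.End ℂ (GroupAlg Φ)) (f : weightLattice Φ → ℂ)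
    (x : GroupAlg Φ) : pairing Φ (transpose A f) x = pairing Φ f (A x) := by
  refine e_induction (p := fun x => pairing Φ (transpose A f) x = pairing Φ f (A x)) ?_ ?_ ?_ x
  · rw [map_zero]
    exact (map_zero (pairingHom Φ (transpose A f))).trans (map_zero (pairingHom Φ f)).symm
  · intro x y hx hy
    rw [map_add, pairing_add_right, pairing_add_right, hx, hy]
  · intro l c
    rw [map_smul, pairing_smul_right, pairing_smul_right, pairing_e, transpose_apply, neg_neg]

theorem transpose_mul (A B : Module.End ℂ (GroupAlg Φ)) :
    transpose (A * B) = transpose B * transpose A := by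
  refine LinearMap.ext fun f => funext fun l => ?_
  rw [Module.End.mul_apply, transpose_apply, transpose_apply, pairing_transpose]
  rfl

theorem transpose_one : transpose (1 : Module.End ℂ (GroupAlg Φ)) = 1 := by
  refine LinearMap.ext fun f => funext fun l => ?_
  rw [transpose_apply, Module.End.one_apply, Module.End.one_apply, pairing_e, neg_neg]

theorem transpose_add (A B : Module.End ℂ (GroupAlg Φ)) :
    transpose (A + B) = transpose A + transpose B :=
  LinearMap.ext fun f => funext fun _ => pairing_add_right f _ _

theorem transpose_smul (c : ℂ) (A : Module.End ℂ (GroupAlg Φ)) :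
    transpose (c • A) = (starRingEnd ℂ) c • transpose A :=
  LinearMap.ext fun f => funext fun _ => pairing_smul_right f _ _

theorem transpose_mulLeft_e (l : weightLattice Φ) :
    transpose (LinearMap.mulLeft ℂ (e Φ l)) = transOp Φ l := by
  refine LinearMap.ext fun f => funext fun m => ?_
  rw [transpose_apply, LinearMap.mulLeft_apply, e_mul_e, pairing_e, neg_add_rev, neg_neg,
    ← sub_eq_add_neg]
  rfl

variable [Φ.IsCrystallographic]

theorem wtRefl_neg (j : ι) (l : weightLattice Φ) : wtRefl Φ j (-l) = -wtRefl Φ j l := by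
  rw [wtRefl, wtRefl, wtPair_neg]
  module

theorem transpose_reflAlg (j : ι) : transpose (reflAlg Φ j) = reflOp Φ j := by
  refine LinearMap.ext fun f => funext fun l => ?_
  rw [transpose_apply, reflAlg_e, pairing_e, wtRefl_neg, neg_neg]
  rfl

/-- The value at $\lambda$ pairs with the image of $e^{-\lambda}$, so the cases of positive and
negative $\langle\lambda,\alpha_j^\vee\rangle$ are interchanged. -/
theorem transpose_divDiff (j : ι) : transpose (divDiff Φ j) = stringOp Φ j := by
  refine LinearMap.ext fun f => funext fun l => ?_
  have h : stringOp Φ j f l = if 0 < wtPair Φ j l then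
      -∑ k ∈ Finset.Icc 1 (wtPair Φ j l).toNat, f (l - k • rootWt Φ j)
    else if wtPair Φ j l = 0 then 0
    else ∑ k ∈ Finset.range (-wtPair Φ j l).toNat, f (l + k • rootWt Φ j) := rfl
  rw [h, transpose_apply, divDiff, onBasis_e, wtPair_neg]
  change pairingHom Φ f _ = _
  rcases lt_trichotomy (wtPair Φ j l) 0 with hl | hl | hl
  · rw [if_pos (by omega), if_neg (by omega), if_neg (by omega), map_sum]
    refine Finset.sum_congr rfl fun k _ => (pairing_e f _).trans (congrArg f ?_)
    abel
  · rw [if_neg (by omega), if_pos (by omega), if_neg (by omega), if_pos hl, map_zero]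
  · rw [if_neg (by omega), if_neg (by omega), if_pos hl, map_neg, map_sum, neg_neg]
    refine congrArg Neg.neg (Finset.sum_congr rfl fun k _ =>
      (pairing_e f _).trans (congrArg f ?_))
    abel

/-- The parameter must be real: taking adjoints conjugates coefficients. -/
theorem transpose_demazureLusztig (j : ι) (c : ℝ) :
    transpose (demazureLusztig Φ j c) = intReflOp Φ j c := by
  rw [demazureLusztig, intReflOp, transpose_add, transpose_smul, transpose_smul,
    transpose_reflAlg, transpose_divDiff, map_sub, map_inv₀, Complex.conj_ofReal]

end Transpose

/-! ### The two representations. -/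

section Representation

variable {ι V N : Type*} [AddCommGroup V] [Module ℝ V] [AddCommGroup N] [Module ℝ N]
  {Φ : RootPairing ι ℝ V N} [Φ.IsCrystallographic] {b : Φ.Base} {q : affWeyl Φ → ℝ}
  [Finite ι] [Φ.IsRootSystem] [Φ.IsReduced] [Φ.IsIrreducible]
  (hq : IsLengthMultiplicative b q)

/-- The projection `Y^λ T_w ↦ q_w e^λ` of the affine Hecke algebra onto `ℂ[P]`. -/
def toGroupAlg : HeckeAlgebra b q →ₗ[ℂ] GroupAlg Φ :=
  (basisYT hq).constr ℂ fun x => (q x.1 : ℂ) • e Φ x.2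

include hq

theorem toGroupAlg_Y_mul_T {w : affWeyl Φ} (hw : (w : V ≃ᵃ[ℝ] V) ∈ finWeyl Φ)
    (l : weightLattice Φ) : toGroupAlg hq (Y b q l * T b q w) = (q w : ℂ) • e Φ l := by
  have h : Y b q l * T b q w = basisYT hq ((⟨w, hw⟩, l) : PairIndex Φ) :=
    (basisYT_apply hq ((⟨w, hw⟩, l) : PairIndex Φ)).symm
  rw [toGroupAlg, h]
  exact Module.Basis.constr_basis _ _ _ _

/-- That $T_w\mapsto q_w$ is a character: when the length drops, $q_{ws}+(q_s-q_s^{-1})q_w=q_wq_s$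
because $q_w=q_{ws}q_s$. -/
theorem toGroupAlg_mul_T_simple {j : ι} (hj : j ∈ b.support) (h : HeckeAlgebra b q) :
    toGroupAlg hq (h * T b q (refl Φ j 0)) = (q (refl Φ j 0) : ℂ) • toGroupAlg hq h := by
  classical
  have hs : IsSimpleRefl b (refl Φ j 0) := Or.inr ⟨j, hj, rfl⟩
  have hL := isLengthSystem b
  have h1 := hL.len_simple hs
  refine LinearMap.congr_fun (f := (toGroupAlg hq).comp (LinearMap.mulRight ℂ (T b q (refl Φ j 0))))
    (g := (q (refl Φ j 0) : ℂ) • toGroupAlg hq) (YT_ext hq fun w hw l => ?_) h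
  rw [LinearMap.comp_apply, LinearMap.mulRight_apply, LinearMap.smul_apply,
    toGroupAlg_Y_mul_T hq hw, mul_assoc, T_mul_simple hq hs, mul_add, mul_smul_comm, map_add,
    map_smul, toGroupAlg_Y_mul_T hq hw,
    toGroupAlg_Y_mul_T hq ((finWeyl Φ).mul_mem hw (refl_mem_finWeyl j)), smul_smul, smul_smul,
    ← add_smul]
  congr 1
  rcases hL.mul_simple hs w with hl | hl
  · rw [if_neg (by omega), hq.map_mul _ _ (by omega)]
    push_cast
    ring
  · have h2 : q w = q (w * refl Φ j 0) * q (refl Φ j 0) := by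
      rw [← hq.map_mul _ _ (by rw [hL.mul_simple_cancel hs]; omega), hL.mul_simple_cancel hs]
    have h3 : (q (refl Φ j 0) : ℂ) ≠ 0 := Complex.ofReal_ne_zero.mpr (hq.ne_zero _)
    rw [if_pos (by omega), h2, heckeCoeff]
    push_cast
    field_simp
    ring

theorem toGroupAlg_mul_T {w : affWeyl Φ} (hw : (w : V ≃ᵃ[ℝ] V) ∈ finWeyl Φ)
    (h : HeckeAlgebra b q) :
    toGroupAlg hq (h * T b q w) = (q w : ℂ) • toGroupAlg hq h := by
  refine finWeyl_induction_left (b := b) (p := fun w => ∀ h,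
    toGroupAlg hq (h * T b q w) = (q w : ℂ) • toGroupAlg hq h) ?_ ?_ hw h
  · intro h
    rw [T_one, mul_one, hq.map_length_zero 1 (isLengthSystem b).one, Complex.ofReal_one, one_smul]
  · intro j hj w hw hl ih h
    have hs : IsSimpleRefl b (refl Φ j 0) := Or.inr ⟨j, hj, rfl⟩
    have hlen : length b (refl Φ j 0 * w) = length b (refl Φ j 0) + length b w := by
      rw [hl, (isLengthSystem b).len_simple hs, add_comm]
    rw [T_mul hlen, ← mul_assoc, ih, toGroupAlg_mul_T_simple hq hj, smul_smul,
      hq.map_mul _ _ hlen, Complex.ofReal_mul, mul_comm]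

theorem toGroupAlg_YHom (x : GroupAlg Φ) : toGroupAlg hq (YHom hq x) = x := by
  refine e_induction (p := fun x => toGroupAlg hq (YHom hq x) = x) ?_ ?_ ?_ x
  · rw [map_zero, map_zero]
  · intro x y hx hy
    rw [map_add, map_add, hx, hy]
  · intro l c
    have h := toGroupAlg_Y_mul_T hq (w := 1) (one_mem (finWeyl Φ)) l
    rw [T_one, mul_one, hq.map_length_zero 1 (isLengthSystem b).one, Complex.ofReal_one,
      one_smul] at h
    rw [map_smul, map_smul, YHom_e, h]

/-- Replacing $h$ by $Y$ of its projection does not change the class of $gh$: the kernel of the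
projection is a left ideal, so $\mathcal H$ acts on the quotient $\mathbb C[P]$. -/
theorem toGroupAlg_mul (g h : HeckeAlgebra b q) :
    toGroupAlg hq (g * YHom hq (toGroupAlg hq h)) = toGroupAlg hq (g * h) := by
  refine LinearMap.congr_fun (f := (toGroupAlg hq).comp ((LinearMap.mulLeft ℂ g).comp
      ((YHom hq).toLinearMap.comp (toGroupAlg hq))))
    (g := (toGroupAlg hq).comp (LinearMap.mulLeft ℂ g)) (YT_ext hq fun w hw l => ?_) h
  change toGroupAlg hq (g * YHom hq (toGroupAlg hq (Y b q l * T b q w))) =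
    toGroupAlg hq (g * (Y b q l * T b q w))
  rw [toGroupAlg_Y_mul_T hq hw, map_smul, YHom_e, mul_smul_comm, map_smul, ← mul_assoc,
    toGroupAlg_mul_T hq hw]

omit hq in
/-- The polynomial representation of the affine Hecke algebra on `ℂ[P]`. -/
def polynomialRep : HeckeAlgebra b q →ₐ[ℂ] Module.End ℂ (GroupAlg Φ) :=
  AlgHom.ofLinearMap
    { toFun := fun h => (toGroupAlg hq).comp
        ((LinearMap.mulLeft ℂ h).comp (YHom hq).toLinearMap)
      map_add' := fun g h => LinearMap.ext fun x => by
        change toGroupAlg hq ((g + h) * YHom hq x) =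
          toGroupAlg hq (g * YHom hq x) + toGroupAlg hq (h * YHom hq x)
        rw [add_mul, map_add]
      map_smul' := fun c h => LinearMap.ext fun x => by
        change toGroupAlg hq (c • h * YHom hq x) = c • toGroupAlg hq (h * YHom hq x)
        rw [smul_mul_assoc, map_smul] }
    (LinearMap.ext fun x => by
      change toGroupAlg hq (1 * YHom hq x) = x
      rw [one_mul, toGroupAlg_YHom])
    (fun g h => LinearMap.ext fun x => by
      change toGroupAlg hq (g * h * YHom hq x) =
        toGroupAlg hq (g * YHom hq (toGroupAlg hq (h * YHom hq x)))
      rw [toGroupAlg_mul, mul_assoc])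

theorem polynomialRep_apply (h : HeckeAlgebra b q) (x : GroupAlg Φ) :
    polynomialRep hq h x = toGroupAlg hq (h * YHom hq x) := rfl

/-- Projecting the Bernstein relation replaces the right factor $T_j$ by $q_j$, leaving
$q_js_j+(q_j-q_j^{-1})D_j$. -/
theorem isPolynomialRep_polynomialRep : IsPolynomialRep b q (polynomialRep hq) := by
  refine ⟨fun j hj => LinearMap.ext fun x => ?_, fun l => LinearMap.ext fun x => ?_⟩
  · rw [polynomialRep_apply, T_mul_YHom hq hj, map_add, map_smul, toGroupAlg_mul_T_simple hq hj,
      toGroupAlg_YHom, toGroupAlg_YHom]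
    rfl
  · rw [polynomialRep_apply, ← YHom_e hq, ← map_mul, toGroupAlg_YHom, LinearMap.mulLeft_apply]

/-- The integral-reflection representation of the affine Hecke algebra on `C(P)`. -/
def intReflRep : HeckeAlgebra b q →ₐ[ℂ] Module.End ℂ (weightLattice Φ → ℂ) :=
  AlgHom.ofLinearMap
    { toFun := fun h => transpose (polynomialRep hq (star hq h))
      map_add' := fun g h => by rw [map_add, map_add, transpose_add]
      map_smul' := fun c h => by
        rw [LinearMap.map_smulₛₗ, map_smul, transpose_smul, Complex.conj_conj, RingHom.id_apply] }
    (by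
      change transpose (polynomialRep hq (star hq 1)) = 1
      rw [← Y_zero hq, star_Y, Y_zero hq, map_one, transpose_one])
    (fun g h => by
      change transpose (polynomialRep hq (star hq (g * h))) =
        transpose (polynomialRep hq (star hq g)) * transpose (polynomialRep hq (star hq h))
      rw [star_mul, map_mul, transpose_mul])

theorem intReflRep_apply (h : HeckeAlgebra b q) :
    intReflRep hq h = transpose (polynomialRep hq (star hq h)) := rfl

theorem isIntReflRep_intReflRep : IsIntReflRep b q (intReflRep hq) := by
  obtain ⟨h1, h2⟩ := isPolynomialRep_polynomialRep hq
  refine ⟨fun j hj => ?_, fun l => ?_⟩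
  · rw [intReflRep_apply, star_T hq (refl_mem_finWeyl j), inv_refl, h1 j hj,
      transpose_demazureLusztig]
  · rw [intReflRep_apply, star_Y, h2, transpose_mulLeft_e]

theorem algHom_ext_of_generators {A : Type*} [Semiring A] [Algebra ℂ A]
    {f g : HeckeAlgebra b q →ₐ[ℂ] A}
    (hT : ∀ j ∈ b.support, f (T b q (refl Φ j 0)) = g (T b q (refl Φ j 0)))
    (hY : ∀ l, f (Y b q l) = g (Y b q l)) : f = g := by
  refine AlgHom.ext_of_adjoin_eq_top (adjoin_generators hq) ?_
  rintro _ (⟨j, hj, rfl⟩ | ⟨l, rfl⟩)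
  · exact hT j hj
  · exact hY l

theorem IsPolynomialRep.eq_polynomialRep {R : HeckeAlgebra b q →ₐ[ℂ] Module.End ℂ (GroupAlg Φ)}
    (hR : IsPolynomialRep b q R) : R = polynomialRep hq := by
  have h := isPolynomialRep_polynomialRep hq
  exact algHom_ext_of_generators hq (fun j hj => (hR.1 j hj).trans (h.1 j hj).symm)
    fun l => (hR.2 l).trans (h.2 l).symm

theorem IsIntReflRep.eq_intReflRep
    {I : HeckeAlgebra b q →ₐ[ℂ] Module.End ℂ (weightLattice Φ → ℂ)}
    (hI : IsIntReflRep b q I) : I = intReflRep hq := by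
  have h := isIntReflRep_intReflRep hq
  exact algHom_ext_of_generators hq (fun j hj => (hI.1 j hj).trans (h.1 j hj).symm)
    fun l => (hI.2 l).trans (h.2 l).symm

end Representation

end AffineHecke

end

theorem mainTheorem2 {ι V N : Type*} [Finite ι] [AddCommGroup V] [Module ℝ V]
    [AddCommGroup N] [Module ℝ N] (Φ : RootPairing ι ℝ V N) [Φ.IsRootSystem]
    [Φ.IsCrystallographic] [Φ.IsReduced] [Φ.IsIrreducible] (b : Φ.Base)
    (q : AffineHecke.affWeyl Φ → ℝ) (hq : AffineHecke.IsLengthMultiplicative b q) :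
    (∃! I : AffineHecke.HeckeAlgebra b q →ₐ[ℂ]
        Module.End ℂ (AffineHecke.weightLattice Φ → ℂ), AffineHecke.IsIntReflRep b q I) ∧
    (∃! R : AffineHecke.HeckeAlgebra b q →ₐ[ℂ]
        Module.End ℂ (AffineHecke.GroupAlg Φ), AffineHecke.IsPolynomialRep b q R) ∧
    (∃! σ : AffineHecke.HeckeAlgebra b q →ₛₗ[starRingEnd ℂ] AffineHecke.HeckeAlgebra b q,
        AffineHecke.IsStarInvolution b q σ) ∧
    ∀ I R σ, AffineHecke.IsIntReflRep b q I → AffineHecke.IsPolynomialRep b q R →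
      AffineHecke.IsStarInvolution b q σ →
      ∀ (h : AffineHecke.HeckeAlgebra b q) (f : AffineHecke.weightLattice Φ → ℂ)
        (p : AffineHecke.GroupAlg Φ),
        AffineHecke.pairing Φ (I h f) p = AffineHecke.pairing Φ f (R (σ h) p) := by
  refine ⟨⟨_, AffineHecke.isIntReflRep_intReflRep hq, fun I hI => hI.eq_intReflRep hq⟩,
    ⟨_, AffineHecke.isPolynomialRep_polynomialRep hq, fun R hR => hR.eq_polynomialRep hq⟩,
    ⟨_, AffineHecke.isStarInvolution_star hq, fun σ hσ => hσ.eq_star hq⟩, ?_⟩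
  intro I R σ hI hR hσ h f p
  -- By uniqueness only the constructed maps matter, and for them $I(h)$ is by definition the
  -- adjoint of $\check T(h^\star)$.
  rw [hI.eq_intReflRep hq, hR.eq_polynomialRep hq, hσ.eq_star hq, AffineHecke.intReflRep_apply,
    AffineHecke.pairing_transpose]
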